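/- **Setting.** Let $\Omega\subseteq\mathbb R^n$ be open. Nets are indexed by $\varepsilon\in(0,1]$, and $O(\cdot)$ refers to $\varepsilon\to0$. For a complex vector space $E$ with a family of seminorms $(p_i)_i$, let $\mathcal M_E$ be the set of nets $(u_\varepsilon)_\varepsilon$ in $E$ with $\forall i\,\exists N:\ p_i(u_\varepsilon)=O(\varepsilon^{-N})$, let $\mathcal N_E$ be the set of nets with $\forall i\,\forall q:\ p_i(u_\varepsilon)=O(\varepsilon^{q})$, and put $\mathcal G_E=\mathcal M_E/\mathcal N_E$. Put $\widetilde{\mathbb C}=\mathcal G_{\mathbb C}$ (a ring; each $\mathcal G_E$ is a $\widetilde{\mathbb C}$-module), $\mathcal G(\Omega)=\mathcal G_{C^\infty(\Omega)}$ with the seminorms $p_{K,j}(f)=\sup_{x\in K,|\alpha|\le j}|\partial^\alpha f(x)|$, $K\Subset\Omega$, $j\in\mathbb N$, and $\mathcal G_{\mathscr S}(\mathbb R^n)=\mathcal G_{\mathscr S(\mathbb R^n)}$. Let $\mathcal G_\tau(\mathbb R^n)$ be the quotient of the nets in $\mathcal O_M(\mathbb R^n)$ with $\forall\alpha\,\exists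 N:\ \sup_x(1+|x|)^{-N}|\partial^\alpha u_\varepsilon(x)|=O(\varepsilon^{-N})$ by those with $\forall\alpha\,\exists N\,\forall q:\ \sup_x(1+|x|)^{-N}|\partial^\alpha u_\varepsilon(x)|=O(\varepsilon^{q})$. The support of $u\in\mathcal G(\Omega)$ is the complement in $\Omega$ of the largest open set on which $u$ is $0$; $\mathcal G_c(\Omega)$ is the submodule of elements with compact support, and $\mathcal G_K(\Omega)$ that of elements with support in $K\Subset\Omega$. The regular elements are: $\mathcal G^\infty(\Omega)$, the classes of nets with $\forall K\,\exists N\,\forall j:\ p_{K,j}(u_\varepsilon)=O(\varepsilon^{-N})$; $\mathcal G_c^\infty(\Omega)=\mathcal G^\infty(\Omega)\cap\mathcal G_c(\Omega)$; and $\mathcal G^\infty_{\mathscr S}(\mathbb R^n)$, the classes of nets in $\mathscr S(\mathbb R^n)$ for which one $N$ satisfies $p(u_\varepsilon)=O(\varepsilon^{-N})$ for all Schwartz seminorms $p$. Each $\mathcal G_E$ carries the sharp topology, given by the ultra-pseudo-seminorms $e^{-v_i(u)}$, $v_i(u)=\sup\{b\in\mathbb R:\ p_i(u_\varepsilon)=O(\varepsilon^b)\}$;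 $\mathcal G_c(\Omega)$ carries the inductive limit topology (the finest locally convex $\widetilde{\mathbb C}$-module topology making all inclusions $\mathcal G_K(\Omega)\to\mathcal G_c(\Omega)$ continuous, where $\mathcal G_K(\Omega)$ has the topology induced by $\mathcal G(\Omega)$). $L(\cdot,\widetilde{\mathbb C})$ denotes the space of continuous $\widetilde{\mathbb C}$-linear functionals. *Functionals.* For $u\in\mathcal G(\Omega)$ and $v\in\mathcal G_c(\Omega)$ put $\int_\Omega uv=[(\int_K u_\varepsilon v_\varepsilon\,dx)_\varepsilon]$ for any $K\Subset\Omega$ containing $\operatorname{supp}v$ in its interior; for $u\in\mathcal G_\tau(\mathbb R^n)$, $v\in\mathcal G_{\mathscr S}(\mathbb R^n)$ put $\int uv=[(\int_{\mathbb R^n}u_\varepsilon v_\varepsilon\,dx)_\varepsilon]$. Integration maps $\mathcal G(\Omega)\to L(\mathcal G_c(\Omega),\widetilde{\mathbb C})$, $\mathcal G_c(\Omega)\to L(\mathcal G(\Omega),\widetilde{\mathbb C})$, $\mathcal G_\tau(\mathbb R^n)\to L(\mathcal G_{\mathscr S}(\mathbb R^n),\widetilde{\mathbb C})$. For $V\subseteq\Omega$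 open and $T\in L(\mathcal G_c(\Omega),\widetilde{\mathbb C})$, $T|_V$ is the restriction of $T$ to $\mathcal G_c(V)=\{u\in\mathcal G_c(\Omega):\operatorname{supp}u\subseteq V\}$; $\operatorname{supp}T$ is the complement in $\Omega$ of the set of points with an open neighbourhood $V\subseteq\Omega$ such that $T|_V=0$; $\operatorname{sing\,supp}_gT$ is the complement in $\Omega$ of the set of points with an open neighbourhood $V\subseteq\Omega$ such that $T|_V$ is integration against some $v\in\mathcal G^\infty(V)$. For $u\in\mathcal G(\Omega)$, $\operatorname{sing\,supp}_gu$ is the complement in $\Omega$ of the set of points with an open neighbourhood $V\subseteq\Omega$ such that $u|_V\in\mathcal G^\infty(V)$. *Embeddings.* Fix a mollifier $\varphi\in\mathscr S(\mathbb R^n)$ with $\int\varphi=1$ and $\int y^\alpha\varphi(y)\,dy=0$ for all $\alpha\ne0$; $\varphi_\varepsilon(x)=\varepsilon^{-n}\varphi(x/\varepsilon)$. The direct functional is $\iota_d(w)(u)=[(w(u_\varepsilon))_\varepsilon]$; it lies in $L(\mathcal G_c(\Omega),\widetilde{\mathbb C})$ for $w\in\mathcal D'(\Omega)$ (with representatives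 of $u$ supported in one fixed compact subset of $\Omega$), in $L(\mathcal G(\Omega),\widetilde{\mathbb C})$ for $w\in\mathcal E'(\Omega)$, in $L(\mathcal G_{\mathscr S}(\mathbb R^n),\widetilde{\mathbb C})$ for $w\in\mathscr S'(\mathbb R^n)$. The Colombeau embedding is $\iota(w)=[((w*\varphi_\varepsilon)|_\Omega)_\varepsilon]\in\mathcal G_c(\Omega)$ for $w\in\mathcal E'(\Omega)$; $\iota(w)=[(w*\varphi_\varepsilon)_\varepsilon]\in\mathcal G_\tau(\mathbb R^n)$ for $w\in\mathscr S'(\mathbb R^n)$; and for $w\in\mathcal D'(\Omega)$, $\iota(w)\in\mathcal G(\Omega)$ is the element with $\iota(w)|_V=[((\psi w*\varphi_\varepsilon)|_V)_\varepsilon]$ for all open $V\subseteq\Omega$ and $\psi\in\mathcal D(\Omega)$ with $\psi=1$ on $V$. In each case $\iota'(w)$ is the integration functional given by $\iota(w)$. **Proposition.** For every open $\Omega\subseteq\mathbb R^n$ and every such $\varphi$, the elements $\iota(w)$ and the functionals $\iota_d(w),\iota'(w)$ are well defined (they exist in the stated spaces and are unique), and: (i) for all $w\in\mathcal D'(\Omega)$,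 $\iota_d(w),\iota'(w)\in L(\mathcal G_c(\Omega),\widetilde{\mathbb C})$ coincide on $\mathcal G_c^\infty(\Omega)$; (ii) for all $w\in\mathcal E'(\Omega)$, $\iota_d(w),\iota'(w)\in L(\mathcal G(\Omega),\widetilde{\mathbb C})$ coincide on $\mathcal G^\infty(\Omega)$; (iii) for all $w\in\mathscr S'(\mathbb R^n)$, $\iota_d(w),\iota'(w)\in L(\mathcal G_{\mathscr S}(\mathbb R^n),\widetilde{\mathbb C})$ coincide on $\mathcal G^\infty_{\mathscr S}(\mathbb R^n)$; (iv) for all $w\in\mathcal D'(\Omega)$, $$\operatorname{supp}w=\operatorname{supp}\iota(w)=\operatorname{supp}\iota'(w)=\operatorname{supp}\iota_d(w),$$ $$\operatorname{sing\,supp}w=\operatorname{sing\,supp}_g\iota(w)=\operatorname{sing\,supp}_g\iota'(w)=\operatorname{sing\,supp}_g\iota_d(w).$$ -/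

import Mathlib

open TopologicalSpace MeasureTheory Asymptotics Filter
open scoped ContDiff Distributions SchwartzMap Topology

namespace Colombeau

noncomputable section

/-! ### Nets in `ε ∈ (0,1]` and the ring of complex generalized numbers -/

/-- The parameter set `(0,1]`. -/
abbrev Eps : Type := Set.Ioc (0 : ℝ) 1

/-- The filter `ε → 0` on `(0,1]`. -/
def toZero : Filter Eps := comap Subtype.val (𝓝 (0 : ℝ))

/-- The net `(ε ^ b)_ε`. -/
def powNet (b : ℝ) : Eps → ℝ := fun ε => (ε : ℝ) ^ b

theorem powNet_isBigO {b c : ℝ} (h : c ≤ b) : powNet b =O[toZero] powNet c := by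
  refine IsBigO.of_bound 1 (Eventually.of_forall fun ε => ?_)
  have h0 : (0 : ℝ) < ε := ε.2.1
  rw [one_mul, powNet, powNet, Real.norm_of_nonneg (Real.rpow_nonneg h0.le _),
    Real.norm_of_nonneg (Real.rpow_nonneg h0.le _)]
  exact Real.rpow_le_rpow_of_exponent_ge h0 ε.2.2 h

theorem powNet_mul (b c : ℝ) : (fun ε => powNet b ε * powNet c ε) = powNet (b + c) := by
  funext ε
  exact (Real.rpow_add ε.2.1 b c).symm

/-- Moderate nets of complex numbers. -/
def modNets : Subring (Eps → ℂ) where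
  carrier := {a | ∃ N : ℕ, a =O[toZero] powNet (-(N : ℝ))}
  zero_mem' := ⟨0, isBigO_zero _ _⟩
  one_mem' := by
    refine ⟨0, IsBigO.of_bound 1 (Eventually.of_forall fun ε => ?_)⟩
    simp [powNet]
  neg_mem' := by
    rintro a ⟨N, h⟩
    exact ⟨N, h.neg_left⟩
  add_mem' := by
    rintro a b ⟨N, h⟩ ⟨M, k⟩
    refine ⟨N + M, IsBigO.add (h.trans (powNet_isBigO ?_)) (k.trans (powNet_isBigO ?_))⟩ <;>
      · push_cast
        have := Nat.cast_nonneg (α := ℝ) N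
        have := Nat.cast_nonneg (α := ℝ) M
        linarith
  mul_mem' := by
    rintro a b ⟨N, h⟩ ⟨M, k⟩
    refine ⟨N + M, (h.mul k).trans ?_⟩
    rw [powNet_mul]
    exact powNet_isBigO (by push_cast; linarith)

/-- Negligible nets of complex numbers. -/
def neglNets : Ideal modNets where
  carrier := {a | ∀ q : ℕ, (a : Eps → ℂ) =O[toZero] powNet q}
  zero_mem' := fun _ => isBigO_zero _ _
  add_mem' := fun ha hb q => (ha q).add (hb q)
  smul_mem' := by
    rintro ⟨c, N, hc⟩ a ha q
    refine (hc.mul (ha (q + N))).trans ?_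
    rw [powNet_mul]
    exact powNet_isBigO (by push_cast; linarith)

/-- The ring `ℂ~` of complex generalized numbers: moderate nets modulo negligible nets. -/
def GenNumber : Type := modNets ⧸ neglNets

instance : CommRing GenNumber := inferInstanceAs (CommRing (modNets ⧸ neglNets))

/-- The class of a moderate net. -/
def GenNumber.mk (a : modNets) : GenNumber := Ideal.Quotient.mk neglNets a

/-- `z` is the class of the net `a` (in particular `a` is moderate). -/
def GenNumber.IsRep (z : GenNumber) (a : Eps → ℂ) : Prop :=
  ∃ h : a ∈ modNets, GenNumber.mk ⟨a, h⟩ = z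

/-- The ultra-pseudo-norm `|z|_e = exp (-v(z))`, where `v(z)` is the supremum of all real `b` with
`|z_ε| = O(ε ^ b)`. -/
def GenNumber.absE (z : GenNumber) : ℝ :=
  sInf {r | ∃ (a : Eps → ℂ) (b : ℝ), z.IsRep a ∧ a =O[toZero] powNet b ∧ r = Real.exp (-b)}

/-- The sharp topology on `ℂ~`. -/
instance : TopologicalSpace GenNumber :=
  generateFrom {B | ∃ (z : GenNumber) (r : ℝ), 0 < r ∧ B = {y | (y - z).absE < r}}

/-! ### The `ℂ~`-module of generalized functions based on a space with a family of seminorms -/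

section General

variable {F ι : Type} [AddCommGroup F] [Module ℂ F] (p : SeminormFamily ℂ F ι)

/-- Moderate nets in `F`. -/
def modE : Submodule modNets (Eps → F) where
  carrier := {u | ∀ i, ∃ N : ℕ, (fun ε => p i (u ε)) =O[toZero] powNet (-(N : ℝ))}
  zero_mem' := fun i => ⟨0, by simpa using isBigO_zero _ _⟩
  add_mem' := by
    intro u v hu hv i
    obtain ⟨N, h⟩ := hu i
    obtain ⟨M, k⟩ := hv i
    refine ⟨N + M, IsBigO.trans (IsBigO.of_bound 1 (Eventually.of_forall fun ε => ?_))
      (IsBigO.add (h.trans (powNet_isBigO ?_)) (k.trans (powNet_isBigO ?_)))⟩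
    · rw [one_mul, Real.norm_of_nonneg (apply_nonneg _ _),
        Real.norm_of_nonneg (add_nonneg (apply_nonneg _ _) (apply_nonneg _ _))]
      exact map_add_le_add _ _ _
    all_goals
      push_cast
      have := Nat.cast_nonneg (α := ℝ) N
      have := Nat.cast_nonneg (α := ℝ) M
      linarith
  smul_mem' := by
    rintro ⟨c, N, hc⟩ u hu i
    obtain ⟨M, k⟩ := hu i
    refine ⟨N + M, ?_⟩
    have : (fun ε => p i (((⟨c, N, hc⟩ : modNets) • u) ε)) = fun ε => ‖c ε‖ * p i (u ε) := by
      funext ε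
      exact map_smul_eq_mul (p i) (c ε) (u ε)
    rw [this]
    refine (hc.norm_left.mul k).trans ?_
    rw [powNet_mul]
    exact powNet_isBigO (by push_cast; linarith)

/-- Negligible nets in `F`. -/
def neglE : Submodule modNets (modE p) where
  carrier := {u | ∀ i, ∀ q : ℕ, (fun ε => p i ((u : Eps → F) ε)) =O[toZero] powNet q}
  zero_mem' := fun i q => by simpa using isBigO_zero _ _
  add_mem' := by
    intro u v hu hv i q
    refine IsBigO.trans (IsBigO.of_bound 1 (Eventually.of_forall fun ε => ?_))
      ((hu i q).add (hv i q))
    rw [one_mul, Real.norm_of_nonneg (apply_nonneg _ _),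
      Real.norm_of_nonneg (add_nonneg (apply_nonneg _ _) (apply_nonneg _ _))]
    exact map_add_le_add _ _ _
  smul_mem' := by
    rintro ⟨c, N, hc⟩ u hu i q
    have : (fun ε => p i ((((⟨c, N, hc⟩ : modNets) • u : modE p) : Eps → F) ε))
        = fun ε => ‖c ε‖ * p i ((u : Eps → F) ε) := by
      funext ε
      exact map_smul_eq_mul (p i) (c ε) ((u : Eps → F) ε)
    rw [this]
    refine (hc.norm_left.mul (hu i (q + N))).trans ?_
    rw [powNet_mul]
    exact powNet_isBigO (by push_cast; linarith)

/-- Moderate nets modulo negligible nets. -/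
def GE : Type := modE p ⧸ neglE p

instance : AddCommGroup (GE p) := inferInstanceAs (AddCommGroup (modE p ⧸ neglE p))

instance : Module modNets (GE p) := inferInstanceAs (Module modNets (modE p ⧸ neglE p))

theorem GE.isTorsionBySet : Module.IsTorsionBySet modNets (GE p) neglNets := by
  rintro x ⟨⟨c, hcm⟩, hc⟩
  obtain ⟨u, rfl⟩ := Submodule.Quotient.mk_surjective (neglE p) x
  change Submodule.Quotient.mk ((⟨c, hcm⟩ : modNets) • u) = _
  refine (Submodule.Quotient.mk_eq_zero _).2 fun i q => ?_
  have : (fun ε => p i ((((⟨c, hcm⟩ : modNets) • u : modE p) : Eps → F) ε))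
      = fun ε => ‖c ε‖ * p i ((u : Eps → F) ε) := by
    funext ε
    exact map_smul_eq_mul (p i) (c ε) ((u : Eps → F) ε)
  obtain ⟨N, hN⟩ := u.2 i
  rw [this]
  refine ((hc (q + N)).norm_left.mul hN).trans ?_
  rw [powNet_mul]
  exact powNet_isBigO (by push_cast; linarith)

/-- The `ℂ~`-module structure, `[(c_ε)_ε] • [(u_ε)_ε] = [(c_ε u_ε)_ε]`. -/
instance : Module GenNumber (GE p) := (GE.isTorsionBySet p).module

variable {p}

/-- The class of a moderate net. -/
def GE.mk (u : modE p) : GE p := Submodule.Quotient.mk (p := neglE p) u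

/-- `z` is the class of the net `u` (in particular `u` is moderate). -/
def GE.IsRep (z : GE p) (u : Eps → F) : Prop := ∃ h : u ∈ modE p, GE.mk ⟨u, h⟩ = z

/-- The ultra-pseudo-seminorm `exp (-v_i(z))`, where `v_i(z)` is the supremum of all real `b` with
`p_i(u_ε) = O(ε ^ b)`. -/
def GE.upsn (i : ι) (z : GE p) : ℝ :=
  sInf {r | ∃ (u : Eps → F) (b : ℝ), z.IsRep u ∧
    (fun ε => p i (u ε)) =O[toZero] powNet b ∧ r = Real.exp (-b)}

/-- The sharp topology, given by the ultra-pseudo-seminorms. -/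
instance : TopologicalSpace (GE p) :=
  generateFrom {B | ∃ (i : ι) (z : GE p) (r : ℝ), 0 < r ∧ B = {y | GE.upsn i (y - z) < r}}

end General

/-- A topology on a `ℂ~`-module for which the module operations are continuous and `0` has a base of
neighbourhoods that are `ℂ~`-convex and balanced. -/
def IsLocallyConvexTopology {M : Type} [AddCommGroup M] [Module GenNumber M]
    (t : TopologicalSpace M) : Prop :=
  ContinuousAdd M ∧ ContinuousSMul GenNumber M ∧
    ∀ U ∈ 𝓝 (0 : M), ∃ W ∈ 𝓝 (0 : M), W ⊆ U ∧ (∀ x ∈ W, ∀ y ∈ W, x + y ∈ W) ∧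
      ∀ c : GenNumber, c.absE ≤ 1 → ∀ x ∈ W, c • x ∈ W

/-! ### Smooth functions and the algebra `𝓖(Ω)` -/

/-- Euclidean space. -/
abbrev Eu (n : ℕ) : Type := EuclideanSpace ℝ (Fin n)

variable {n : ℕ}

/-- Functions that are smooth on `Ω`. -/
def smoothSub (Ω : Opens (Eu n)) : Submodule ℂ (Eu n → ℂ) where
  carrier := {f | ContDiffOn ℝ ∞ f Ω}
  zero_mem' := contDiffOn_const
  add_mem' := fun hf hg => ContDiffOn.add hf hg
  smul_mem' := fun c _ hf => ContDiffOn.const_smul c hf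

/-- Smooth functions on `Ω`, written as functions on the whole space; the values outside `Ω` are
irrelevant, because everything below sees a function on a neighbourhood of points of `Ω` only. -/
def SmoothOn (Ω : Opens (Eu n)) : Type := smoothSub Ω

instance (Ω : Opens (Eu n)) : AddCommGroup (SmoothOn Ω) :=
  inferInstanceAs (AddCommGroup (smoothSub Ω))

instance (Ω : Opens (Eu n)) : Module ℂ (SmoothOn Ω) := inferInstanceAs (Module ℂ (smoothSub Ω))

instance (Ω : Opens (Eu n)) : CoeFun (SmoothOn Ω) (fun _ => Eu n → ℂ) := ⟨fun f => f.1⟩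

theorem SmoothOn.contDiffAt {Ω : Opens (Eu n)} (f : SmoothOn Ω) {x : Eu n} (hx : x ∈ Ω) :
    ContDiffAt ℝ ∞ f x :=
  ContDiffOn.contDiffAt f.2 (Ω.isOpen.mem_nhds hx)

/-- Compact subsets of `Ω`. -/
abbrev CompactIn (Ω : Opens (Eu n)) : Type := {K : Set (Eu n) // IsCompact K ∧ K ⊆ Ω}

/-- `sup_{x ∈ K, i ≤ j} ‖D^i f (x)‖`. -/
def supDeriv (K : Set (Eu n)) (j : ℕ) (f : Eu n → ℂ) : ℝ :=
  ⨆ q : Fin (j + 1) × K, ‖iteratedFDeriv ℝ (q.1 : ℕ) f (q.2 : Eu n)‖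

theorem supDeriv_nonneg (K : Set (Eu n)) (j : ℕ) (f : Eu n → ℂ) : 0 ≤ supDeriv K j f :=
  Real.iSup_nonneg fun _ => norm_nonneg _

theorem bddAbove_supDeriv {Ω : Opens (Eu n)} (K : CompactIn Ω) (j : ℕ) (f : SmoothOn Ω) :
    BddAbove (Set.range fun q : Fin (j + 1) × K.1 =>
      ‖iteratedFDeriv ℝ (q.1 : ℕ) f (q.2 : Eu n)‖) := by
  have key : ∀ i : Fin (j + 1), ∃ C : ℝ, ∀ x ∈ K.1, ‖iteratedFDeriv ℝ (i : ℕ) f x‖ ≤ C := by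
    intro i
    refine K.2.1.exists_bound_of_continuousOn fun x hx => ContinuousAt.continuousWithinAt ?_
    exact (f.contDiffAt (K.2.2 hx)).continuousAt_iteratedFDeriv (by exact_mod_cast le_top)
  choose C hC using key
  refine ⟨∑ i, |C i|, ?_⟩
  rintro _ ⟨⟨i, x⟩, rfl⟩
  exact ((hC i x x.2).trans (le_abs_self _)).trans
    (Finset.single_le_sum (f := fun i => |C i|) (fun _ _ => abs_nonneg _) (Finset.mem_univ i))

/-- The seminorms `p_{K,j}` of `C^∞(Ω)`. -/
def smoothSeminorms (Ω : Opens (Eu n)) : SeminormFamily ℂ (SmoothOn Ω) (CompactIn Ω × ℕ) :=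
  fun i => Seminorm.of (fun f => supDeriv i.1.1 i.2 f)
    (by
      intro f g
      refine Real.iSup_le (fun q => ?_)
        (add_nonneg (supDeriv_nonneg _ _ _) (supDeriv_nonneg _ _ _))
      have hx := i.1.2.2 q.2.2
      have h : iteratedFDeriv ℝ (q.1 : ℕ) (f + g : SmoothOn Ω) (q.2 : Eu n)
          = iteratedFDeriv ℝ (q.1 : ℕ) f (q.2 : Eu n)
            + iteratedFDeriv ℝ (q.1 : ℕ) g (q.2 : Eu n) :=
        iteratedFDeriv_add_apply ((f.contDiffAt hx).of_le (by exact_mod_cast le_top))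
          ((g.contDiffAt hx).of_le (by exact_mod_cast le_top))
      rw [h]
      exact (norm_add_le _ _).trans (add_le_add
        (le_ciSup (bddAbove_supDeriv i.1 i.2 f) q) (le_ciSup (bddAbove_supDeriv i.1 i.2 g) q)))
    (by
      intro c f
      rw [supDeriv, supDeriv, Real.mul_iSup_of_nonneg (norm_nonneg c)]
      congr 1
      funext q
      have hx := i.1.2.2 q.2.2
      have h : iteratedFDeriv ℝ (q.1 : ℕ) (c • f : SmoothOn Ω) (q.2 : Eu n)
          = c • iteratedFDeriv ℝ (q.1 : ℕ) f (q.2 : Eu n) :=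
        iteratedFDeriv_const_smul_apply ((f.contDiffAt hx).of_le (by exact_mod_cast le_top))
      rw [h, norm_smul])

theorem smoothSeminorms_apply (Ω : Opens (Eu n)) (K : CompactIn Ω) (j : ℕ) (f : SmoothOn Ω) :
    smoothSeminorms Ω (K, j) f = supDeriv K.1 j f := rfl

instance (Ω : Opens (Eu n)) : Nonempty (CompactIn Ω) := ⟨⟨∅, isCompact_empty, Set.empty_subset _⟩⟩

/-- The Fréchet topology of `C^∞(Ω)`. -/
instance (Ω : Opens (Eu n)) : TopologicalSpace (SmoothOn Ω) :=
  (smoothSeminorms Ω).moduleFilterBasis.topology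

/-- The Colombeau algebra `𝓖(Ω)` (as a `ℂ~`-module). -/
abbrev G (Ω : Opens (Eu n)) : Type := GE (smoothSeminorms Ω)

/-- Restriction of smooth functions. -/
def SmoothOn.restrict {V Ω : Opens (Eu n)} (h : V ≤ Ω) (f : SmoothOn Ω) : SmoothOn V :=
  ⟨f.1, ContDiffOn.mono f.2 h⟩

/-- Compact subsets of `V` are compact subsets of `Ω`. -/
def CompactIn.incl {V Ω : Opens (Eu n)} (h : V ≤ Ω) (K : CompactIn V) : CompactIn Ω :=
  ⟨K.1, K.2.1, K.2.2.trans h⟩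

/-- Restriction of moderate nets. -/
def restrictNet {V Ω : Opens (Eu n)} (h : V ≤ Ω) :
    modE (smoothSeminorms Ω) →ₗ[modNets] modE (smoothSeminorms V) where
  toFun u := ⟨fun ε => (u.1 ε).restrict h, fun i => u.2 (i.1.incl h, i.2)⟩
  map_add' _ _ := rfl
  map_smul' _ _ := rfl

/-- The restriction map `𝓖(Ω) → 𝓖(V)`. -/
def G.restrict {V Ω : Opens (Eu n)} (h : V ≤ Ω) : G Ω →ₗ[modNets] G V :=
  Submodule.mapQ (neglE (smoothSeminorms Ω)) (neglE (smoothSeminorms V)) (restrictNet h)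
    (fun _ hu i q => hu (i.1.incl h, i.2) q)

/-- The support of `u ∈ 𝓖(Ω)`: the complement in `Ω` of the largest open set on which `u` is `0`. -/
def G.supp {Ω : Opens (Eu n)} (u : G Ω) : Set (Eu n) :=
  {x | x ∈ Ω ∧ ∀ (V : Opens (Eu n)) (h : V ≤ Ω), x ∈ V → G.restrict h u ≠ 0}

theorem G.supp_add {Ω : Opens (Eu n)} (u v : G Ω) : (u + v).supp ⊆ u.supp ∪ v.supp := by
  intro x hx
  by_contra hc
  rw [Set.mem_union, not_or] at hc
  have aux : ∀ z : G Ω, x ∉ z.supp → ∃ (V : Opens (Eu n)) (h : V ≤ Ω), x ∈ V ∧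
      G.restrict h z = 0 := by
    intro z hz
    by_contra hne
    push Not at hne
    exact hz ⟨hx.1, hne⟩
  obtain ⟨V, hV, hxV, hu⟩ := aux u hc.1
  obtain ⟨W, hW, hxW, hv⟩ := aux v hc.2
  have trans : ∀ {A B : Opens (Eu n)} (hAB : A ≤ B) (hB : B ≤ Ω) (z : G Ω),
      G.restrict hB z = 0 → G.restrict (hAB.trans hB) z = 0 := by
    intro A B hAB hB z hz
    have : G.restrict (hAB.trans hB) z = G.restrict hAB (G.restrict hB z) := by
      obtain ⟨a, rfl⟩ := Submodule.Quotient.mk_surjective _ z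
      rfl
    rw [this, hz, map_zero]
  refine hx.2 (V ⊓ W) (inf_le_left.trans hV) ⟨hxV, hxW⟩ ?_
  rw [map_add, trans inf_le_left hV u hu, trans inf_le_right hW v hv, add_zero]

theorem G.supp_smul {Ω : Opens (Eu n)} (c : GenNumber) (u : G Ω) : (c • u).supp ⊆ u.supp := by
  intro x hx
  refine ⟨hx.1, fun V h hxV h0 => hx.2 V h hxV ?_⟩
  obtain ⟨a, rfl⟩ := Ideal.Quotient.mk_surjective c
  change G.restrict h (a • u) = 0
  rw [map_smul, h0, smul_zero]

theorem G.supp_zero {Ω : Opens (Eu n)} : (0 : G Ω).supp = ∅ := by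
  ext x
  refine ⟨fun hx => hx.2 Ω le_rfl hx.1 (map_zero _), fun hx => hx.elim⟩

/-- Generalized functions with compact support in `Ω`. As the support is relatively closed in `Ω`, it
is compact if and only if it lies in a compact subset of `Ω`. -/
def gcSub (Ω : Opens (Eu n)) : Submodule GenNumber (G Ω) where
  carrier := {u | ∃ K : CompactIn Ω, u.supp ⊆ K.1}
  zero_mem' := ⟨⟨∅, isCompact_empty, Set.empty_subset _⟩, by rw [G.supp_zero]⟩
  add_mem' := by
    rintro u v ⟨K, hK⟩ ⟨L, hL⟩
    exact ⟨⟨K.1 ∪ L.1, K.2.1.union L.2.1, Set.union_subset K.2.2 L.2.2⟩,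
      (G.supp_add u v).trans (Set.union_subset_union hK hL)⟩
  smul_mem' := by
    rintro c u ⟨K, hK⟩
    exact ⟨K, (G.supp_smul c u).trans hK⟩

/-- The algebra `𝓖_c(Ω)` (as a `ℂ~`-module). -/
def Gc (Ω : Opens (Eu n)) : Type := gcSub Ω

instance (Ω : Opens (Eu n)) : AddCommGroup (Gc Ω) := inferInstanceAs (AddCommGroup (gcSub Ω))

instance (Ω : Opens (Eu n)) : Module GenNumber (Gc Ω) :=
  inferInstanceAs (Module GenNumber (gcSub Ω))

/-- The inclusion of `𝓖_c(Ω)` in `𝓖(Ω)`. -/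
def Gc.val {Ω : Opens (Eu n)} (u : Gc Ω) : G Ω := u.1

/-- The submodule `𝓖_K(Ω)` of generalized functions with support in `K`. -/
abbrev GK {Ω : Opens (Eu n)} (K : CompactIn Ω) : Type := {u : Gc Ω // u.val.supp ⊆ K.1}

/-- The topology of `𝓖_K(Ω)`, induced by `𝓖(Ω)`; it is the one of the ultra-pseudo-seminorms
`upsn (K', j)`, `j ∈ ℕ`, for any one compact `K' ⊆ Ω` whose interior contains `K`. -/
@[reducible]
def GK.topology {Ω : Opens (Eu n)} (K : CompactIn Ω) : TopologicalSpace (GK K) :=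
  induced (fun u => u.1.val) inferInstance

/-- The inductive limit topology of `𝓖_c(Ω)`: the finest locally convex `ℂ~`-module topology for which
all inclusions `𝓖_K(Ω) → 𝓖_c(Ω)` are continuous. -/
instance (Ω : Opens (Eu n)) : TopologicalSpace (Gc Ω) :=
  sInf {t | IsLocallyConvexTopology t ∧
    ∀ K : CompactIn Ω, @Continuous (GK K) (Gc Ω) (GK.topology K) t Subtype.val}

/-- The regular generalized functions `𝓖^∞(Ω)`. -/
def GInf (Ω : Opens (Eu n)) : Set (G Ω) :=
  {u | ∃ a : Eps → SmoothOn Ω, u.IsRep a ∧ ∀ K : CompactIn Ω, ∃ N : ℕ, ∀ j : ℕ,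
    (fun ε => smoothSeminorms Ω (K, j) (a ε)) =O[toZero] powNet (-(N : ℝ))}

/-- The regular generalized functions with compact support, `𝓖_c^∞(Ω)`. -/
def GcInf (Ω : Opens (Eu n)) : Set (Gc Ω) := {u | u.val ∈ GInf Ω}

/-- The generalized singular support of `u ∈ 𝓖(Ω)`. -/
def G.singSupp {Ω : Opens (Eu n)} (u : G Ω) : Set (Eu n) :=
  {x | x ∈ Ω ∧ ∀ (V : Opens (Eu n)) (h : V ≤ Ω), x ∈ V → G.restrict h u ∉ GInf V}

/-! ### The global algebras `𝓖_𝓢(ℝⁿ)` and `𝓖_τ(ℝⁿ)` -/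

/-- The algebra `𝓖_𝓢(ℝⁿ)` (as a `ℂ~`-module). -/
abbrev GS (n : ℕ) : Type := GE (schwartzSeminormFamily ℂ (Eu n) ℂ)

/-- The regular elements `𝓖_𝓢^∞(ℝⁿ)`. -/
def GSInf (n : ℕ) : Set (GS n) :=
  {u | ∃ a : Eps → 𝓢(Eu n, ℂ), u.IsRep a ∧ ∃ N : ℕ, ∀ i : ℕ × ℕ,
    (fun ε => schwartzSeminormFamily ℂ (Eu n) ℂ i (a ε)) =O[toZero] powNet (-(N : ℝ))}

/-- `sup_x (1+|x|)^{-N} ‖D^k u_ε(x)‖ = O(ε ^ b)`. -/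
def TemperedBound (u : Eps → Eu n → ℂ) (k N : ℕ) (b : ℝ) : Prop :=
  ∃ C : ℝ, ∀ᶠ ε in toZero, ∀ x, ‖iteratedFDeriv ℝ k (u ε) x‖ ≤ C * (1 + ‖x‖) ^ N * powNet b ε

theorem TemperedBound.mono {u : Eps → Eu n → ℂ} {k N M : ℕ} {b c : ℝ} (h : TemperedBound u k N b)
    (hN : N ≤ M) (hb : c ≤ b) : TemperedBound u k M c := by
  obtain ⟨C, hC⟩ := h
  refine ⟨|C|, hC.mono fun ε hε x => (hε x).trans ?_⟩
  have h0 : (0 : ℝ) < ε := ε.2.1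
  have h1 : (1 : ℝ) ≤ 1 + ‖x‖ := by linarith [norm_nonneg x]
  have h2 : powNet b ε ≤ powNet c ε := Real.rpow_le_rpow_of_exponent_ge h0 ε.2.2 hb
  have h3 : 0 ≤ powNet b ε := Real.rpow_nonneg h0.le _
  have h4 : (1 + ‖x‖) ^ N ≤ (1 + ‖x‖) ^ M := pow_le_pow_right₀ h1 hN
  have h5 : 0 ≤ (1 + ‖x‖) ^ N := by positivity
  gcongr
  exact le_abs_self C

theorem TemperedBound.add {u v : Eps → Eu n → ℂ} {k N : ℕ} {b : ℝ}
    (hu' : ∀ ε, ContDiff ℝ ∞ (u ε)) (hv' : ∀ ε, ContDiff ℝ ∞ (v ε))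
    (hu : TemperedBound u k N b) (hv : TemperedBound v k N b) : TemperedBound (u + v) k N b := by
  obtain ⟨C, hC⟩ := hu
  obtain ⟨D, hD⟩ := hv
  refine ⟨C + D, (hC.and hD).mono fun ε hε x => ?_⟩
  have h : iteratedFDeriv ℝ k ((u + v) ε) x
      = iteratedFDeriv ℝ k (u ε) x + iteratedFDeriv ℝ k (v ε) x :=
    iteratedFDeriv_add_apply ((hu' ε).contDiffAt.of_le (by exact_mod_cast le_top))
      ((hv' ε).contDiffAt.of_le (by exact_mod_cast le_top))
  rw [h]
  refine (norm_add_le _ _).trans ((add_le_add (hε.1 x) (hε.2 x)).trans (le_of_eq ?_))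
  ring

theorem TemperedBound.const_smul {u : Eps → Eu n → ℂ} {k N : ℕ} {b : ℝ} (c : ℂ)
    (hu' : ∀ ε, ContDiff ℝ ∞ (u ε)) (hu : TemperedBound u k N b) :
    TemperedBound (c • u) k N b := by
  obtain ⟨C, hC⟩ := hu
  refine ⟨‖c‖ * C, hC.mono fun ε hε x => ?_⟩
  have h : iteratedFDeriv ℝ k ((c • u) ε) x = c • iteratedFDeriv ℝ k (u ε) x :=
    iteratedFDeriv_const_smul_apply (f := u ε) (a := c)
      ((hu' ε).contDiffAt.of_le (by exact_mod_cast le_top))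
  rw [h, norm_smul, mul_assoc, mul_assoc, ← mul_assoc C]
  exact mul_le_mul_of_nonneg_left (hε x) (norm_nonneg c)

theorem TemperedBound.zero (k N : ℕ) (b : ℝ) : TemperedBound (0 : Eps → Eu n → ℂ) k N b := by
  exact ⟨0, Eventually.of_forall fun ε x => by simp⟩

/-- Moderate nets for `𝓖_τ(ℝⁿ)`: nets of functions in `𝓞_M(ℝⁿ)` (smooth functions all of whose
derivatives grow at most polynomially) such that for all `k` there is an `N` with
`sup_x (1+|x|)^{-N} ‖D^k u_ε(x)‖ = O(ε ^ (-N))`. -/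
def modTau (n : ℕ) : Submodule ℂ (Eps → Eu n → ℂ) where
  carrier := {u | (∀ ε, (u ε).HasTemperateGrowth) ∧
    ∀ k : ℕ, ∃ N : ℕ, TemperedBound u k N (-(N : ℝ))}
  zero_mem' := ⟨fun _ => Function.HasTemperateGrowth.const 0, fun k => ⟨0, .zero k 0 _⟩⟩
  add_mem' := by
    rintro u v ⟨hu, hu'⟩ ⟨hv, hv'⟩
    refine ⟨fun ε => (hu ε).add (hv ε), fun k => ?_⟩
    obtain ⟨N, hN⟩ := hu' k
    obtain ⟨M, hM⟩ := hv' k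
    have := Nat.cast_nonneg (α := ℝ) N
    have := Nat.cast_nonneg (α := ℝ) M
    exact ⟨N + M, .add (fun ε => (hu ε).1) (fun ε => (hv ε).1)
      (hN.mono (by omega) (by push_cast; linarith))
      (hM.mono (by omega) (by push_cast; linarith))⟩
  smul_mem' := by
    rintro c u ⟨hu, hu'⟩
    refine ⟨fun ε => (Function.HasTemperateGrowth.const c).mul (hu ε), fun k => ?_⟩
    obtain ⟨N, hN⟩ := hu' k
    exact ⟨N, hN.const_smul c fun ε => (hu ε).1⟩

/-- Negligible nets for `𝓖_τ(ℝⁿ)`: for all `k` there is an `N` such that for all `q`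
`sup_x (1+|x|)^{-N} ‖D^k u_ε(x)‖ = O(ε ^ q)`. -/
def neglTau (n : ℕ) : Submodule ℂ (modTau n) where
  carrier := {u | ∀ k : ℕ, ∃ N : ℕ, ∀ q : ℕ, TemperedBound (u : Eps → Eu n → ℂ) k N q}
  zero_mem' := fun k => ⟨0, fun q => .zero k 0 _⟩
  add_mem' := by
    intro u v hu hv k
    obtain ⟨N, hN⟩ := hu k
    obtain ⟨M, hM⟩ := hv k
    exact ⟨N + M, fun q => .add (fun ε => (u.2.1 ε).1) (fun ε => (v.2.1 ε).1)
      ((hN q).mono (by omega) le_rfl) ((hM q).mono (by omega) le_rfl)⟩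
  smul_mem' := by
    intro c u hu k
    obtain ⟨N, hN⟩ := hu k
    exact ⟨N, fun q => (hN q).const_smul c fun ε => (u.2.1 ε).1⟩

/-- The algebra `𝓖_τ(ℝⁿ)` of tempered generalized functions (as a vector space). -/
def GTau (n : ℕ) : Type := modTau n ⧸ neglTau n

instance : AddCommGroup (GTau n) := inferInstanceAs (AddCommGroup (modTau n ⧸ neglTau n))

/-- `z ∈ 𝓖_τ(ℝⁿ)` is the class of the net `u` (in particular `u` is moderate). -/
def GTau.IsRep (z : GTau n) (u : Eps → Eu n → ℂ) : Prop :=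
  ∃ h : u ∈ modTau n, (Submodule.Quotient.mk ⟨u, h⟩ : modTau n ⧸ neglTau n) = z

/-! ### Topological duals and integration -/

/-- The dual `L(𝓖_c(Ω), ℂ~)`. -/
abbrev DualGc (Ω : Opens (Eu n)) : Type := Gc Ω →L[GenNumber] GenNumber

/-- The dual `L(𝓖(Ω), ℂ~)`. -/
abbrev DualG (Ω : Opens (Eu n)) : Type := G Ω →L[GenNumber] GenNumber

/-- The dual `L(𝓖_𝓢(ℝⁿ), ℂ~)`. -/
abbrev DualGS (n : ℕ) : Type := GS n →L[GenNumber] GenNumber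

/-- The restriction `T|_V` of `T ∈ L(𝓖_c(Ω), ℂ~)` is the functional `u ↦ ∫_V v u` given by `v ∈ 𝓖(V)`.
Here `𝓖_c(V)` is the set of all `u ∈ 𝓖_c(Ω)` with `supp u ⊆ V`, and `∫_V v u` is the class of
`(∫_K v_ε u_ε)_ε` for any compact `K ⊆ V` that contains `supp u` in its interior. -/
def IsIntegralOn {V Ω : Opens (Eu n)} (v : G V) (T : DualGc Ω) : Prop :=
  ∀ u : Gc Ω, u.val.supp ⊆ V → ∀ (a : Eps → SmoothOn V) (b : Eps → SmoothOn Ω) (K : Set (Eu n)),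
    v.IsRep a → u.val.IsRep b → IsCompact K → K ⊆ V → u.val.supp ⊆ interior K →
      (T u).IsRep fun ε => ∫ x in K, a ε x * b ε x

/-- The functional `v ↦ ∫_Ω u v` in `L(𝓖_c(Ω), ℂ~)` given by `u ∈ 𝓖(Ω)`. -/
def G.toDual {Ω : Opens (Eu n)} (u : G Ω) : DualGc Ω :=
  Classical.epsilon fun T => IsIntegralOn u T

/-- `T ∈ L(𝓖(Ω), ℂ~)` is the functional `v ↦ ∫_Ω u v` given by `u ∈ 𝓖_c(Ω)`. -/
def IsIntegralC {Ω : Opens (Eu n)} (u : Gc Ω) (T : DualG Ω) : Prop :=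
  ∀ (v : G Ω) (a b : Eps → SmoothOn Ω) (K : Set (Eu n)),
    u.val.IsRep a → v.IsRep b → IsCompact K → K ⊆ Ω → u.val.supp ⊆ interior K →
      (T v).IsRep fun ε => ∫ x in K, a ε x * b ε x

/-- The functional `v ↦ ∫_Ω u v` in `L(𝓖(Ω), ℂ~)` given by `u ∈ 𝓖_c(Ω)`. -/
def Gc.toDual {Ω : Opens (Eu n)} (u : Gc Ω) : DualG Ω :=
  Classical.epsilon fun T => IsIntegralC u T

/-- `T ∈ L(𝓖_𝓢(ℝⁿ), ℂ~)` is the functional `v ↦ ∫ u v` given by `u ∈ 𝓖_τ(ℝⁿ)`. -/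
def IsIntegralTau (u : GTau n) (T : DualGS n) : Prop :=
  ∀ (v : GS n) (a : Eps → Eu n → ℂ) (b : Eps → 𝓢(Eu n, ℂ)), u.IsRep a → v.IsRep b →
    (T v).IsRep fun ε => ∫ x, a ε x * b ε x

/-- The functional `v ↦ ∫ u v` in `L(𝓖_𝓢(ℝⁿ), ℂ~)` given by `u ∈ 𝓖_τ(ℝⁿ)`. -/
def GTau.toDual (u : GTau n) : DualGS n :=
  Classical.epsilon fun T => IsIntegralTau u T

/-- The support of `T ∈ L(𝓖_c(Ω), ℂ~)`: the complement in `Ω` of the largest open set `V` with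
`T|_V = 0`. -/
def dualSupp {Ω : Opens (Eu n)} (T : DualGc Ω) : Set (Eu n) :=
  {x | x ∈ Ω ∧ ∀ V : Opens (Eu n), V ≤ Ω → x ∈ V → ¬ ∀ u : Gc Ω, u.val.supp ⊆ V → T u = 0}

/-- The generalized singular support of `T ∈ L(𝓖_c(Ω), ℂ~)`: the complement in `Ω` of the set of points
with an open neighbourhood `V` such that `T|_V` belongs to `𝓖^∞(V)`. -/
def dualSingSupp {Ω : Opens (Eu n)} (T : DualGc Ω) : Set (Eu n) :=
  {x | x ∈ Ω ∧ ∀ V : Opens (Eu n), V ≤ Ω → x ∈ V → ¬ ∃ v ∈ GInf V, IsIntegralOn v T}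

/-! ### Distributions -/

/-- The distributions `𝓓'(Ω)`, as continuous complex linear forms on complex test functions. -/
abbrev Distr (Ω : Opens (Eu n)) : Type := 𝓓(Ω, ℂ) →L[ℂ] ℂ

/-- The distributions with compact support `𝓔'(Ω)`, the dual of `C^∞(Ω)`. -/
abbrev DistrC (Ω : Opens (Eu n)) : Type := SmoothOn Ω →L[ℂ] ℂ

/-- The support of a distribution on `Ω`, as a subset of `Ω`. -/
def distrSupp {Ω : Opens (Eu n)} (w : Distr Ω) : Set (Eu n) := Ω ∩ Distribution.dsupport w

/-- The singular support of a distribution on `Ω`. -/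
def distrSingSupp {Ω : Opens (Eu n)} (w : Distr Ω) : Set (Eu n) :=
  {x | x ∈ Ω ∧ ∀ V : Opens (Eu n), V ≤ Ω → x ∈ V → ¬ ∃ g : SmoothOn V,
    ∀ f : 𝓓(Ω, ℂ), tsupport f ⊆ V → w f = ∫ y, g y * f y}

/-- A test function on `Ω` as a smooth function on `Ω`. -/
def testToSmooth {Ω : Opens (Eu n)} (f : 𝓓(Ω, ℂ)) : SmoothOn Ω :=
  ⟨f, f.contDiff.contDiffOn⟩

/-- A Schwartz function as a smooth function on `Ω`. -/
def schwartzToSmooth (Ω : Opens (Eu n)) (f : 𝓢(Eu n, ℂ)) : SmoothOn Ω :=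
  ⟨f, (f.smooth ⊤).contDiffOn⟩

/-- The product of a test function and a Schwartz function. -/
def testMul {Ω : Opens (Eu n)} (ψ : 𝓓(Ω, ℂ)) (f : 𝓢(Eu n, ℂ)) : 𝓓(Ω, ℂ) where
  toFun := fun y => ψ y * f y
  contDiff' := ψ.contDiff.mul (f.smooth ⊤)
  hasCompactSupport' := ψ.hasCompactSupport.mul_right
  tsupport_subset' := (tsupport_mul_subset_left).trans ψ.tsupport_subset

/-! ### The direct embeddings `ι_d` -/

/-- `T` is the functional `u ↦ [(w(u_ε))_ε]` on `𝓖_c(Ω)`, where `(u_ε)_ε` is any representative of `u`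
whose members are supported in one compact subset of `Ω`. -/
def IsDirect {Ω : Opens (Eu n)} (w : Distr Ω) (T : DualGc Ω) : Prop :=
  ∀ (u : Gc Ω) (K : CompactIn Ω) (a : Eps → 𝓓(Ω, ℂ)), (∀ ε, tsupport (a ε) ⊆ K.1) →
    u.val.IsRep (fun ε => testToSmooth (a ε)) → (T u).IsRep fun ε => w (a ε)

/-- `ι_d : 𝓓'(Ω) → L(𝓖_c(Ω), ℂ~)`. -/
def iotaD {Ω : Opens (Eu n)} (w : Distr Ω) : DualGc Ω := Classical.epsilon fun T => IsDirect w T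

/-- `T` is the functional `u ↦ [(w(u_ε))_ε]` on `𝓖(Ω)`. -/
def IsDirectC {Ω : Opens (Eu n)} (w : DistrC Ω) (T : DualG Ω) : Prop :=
  ∀ (u : G Ω) (a : Eps → SmoothOn Ω), u.IsRep a → (T u).IsRep fun ε => w (a ε)

/-- `ι_d : 𝓔'(Ω) → L(𝓖(Ω), ℂ~)`. -/
def iotaDC {Ω : Opens (Eu n)} (w : DistrC Ω) : DualG Ω := Classical.epsilon fun T => IsDirectC w T

/-- `T` is the functional `u ↦ [(w(u_ε))_ε]` on `𝓖_𝓢(ℝⁿ)`. -/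
def IsDirectS (w : 𝓢'(Eu n, ℂ)) (T : DualGS n) : Prop :=
  ∀ (u : GS n) (a : Eps → 𝓢(Eu n, ℂ)), u.IsRep a → (T u).IsRep fun ε => w (a ε)

/-- `ι_d : 𝓢'(ℝⁿ) → L(𝓖_𝓢(ℝⁿ), ℂ~)`. -/
def iotaDS (w : 𝓢'(Eu n, ℂ)) : DualGS n := Classical.epsilon fun T => IsDirectS w T

/-! ### The Colombeau embeddings `ι` and `ι'` -/

/-- A mollifier: `∫ φ = 1` and all moments of positive order vanish. -/
def IsMollifier (φ : 𝓢(Eu n, ℂ)) : Prop :=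
  ∫ y, φ y = 1 ∧ ∀ α : Fin n → ℕ, α ≠ 0 → ∫ y, ((∏ i, y i ^ α i : ℝ) : ℂ) * φ y = 0

/-- The homothety `y ↦ - ε⁻¹ y`. -/
def negDilation (n : ℕ) (ε : Eps) : Eu n ≃L[ℝ] Eu n :=
  ContinuousLinearEquiv.smulLeft (-(Units.mk0 (ε : ℝ) ε.2.1.ne')⁻¹)

/-- The Schwartz function `y ↦ φ_ε(x - y)`, where `φ_ε(z) = ε^{-n} φ(z / ε)`. -/
def shiftMoll (φ : 𝓢(Eu n, ℂ)) (ε : Eps) (x : Eu n) : 𝓢(Eu n, ℂ) :=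
  (((ε : ℝ) ^ n)⁻¹ : ℂ) • SchwartzMap.compSubConstCLM ℂ x
    (SchwartzMap.compCLMOfContinuousLinearEquiv ℂ (negDilation n ε) φ)

theorem shiftMoll_apply (φ : 𝓢(Eu n, ℂ)) (ε : Eps) (x y : Eu n) :
    shiftMoll φ ε x y = (((ε : ℝ) ^ n)⁻¹ : ℂ) * φ ((ε : ℝ)⁻¹ • (x - y)) := by
  have h : negDilation n ε (y - x) = (ε : ℝ)⁻¹ • (x - y) := by
    change (-(Units.mk0 (ε : ℝ) ε.2.1.ne')⁻¹) • (y - x) = _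
    rw [Units.smul_def]
    simp [← smul_neg]
  simp [shiftMoll, h]

/-- `u ∈ 𝓖_c(Ω)` is the class of the net `((w * φ_ε)|_Ω)_ε`, with
`(w * φ_ε)(x) = w(φ_ε(x - ·))`. -/
def IsEmbC {Ω : Opens (Eu n)} (φ : 𝓢(Eu n, ℂ)) (w : DistrC Ω) (u : Gc Ω) : Prop :=
  ∃ a : Eps → SmoothOn Ω, u.val.IsRep a ∧
    ∀ ε, ∀ x ∈ Ω, a ε x = w (schwartzToSmooth Ω (shiftMoll φ ε x))

/-- `ι : 𝓔'(Ω) → 𝓖_c(Ω)`. -/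
def iotaC {Ω : Opens (Eu n)} (φ : 𝓢(Eu n, ℂ)) (w : DistrC Ω) : Gc Ω :=
  Classical.epsilon fun u => IsEmbC φ w u

/-- `u ∈ 𝓖(Ω)` is the generalized function whose restriction to `V` is the class of
`((ψ w * φ_ε)|_V)_ε` whenever `ψ` is a test function on `Ω` that equals `1` on the open set `V`;
`(ψ w * φ_ε)(x) = w(ψ φ_ε(x - ·))`. -/
def IsEmb {Ω : Opens (Eu n)} (φ : 𝓢(Eu n, ℂ)) (w : Distr Ω) (u : G Ω) : Prop :=
  ∀ (V : Opens (Eu n)) (h : V ≤ Ω) (ψ : 𝓓(Ω, ℂ)), (∀ x ∈ V, ψ x = 1) →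
    ∃ a : Eps → SmoothOn V, (G.restrict h u).IsRep a ∧
      ∀ ε, ∀ x ∈ V, a ε x = w (testMul ψ (shiftMoll φ ε x))

/-- `ι : 𝓓'(Ω) → 𝓖(Ω)`. -/
def iota {Ω : Opens (Eu n)} (φ : 𝓢(Eu n, ℂ)) (w : Distr Ω) : G Ω :=
  Classical.epsilon fun u => IsEmb φ w u

/-- `u ∈ 𝓖_τ(ℝⁿ)` is the class of the net `(w * φ_ε)_ε`. -/
def IsEmbS (φ : 𝓢(Eu n, ℂ)) (w : 𝓢'(Eu n, ℂ)) (u : GTau n) : Prop :=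
  u.IsRep fun ε x => w (shiftMoll φ ε x)

/-- `ι : 𝓢'(ℝⁿ) → 𝓖_τ(ℝⁿ)`. -/
def iotaS (φ : 𝓢(Eu n, ℂ)) (w : 𝓢'(Eu n, ℂ)) : GTau n :=
  Classical.epsilon fun u => IsEmbS φ w u

/-- `ι' : 𝓓'(Ω) → L(𝓖_c(Ω), ℂ~)`. -/
def iota' {Ω : Opens (Eu n)} (φ : 𝓢(Eu n, ℂ)) (w : Distr Ω) : DualGc Ω := (iota φ w).toDual

/-- `ι' : 𝓔'(Ω) → L(𝓖(Ω), ℂ~)`. -/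
def iotaC' {Ω : Opens (Eu n)} (φ : 𝓢(Eu n, ℂ)) (w : DistrC Ω) : DualG Ω := (iotaC φ w).toDual

/-- `ι' : 𝓢'(ℝⁿ) → L(𝓖_𝓢(ℝⁿ), ℂ~)`. -/
def iotaS' (φ : 𝓢(Eu n, ℂ)) (w : 𝓢'(Eu n, ℂ)) : DualGS n := (iotaS φ w).toDual

end

end Colombeau

open Colombeau

namespace Colombeau

noncomputable section

/-! ### Nets -/

/-! Everything rests on one estimate. Let `W` be a linear form on Schwartz functions bounded by a
weighted `C^L` norm. Then `W b - ∫ W(φ_ε(x - ·)) b(x) dx` is `W` applied to `b - ∫ φ(z) b(· + εz)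
dz`. Taylor expansion and the vanishing moments of `φ` make this `O(ε^(q+1))` times a norm of `b`
with `L + q + 1` derivatives, for every `q`. Pulling `W` through the integral, and differentiating
`W(φ_ε(x - ·))` in `x`, takes place in a Banach space of weighted jets to which `W` extends by
Hahn–Banach (`exists_jet_extension`, `hasFDerivAt_jet_translate`,
`IsMollifier.exists_norm_apply_sub_integral_le`).

For a regular net `b_ε` all derivatives grow like one power `ε^(-N)`, so a large `q` makes the error
negligible; this gives (i)–(iii). The argument survives if each derivative costs another factor
`ε^(-1/2)`, since the Taylor order gains a full power of `ε`. Such nets are called slow, and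
`ActsLike w T` says that `T` agrees with `w` on slow nets of test functions. Both the direct and the
integration functional have this property, so the lower bounds in (iv) need only one proof.

Well-definedness uses that representatives can be cut off near the support, that integrals do not
see the complement of the support, and that `ψ w * φ_ε` is negligible away from `supp ψ` because `φ`
decays rapidly. The last fact lets the local regularizations be glued by a partition of unity
(`exists_glued_net`). Continuity on the inductive limit holds because the topology induced by a
functional with continuous restrictions is itself one of the admissible locally convex topologies
(`exists_dualGc`).

For supports, constant nets of test functions show that `supp w` lies in the support of any
functional acting like `w`; the other inclusions are local. For singular supports the hard step is
`ActsLike.distrSingSupp_subset`. Suppose `T` is integration against a regular net `a_ε` near a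
point, and let `θ` be a cutoff. Testing on the slow nets `θ φ_η(x_ε - ·)`, with `η` equal to
`ε^(1/2)` or `ε^(1/4)`, shows that `θw * φ_η` is close to `(θ a_ε) * φ_η`. The latter is close to `θ
a_ε` by the vanishing moments, since the derivatives of `θ a_ε` have one common growth rate. All
this is uniform in `x` and holds for all derivatives, so eliminating `θ a_ε` makes `θw * φ_(ε²) - θw
* φ_ε` small in every `C^j`. Along repeatedly squared scales the telescoping series converges to a
smooth function; as `θw * φ_ε` also tends weakly to `θw`, the distribution is smooth there. -/

theorem powNet_pos (b : ℝ) (ε : Eps) : 0 < powNet b ε := Real.rpow_pos_of_pos ε.2.1 b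

theorem norm_powNet (b : ℝ) (ε : Eps) : ‖powNet b ε‖ = powNet b ε :=
  Real.norm_of_nonneg (powNet_pos b ε).le

theorem powNet_le {b c : ℝ} (h : c ≤ b) (ε : Eps) : powNet b ε ≤ powNet c ε :=
  Real.rpow_le_rpow_of_exponent_ge ε.2.1 ε.2.2 h

theorem powNet_zero (ε : Eps) : powNet 0 ε = 1 := Real.rpow_zero _

theorem powNet_natCast (q : ℕ) (ε : Eps) : powNet q ε = (ε : ℝ) ^ q := Real.rpow_natCast _ _

theorem powNet_neg_natCast (q : ℕ) (ε : Eps) : powNet (-(q : ℝ)) ε = ((ε : ℝ)⁻¹) ^ q := by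
  rw [powNet, Real.rpow_neg ε.2.1.le, Real.rpow_natCast, inv_pow]

theorem eventually_toZero_lt {δ : ℝ} (hδ : 0 < δ) : ∀ᶠ ε : Eps in toZero, (ε : ℝ) < δ :=
  tendsto_comap.eventually (gt_mem_nhds hδ)

theorem eventually_toZero_iff {P : Eps → Prop} :
    (∀ᶠ ε in toZero, P ε) ↔ ∃ δ > 0, ∀ ε : Eps, (ε : ℝ) < δ → P ε := by
  constructor
  · intro h
    obtain ⟨t, ht, hP⟩ := mem_comap.1 h
    obtain ⟨δ, hδ, hball⟩ := Metric.mem_nhds_iff.1 ht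
    refine ⟨δ, hδ, fun ε hε => hP (hball ?_)⟩
    rw [Metric.mem_ball, dist_zero_right, Real.norm_of_nonneg ε.2.1.le]
    exact hε
  · rintro ⟨δ, hδ, h⟩
    exact (eventually_toZero_lt hδ).mono h

instance : NeBot toZero := by
  refine ⟨fun h => ?_⟩
  have h : ∀ᶠ _ε in toZero, False := by rw [h]; exact eventually_bot
  obtain ⟨δ, hδ, h⟩ := eventually_toZero_iff.1 h
  refine h ⟨min (δ / 2) 1, by positivity, min_le_right _ _⟩ ?_
  exact (min_le_left _ _).trans_lt (by linarith)

theorem tendsto_powNet {b : ℝ} (hb : 0 < b) : Tendsto (powNet b) toZero (𝓝 0) := by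
  have h : ContinuousAt (fun x : ℝ => x ^ b) 0 := Real.continuousAt_rpow_const _ _ (Or.inr hb.le)
  have := h.tendsto.comp (tendsto_comap (f := (Subtype.val : Eps → ℝ)) (x := 𝓝 0))
  rwa [Real.zero_rpow hb.ne'] at this

/-- Negligible nets in a normed group. -/
def IsNegl {E : Type*} [SeminormedAddCommGroup E] (a : Eps → E) : Prop :=
  ∀ q : ℕ, a =O[toZero] powNet q

section

variable {E : Type*} [SeminormedAddCommGroup E] {a b : Eps → E}

theorem IsNegl.zero : IsNegl (fun _ => (0 : E)) := fun _ => isBigO_zero _ _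

theorem IsNegl.add (ha : IsNegl a) (hb : IsNegl b) : IsNegl fun ε => a ε + b ε :=
  fun q => (ha q).add (hb q)

theorem IsNegl.neg (ha : IsNegl a) : IsNegl fun ε => -a ε := fun q => (ha q).neg_left

theorem IsNegl.sub (ha : IsNegl a) (hb : IsNegl b) : IsNegl fun ε => a ε - b ε :=
  fun q => (ha q).sub (hb q)

theorem IsNegl.symm (h : IsNegl fun ε => a ε - b ε) : IsNegl fun ε => b ε - a ε := by
  simpa using h.neg

theorem IsNegl.trans {c : Eps → E} (h : IsNegl fun ε => a ε - b ε)
    (h' : IsNegl fun ε => b ε - c ε) : IsNegl fun ε => a ε - c ε := by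
  simpa using h.add h'

theorem IsNegl.of_le {F : Type*} [SeminormedAddCommGroup F] {f : Eps → F} (ha : IsNegl a)
    (C : ℝ) (h : ∀ᶠ ε in toZero, ‖f ε‖ ≤ C * ‖a ε‖) : IsNegl f :=
  fun q => (IsBigO.of_bound C h).trans (ha q)

/-- A moderate factor does not change negligibility. -/
theorem IsNegl.of_le_powNet {F : Type*} [SeminormedAddCommGroup F] {f : Eps → F} (ha : IsNegl a)
    (C : ℝ) (N : ℕ) (h : ∀ᶠ ε in toZero, ‖f ε‖ ≤ C * powNet (-(N : ℝ)) ε * ‖a ε‖) : IsNegl f := by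
  intro q
  have h1 : f =O[toZero] fun ε => powNet (-(N : ℝ)) ε * ‖a ε‖ := by
    refine IsBigO.of_bound C (h.mono fun ε hε => hε.trans (le_of_eq ?_))
    rw [Real.norm_of_nonneg (mul_nonneg (powNet_pos _ _).le (norm_nonneg _)), mul_assoc]
  refine h1.trans (((isBigO_refl _ _).mul (ha (q + N)).norm_left).trans ?_)
  rw [powNet_mul]
  exact powNet_isBigO (by push_cast; linarith)

theorem IsNegl.sum {ι : Type*} (s : Finset ι) {f : ι → Eps → E} (h : ∀ i ∈ s, IsNegl (f i)) :
    IsNegl fun ε => ∑ i ∈ s, f i ε := by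
  intro q
  exact IsBigO.fun_sum fun i hi => h i hi q

theorem isNegl_norm : (IsNegl fun ε => ‖a ε‖) ↔ IsNegl a :=
  forall_congr' fun _ => isBigO_norm_left

theorem IsNegl.isBigO (h : IsNegl a) (b : ℝ) : a =O[toZero] powNet b :=
  (h ⌈b⌉₊).trans (powNet_isBigO (Nat.le_ceil b))

/-- A negligible net tends to `0`, and the filter is nontrivial. Through this, vanishing in `ℂ~` of
a value computed from a constant net becomes vanishing in `ℂ`. -/
theorem isNegl_const {c : E} : (IsNegl fun _ => c) ↔ ‖c‖ = 0 := by
  constructor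
  · intro h
    exact tendsto_nhds_unique tendsto_const_nhds
      ((h 1).norm_left.trans_tendsto (tendsto_powNet (b := ((1 : ℕ) : ℝ)) (by simp)))
  · intro h q
    exact IsBigO.of_bound 0 (Eventually.of_forall fun ε => by simp [h])

end

theorem IsNegl.mem_modNets {a : Eps → ℂ} (h : IsNegl a) : a ∈ modNets := by
  refine ⟨0, (h 0).trans (powNet_isBigO (by simp))⟩

theorem mem_modNets_of_isBigO {a : Eps → ℂ} {b : ℝ} (h : a =O[toZero] powNet b) : a ∈ modNets :=
  ⟨⌈-b⌉₊, h.trans (powNet_isBigO (by linarith [Nat.le_ceil (-b)]))⟩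

/-! ### Representatives of generalized numbers -/

namespace GenNumber

theorem exists_rep (z : GenNumber) : ∃ a, z.IsRep a := by
  obtain ⟨a, rfl⟩ := Ideal.Quotient.mk_surjective z
  exact ⟨a, a.2, rfl⟩

theorem isRep_mk {a : Eps → ℂ} (h : a ∈ modNets) : (mk ⟨a, h⟩).IsRep a := ⟨h, rfl⟩

variable {z y : GenNumber} {a b : Eps → ℂ}

theorem IsRep.eq_iff (hz : z.IsRep a) (hy : y.IsRep b) : z = y ↔ IsNegl fun ε => a ε - b ε := by
  obtain ⟨ha, rfl⟩ := hz
  obtain ⟨hb, rfl⟩ := hy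
  exact Ideal.Quotient.eq

theorem IsRep.unique (hz : z.IsRep a) (hy : y.IsRep a) : z = y :=
  (hz.eq_iff hy).2 (by simpa using IsNegl.zero)

theorem IsRep.congr (hz : z.IsRep a) (h : IsNegl fun ε => a ε - b ε) : z.IsRep b := by
  have hb : b ∈ modNets := by
    have := modNets.sub_mem hz.1 h.mem_modNets
    convert this using 1
    funext ε
    simp
  refine ⟨hb, ?_⟩
  exact ((hz.eq_iff (isRep_mk hb)).2 h).symm

theorem IsRep.add (hz : z.IsRep a) (hy : y.IsRep b) : (z + y).IsRep fun ε => a ε + b ε := by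
  obtain ⟨ha, rfl⟩ := hz
  obtain ⟨hb, rfl⟩ := hy
  exact ⟨modNets.add_mem ha hb, rfl⟩

theorem IsRep.mul (hz : z.IsRep a) (hy : y.IsRep b) : (z * y).IsRep fun ε => a ε * b ε := by
  obtain ⟨ha, rfl⟩ := hz
  obtain ⟨hb, rfl⟩ := hy
  exact ⟨modNets.mul_mem ha hb, rfl⟩

theorem isRep_zero : (0 : GenNumber).IsRep fun _ => 0 := ⟨modNets.zero_mem, rfl⟩

theorem IsRep.eq_zero_iff (hz : z.IsRep a) : z = 0 ↔ IsNegl a := by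
  rw [hz.eq_iff isRep_zero]
  simp

/-! ### The sharp topology of `ℂ~` -/

theorem absE_bddBelow (z : GenNumber) :
    BddBelow {r | ∃ (a : Eps → ℂ) (b : ℝ), z.IsRep a ∧ a =O[toZero] powNet b ∧
      r = Real.exp (-b)} :=
  ⟨0, by rintro r ⟨a, b, -, -, rfl⟩; exact (Real.exp_pos _).le⟩

theorem absE_nonneg (z : GenNumber) : 0 ≤ z.absE :=
  Real.sInf_nonneg (by rintro r ⟨a, b, -, -, rfl⟩; exact (Real.exp_pos _).le)

theorem IsRep.absE_le (hz : z.IsRep a) {b : ℝ} (h : a =O[toZero] powNet b) :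
    z.absE ≤ Real.exp (-b) :=
  csInf_le (absE_bddBelow z) ⟨a, b, hz, h, rfl⟩

/-- The infimum in `absE` runs over all representatives. Two of them differ by a negligible net, so
an order estimate for one transfers to any prescribed one. -/
theorem IsRep.exists_of_absE_lt (hz : z.IsRep a) {r : ℝ} (h : z.absE < r) :
    ∃ b : ℝ, a =O[toZero] powNet b ∧ Real.exp (-b) < r := by
  have hne : {r | ∃ (a : Eps → ℂ) (b : ℝ), z.IsRep a ∧ a =O[toZero] powNet b ∧
      r = Real.exp (-b)}.Nonempty := by
    obtain ⟨N, hN⟩ := hz.1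
    exact ⟨_, a, _, hz, hN, rfl⟩
  obtain ⟨_, ⟨a', b, ha', hb, rfl⟩, hlt⟩ := exists_lt_of_csInf_lt hne h
  refine ⟨b, ?_, hlt⟩
  have := (((hz.eq_iff ha').1 rfl).isBigO b).add hb
  simpa using this

theorem absE_zero : (0 : GenNumber).absE = 0 := by
  refine le_antisymm (le_of_forall_pos_le_add fun r hr => ?_) (absE_nonneg _)
  have := isRep_zero.absE_le (b := -Real.log r) (isBigO_zero _ _)
  simpa [Real.exp_log hr] using this

theorem absE_add_lt {r : ℝ} (hz : z.absE < r) (hy : y.absE < r) : (z + y).absE < r := by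
  obtain ⟨a, ha⟩ := exists_rep z
  obtain ⟨b, hb⟩ := exists_rep y
  obtain ⟨s, hs, hsr⟩ := ha.exists_of_absE_lt hz
  obtain ⟨t, ht, htr⟩ := hb.exists_of_absE_lt hy
  refine ((ha.add hb).absE_le (b := min s t) ((hs.trans (powNet_isBigO (min_le_left _ _))).add
    (ht.trans (powNet_isBigO (min_le_right _ _))))).trans_lt ?_
  rcases min_choice s t with h | h <;> rwa [h]

theorem absE_mul_lt {r s : ℝ} (hz : z.absE < r) (hy : y.absE < s) : (z * y).absE < r * s := by
  obtain ⟨a, ha⟩ := exists_rep z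
  obtain ⟨b, hb⟩ := exists_rep y
  obtain ⟨t, ht, htr⟩ := ha.exists_of_absE_lt hz
  obtain ⟨t', ht', htr'⟩ := hb.exists_of_absE_lt hy
  have h := (ha.mul hb).absE_le (b := t + t') (by simpa only [powNet_mul] using ht.mul ht')
  refine h.trans_lt ?_
  rw [neg_add, Real.exp_add]
  exact mul_lt_mul'' htr htr' (Real.exp_pos _).le (Real.exp_pos _).le

/-- Submultiplicativity is available only for strict bounds. With `|z|_e < s < r` one has `|c|_e ≤ 1
< r / s`. This makes the balls about `0` balanced. -/
theorem absE_mul_lt_of_le_one {c : GenNumber} {r : ℝ} (hc : c.absE ≤ 1) (hz : z.absE < r) :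
    (c * z).absE < r := by
  obtain ⟨s, hs, hsr⟩ := exists_between hz
  have hs0 : 0 < s := (absE_nonneg z).trans_lt hs
  have := absE_mul_lt (hc.trans_lt ((one_lt_div hs0).2 hsr)) hs
  rwa [div_mul_cancel₀ _ hs0.ne'] at this

theorem isOpen_ball (z : GenNumber) {r : ℝ} (hr : 0 < r) : IsOpen {y : GenNumber | (y - z).absE < r} :=
  isOpen_generateFrom_of_mem ⟨z, r, hr, rfl⟩

/-- The topology is generated by balls with arbitrary centres. By the ultrametric inequality, a ball
containing `z` contains the ball of the same radius about `z`, so centred balls suffice and are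
directed. -/
theorem hasBasis_nhds (z : GenNumber) :
    (𝓝 z).HasBasis (fun r : ℝ => 0 < r) fun r => {y | (y - z).absE < r} := by
  refine ⟨fun s => ⟨fun hs => ?_, fun ⟨r, hr, h⟩ => mem_of_superset
    ((isOpen_ball z hr).mem_nhds (by simpa [absE_zero] using hr)) h⟩⟩
  rw [nhds_generateFrom] at hs
  have : (⨅ s ∈ {s | z ∈ s ∧ s ∈ {B | ∃ (z : GenNumber) (r : ℝ), 0 < r ∧
      B = {y | (y - z).absE < r}}}, 𝓟 s) ≥ ⨅ r ∈ Set.Ioi (0 : ℝ), 𝓟 {y | (y - z).absE < r} := by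
    refine le_iInf₂ fun B hB => ?_
    obtain ⟨hzB, y, r, hr, rfl⟩ := hB
    refine iInf₂_le_of_le r hr (principal_mono.2 fun x hx => ?_)
    have := absE_add_lt (z := x - z) (y := z - y) hx hzB
    simpa using this
  have hs' := this hs
  rw [mem_biInf_of_directed] at hs'
  · obtain ⟨r, hr, h⟩ := hs'
    exact ⟨r, hr, h⟩
  · rintro r hr s hs
    refine ⟨min r s, lt_min (Set.mem_Ioi.1 hr) (Set.mem_Ioi.1 hs), ?_, ?_⟩
    · exact principal_mono.2 fun x hx => (Set.mem_ofPred.1 hx).trans_le (min_le_left _ _)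
    · exact principal_mono.2 fun x hx => (Set.mem_ofPred.1 hx).trans_le (min_le_right _ _)
  · exact ⟨1, Set.mem_Ioi.2 one_pos⟩

instance : ContinuousAdd GenNumber := by
  refine ⟨continuous_iff_continuousAt.2 fun ⟨x, y⟩ => ?_⟩
  rw [ContinuousAt, nhds_prod_eq, ((hasBasis_nhds x).prod (hasBasis_nhds y)).tendsto_iff
    (hasBasis_nhds (x + y))]
  refine fun r hr => ⟨(r, r), ⟨hr, hr⟩, fun p hp => ?_⟩
  have := absE_add_lt hp.1 hp.2
  rwa [sub_add_sub_comm] at this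

instance : ContinuousMul GenNumber := by
  refine ⟨continuous_iff_continuousAt.2 fun ⟨x, y⟩ => ?_⟩
  rw [ContinuousAt, nhds_prod_eq, ((hasBasis_nhds x).prod (hasBasis_nhds y)).tendsto_iff
    (hasBasis_nhds (x * y))]
  intro r hr
  -- The increment of the product is `(p₁ - x)(p₂ - y) + x(p₂ - y) + (p₁ - x)y`. The bounds `1` and
  -- `r` on the radius control the quadratic term, the last one the linear terms.
  have key : ∀ w : GenNumber, ∃ s > 0, s ≤ 1 ∧ s ≤ r ∧ ∀ t : GenNumber, t.absE < s →
      (w * t).absE < r := by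
    intro w
    have hw : 0 < w.absE + 1 := by linarith [absE_nonneg w]
    refine ⟨min (min 1 r) (r / (w.absE + 1)), by positivity,
      (min_le_left _ _).trans (min_le_left _ _), (min_le_left _ _).trans (min_le_right _ _),
      fun t ht => ?_⟩
    have := absE_mul_lt (lt_add_one w.absE) (ht.trans_le (min_le_right _ _))
    rwa [mul_div_cancel₀ _ hw.ne'] at this
  obtain ⟨s, hs, hs1, hsr, hs'⟩ := key x
  obtain ⟨t, ht, ht1, htr, ht'⟩ := key y
  refine ⟨(t, s), ⟨ht, hs⟩, fun p hp => ?_⟩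
  have h1 : ((p.1 - x) * (p.2 - y)).absE < 1 * r :=
    absE_mul_lt (lt_of_lt_of_le hp.1 ht1) (lt_of_lt_of_le hp.2 hsr)
  rw [one_mul] at h1
  have := absE_add_lt h1 (absE_add_lt (hs' _ hp.2) (ht' _ hp.1))
  change (p.1 * p.2 - x * y).absE < r
  convert this using 2
  ring

end GenNumber

/-! ### Representatives in `𝓖_E` and continuous functionals -/

section General

variable {F ι : Type} [AddCommGroup F] [Module ℂ F] {p : SeminormFamily ℂ F ι}

namespace GE

variable {z y : GE p} {a b : Eps → F}

theorem exists_rep (z : GE p) : ∃ a, z.IsRep a := by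
  obtain ⟨a, rfl⟩ := Submodule.Quotient.mk_surjective (neglE p) z
  exact ⟨a, a.2, rfl⟩

theorem isRep_mk {a : Eps → F} (h : a ∈ modE p) : (GE.mk ⟨a, h⟩).IsRep a := ⟨h, rfl⟩

theorem IsRep.eq_iff (hz : z.IsRep a) (hy : y.IsRep b) :
    z = y ↔ ∀ i, IsNegl fun ε => p i (a ε - b ε) := by
  obtain ⟨ha, rfl⟩ := hz
  obtain ⟨hb, rfl⟩ := hy
  exact Submodule.Quotient.eq (neglE p)

theorem IsRep.unique (hz : z.IsRep a) (hy : y.IsRep a) : z = y :=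
  (hz.eq_iff hy).2 fun i => by simpa using IsNegl.zero

theorem IsRep.add (hz : z.IsRep a) (hy : y.IsRep b) : (z + y).IsRep fun ε => a ε + b ε := by
  obtain ⟨ha, rfl⟩ := hz
  obtain ⟨hb, rfl⟩ := hy
  exact ⟨(modE p).add_mem ha hb, rfl⟩

theorem IsRep.smul {c : GenNumber} {s : Eps → ℂ} (hc : c.IsRep s) (hz : z.IsRep a) :
    (c • z).IsRep fun ε => s ε • a ε := by
  obtain ⟨hs, rfl⟩ := hc
  obtain ⟨ha, rfl⟩ := hz
  exact ⟨(modE p).smul_mem ⟨s, hs⟩ ha, rfl⟩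

theorem isRep_zero : (0 : GE p).IsRep fun _ => 0 := ⟨(modE p).zero_mem, rfl⟩

theorem IsRep.eq_zero_iff (hz : z.IsRep a) : z = 0 ↔ ∀ i, IsNegl fun ε => p i (a ε) := by
  rw [hz.eq_iff isRep_zero]
  simp

theorem IsRep.congr (hz : z.IsRep a) (h : ∀ i, IsNegl fun ε => p i (a ε - b ε)) : z.IsRep b := by
  have hab : (fun ε => a ε - b ε) ∈ modE p := fun i =>
    ⟨0, (h i 0).trans (powNet_isBigO (by simp))⟩
  have hb : b ∈ modE p := by
    have := (modE p).sub_mem hz.1 hab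
    convert this using 1
    funext ε
    simp
  exact ⟨hb, ((hz.eq_iff (isRep_mk hb)).2 h).symm⟩

theorem IsRep.isBigO_congr (hz : z.IsRep a) (hy : z.IsRep b) {i : ι} {t : ℝ}
    (h : (fun ε => p i (a ε)) =O[toZero] powNet t) : (fun ε => p i (b ε)) =O[toZero] powNet t := by
  have h1 := ((hz.eq_iff hy).1 rfl i).isBigO t
  refine IsBigO.trans (IsBigO.of_bound 1 (Eventually.of_forall fun ε => ?_)) (h.add h1)
  rw [one_mul, Real.norm_of_nonneg (apply_nonneg _ _),
    Real.norm_of_nonneg (add_nonneg (apply_nonneg _ _) (apply_nonneg _ _))]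
  calc p i (b ε) = p i (a ε - (a ε - b ε)) := by rw [sub_sub_cancel]
    _ ≤ _ := map_sub_le_add _ _ _

theorem upsn_zero (i : ι) : GE.upsn i (0 : GE p) ≤ 0 := by
  refine le_of_forall_pos_le_add fun r hr => ?_
  have : GE.upsn i (0 : GE p) ≤ Real.exp (-(-Real.log r)) := by
    refine csInf_le ⟨0, ?_⟩ ⟨_, _, isRep_zero, ?_, rfl⟩
    · rintro r ⟨a, b, -, -, rfl⟩
      exact (Real.exp_pos _).le
    · simpa using isBigO_zero _ _
  simpa [Real.exp_log hr] using this

theorem IsRep.exists_of_upsn_lt (hz : z.IsRep a) {i : ι} {r : ℝ} (h : GE.upsn i z < r) :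
    ∃ b : ℝ, (fun ε => p i (a ε)) =O[toZero] powNet b ∧ Real.exp (-b) < r := by
  have hne : {r | ∃ (u : Eps → F) (b : ℝ), z.IsRep u ∧
      (fun ε => p i (u ε)) =O[toZero] powNet b ∧ r = Real.exp (-b)}.Nonempty := by
    obtain ⟨N, hN⟩ := hz.1 i
    exact ⟨_, a, _, hz, hN, rfl⟩
  obtain ⟨_, ⟨a', b, ha', hb, rfl⟩, hlt⟩ := exists_lt_of_csInf_lt hne h
  exact ⟨b, ha'.isBigO_congr hz hb, hlt⟩

theorem isOpen_ball (z : GE p) (i : ι) {r : ℝ} (hr : 0 < r) :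
    IsOpen {y : GE p | GE.upsn i (y - z) < r} :=
  isOpen_generateFrom_of_mem ⟨i, z, r, hr, rfl⟩

/-- An additive map to `ℂ~` that is bounded by finitely many ultra-pseudo-seminorms is continuous. -/
theorem continuous_of_bound (T : GE p →+ GenNumber) (s : Finset ι) (c : ℝ)
    (h : ∀ (u : GE p) (a : Eps → F), u.IsRep a → ∀ b : ℝ,
      (∀ i ∈ s, (fun ε => p i (a ε)) =O[toZero] powNet b) →
      ∃ d, (T u).IsRep d ∧ d =O[toZero] powNet (b - c)) : Continuous T := by
  refine continuous_generateFrom_iff.2 ?_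
  rintro _ ⟨z, r, hr, rfl⟩
  rw [isOpen_iff_mem_nhds]
  intro u hu
  -- A loss of `ε^(-c)` multiplies ultra-norms by `e^c`. Radius `δ / 2` therefore gives values of
  -- size at most `r / 2 < r`, and the ultrametric inequality adds them to `T u - z` without
  -- enlarging the ball.
  set δ := r * Real.exp (-c) with hδ
  have hδ0 : 0 < δ := by positivity
  have hU : (⋂ i ∈ s, {v : GE p | GE.upsn i (v - u) < δ / 2}) ∈ 𝓝 u := by
    refine (biInter_finset_mem s).2 fun i _ => (isOpen_ball u i (by positivity)).mem_nhds ?_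
    change GE.upsn i (u - u) < δ / 2
    rw [sub_self]
    exact (upsn_zero i).trans_lt (by positivity)
  refine mem_of_superset hU fun v hv => ?_
  obtain ⟨a, ha⟩ := exists_rep (v - u)
  have hb : ∀ i ∈ s, (fun ε => p i (a ε)) =O[toZero] powNet (-Real.log (δ / 2)) := by
    intro i hi
    obtain ⟨t, ht, hlt⟩ := ha.exists_of_upsn_lt (Set.mem_iInter₂.1 hv i hi)
    refine ht.trans (powNet_isBigO ?_)
    have := (Real.lt_log_iff_exp_lt (by positivity)).2 hlt
    linarith
  obtain ⟨d, hd, hdO⟩ := h _ a ha _ hb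
  have h1 : (T (v - u)).absE < r := by
    refine (hd.absE_le hdO).trans_lt ?_
    rw [neg_sub, sub_neg_eq_add, Real.exp_add, Real.exp_log (by positivity), hδ, mul_comm c.exp]
    rw [div_mul_eq_mul_div, mul_assoc, ← Real.exp_add]
    simpa using hr
  have h2 := GenNumber.absE_add_lt h1 hu
  rw [map_sub, sub_add_sub_cancel] at h2
  exact h2

/-- A net of linear forms on `E` that is bounded by a seminorm up to a moderate factor induces a
continuous functional on `𝓖_E`. -/
theorem exists_functional (l : Eps → F →ₗ[ℂ] ℂ) (s : Finset ι) (C : ℝ) (N : ℕ)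
    (hl : ∀ᶠ ε in toZero, ∀ f, ‖l ε f‖ ≤ C * powNet (-(N : ℝ)) ε * ∑ i ∈ s, p i f) :
    ∃ T : GE p →L[GenNumber] GenNumber, ∀ (u : GE p) (a : Eps → F), u.IsRep a →
      (T u).IsRep fun ε => l ε (a ε) := by
  have key : ∀ (a : Eps → F) (b : ℝ), (∀ i ∈ s, (fun ε => p i (a ε)) =O[toZero] powNet b) →
      (fun ε => l ε (a ε)) =O[toZero] powNet (b - N) := by
    intro a b hb
    have h1 : (fun ε => l ε (a ε)) =O[toZero]
        fun ε => powNet (-(N : ℝ)) ε * ∑ i ∈ s, p i (a ε) := by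
      refine IsBigO.of_bound C (hl.mono fun ε hε => (hε _).trans (le_of_eq ?_))
      rw [Real.norm_of_nonneg (mul_nonneg (powNet_pos _ _).le
        (Finset.sum_nonneg fun i _ => apply_nonneg _ _)), mul_assoc]
    refine h1.trans (((isBigO_refl _ _).mul (IsBigO.fun_sum hb)).trans ?_)
    rw [powNet_mul]
    exact powNet_isBigO (by linarith)
  have hmod : ∀ a ∈ modE p, (fun ε => l ε (a ε)) ∈ modNets := by
    intro a ha
    choose M hM using ha
    refine mem_modNets_of_isBigO (key a (-(∑ i ∈ s, M i : ℕ)) fun i hi =>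
      (hM i).trans (powNet_isBigO ?_))
    rw [neg_le_neg_iff]
    exact_mod_cast Finset.single_le_sum (f := M) (fun _ _ => Nat.zero_le _) hi
  choose rep hrep using exists_rep (p := p)
  have hT : ∀ (u : GE p) (a : Eps → F), u.IsRep a →
      (GenNumber.mk ⟨fun ε => l ε (rep u ε), hmod _ (hrep u).1⟩).IsRep fun ε => l ε (a ε) := by
    intro u a ha
    refine (GenNumber.isRep_mk (hmod _ (hrep u).1)).congr fun q => ?_
    have h1 := key (fun ε => rep u ε - a ε) ((q : ℝ) + N) fun i _ =>
      (((hrep u).eq_iff ha).1 rfl i).isBigO _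
    simpa using h1
  let T : GE p →ₗ[GenNumber] GenNumber :=
    { toFun := fun u => GenNumber.mk ⟨fun ε => l ε (rep u ε), hmod _ (hrep u).1⟩
      map_add' := fun u v => by
        refine (hT _ _ ((hrep u).add (hrep v))).unique ?_
        simpa using (hT u _ (hrep u)).add (hT v _ (hrep v))
      map_smul' := fun c u => by
        obtain ⟨t, ht⟩ := GenNumber.exists_rep c
        refine (hT _ _ (IsRep.smul ht (hrep u))).unique ?_
        simpa using ht.mul (hT u _ (hrep u)) }
  refine ⟨⟨T, continuous_of_bound T.toAddMonoidHom s N fun u a ha b hb => ⟨_, hT u a ha, key a b hb⟩⟩, hT⟩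

end GE

end General

/-! ### Suprema of derivatives -/

section

variable {n : ℕ} {Ω V : Opens (Eu n)}

theorem supDeriv_le {K : Set (Eu n)} {j : ℕ} {f : Eu n → ℂ} {B : ℝ} (hB : 0 ≤ B)
    (h : ∀ i ≤ j, ∀ x ∈ K, ‖iteratedFDeriv ℝ i f x‖ ≤ B) : supDeriv K j f ≤ B :=
  Real.iSup_le (fun q => h _ (Nat.lt_succ_iff.1 q.1.2) _ q.2.2) hB

theorem norm_iteratedFDeriv_le_supDeriv (K : CompactIn Ω) (f : SmoothOn Ω) {i j : ℕ} (hi : i ≤ j)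
    {x : Eu n} (hx : x ∈ K.1) : ‖iteratedFDeriv ℝ i f x‖ ≤ supDeriv K.1 j f :=
  le_ciSup (bddAbove_supDeriv K j f) (⟨⟨i, Nat.lt_succ_iff.2 hi⟩, ⟨x, hx⟩⟩ : Fin (j + 1) × K.1)

theorem norm_le_supDeriv (K : CompactIn Ω) (f : SmoothOn Ω) (j : ℕ)
    {x : Eu n} (hx : x ∈ K.1) : ‖f x‖ ≤ supDeriv K.1 j f := by
  simpa using norm_iteratedFDeriv_le_supDeriv K f (Nat.zero_le j) hx

theorem supDeriv_mono {K : Set (Eu n)} {L : CompactIn Ω} (h : K ⊆ L.1) {i j : ℕ} (hij : i ≤ j)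
    (f : SmoothOn Ω) : supDeriv K i f ≤ supDeriv L.1 j f :=
  supDeriv_le (supDeriv_nonneg _ _ _) fun _ hk _ hx =>
    norm_iteratedFDeriv_le_supDeriv L f (hk.trans hij) (h hx)

theorem iteratedFDeriv_congr_of_eqOn {f g : Eu n → ℂ} {U : Set (Eu n)} (hU : IsOpen U)
    (h : Set.EqOn f g U) (i : ℕ) {x : Eu n} (hx : x ∈ U) :
    iteratedFDeriv ℝ i f x = iteratedFDeriv ℝ i g x :=
  ((h.eventuallyEq_of_mem (hU.mem_nhds hx)).iteratedFDeriv ℝ i).eq_of_nhds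

theorem supDeriv_congr {f g : Eu n → ℂ} {U K : Set (Eu n)} (hU : IsOpen U) (hK : K ⊆ U)
    (h : Set.EqOn f g U) (j : ℕ) : supDeriv K j f = supDeriv K j g := by
  unfold supDeriv
  congr 1
  funext q
  rw [iteratedFDeriv_congr_of_eqOn hU h _ (hK q.2.2)]

/-- The Leibniz rule as a bound for the derivatives of a product with a fixed factor. -/
theorem exists_bound_iteratedFDeriv_mul {χ : Eu n → ℂ} (hχ : ContDiff ℝ ∞ χ)
    (hc : HasCompactSupport χ) (j : ℕ) :
    ∃ C ≥ 0, ∀ (f : Eu n → ℂ) (x : Eu n) (B : ℝ), ContDiffAt ℝ ∞ f x →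
      (∀ i ≤ j, ‖iteratedFDeriv ℝ i f x‖ ≤ B) →
      ∀ i ≤ j, ‖iteratedFDeriv ℝ i (fun y => χ y * f y) x‖ ≤ C * B := by
  have hb : ∀ i : ℕ, ∃ C : ℝ, ∀ x, ‖iteratedFDeriv ℝ i χ x‖ ≤ C := fun i =>
    (hχ.continuous_iteratedFDeriv (by exact_mod_cast le_top)).bounded_above_of_compact_support
      (hc.iteratedFDeriv i)
  choose D hD using hb
  have hD0 : ∀ i, 0 ≤ D i := fun i => (norm_nonneg _).trans (hD i 0)
  refine ⟨∑ i ∈ Finset.range (j + 1), ∑ k ∈ Finset.range (i + 1), (i.choose k : ℝ) * D k,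
    Finset.sum_nonneg fun i _ => Finset.sum_nonneg fun k _ => mul_nonneg (by positivity) (hD0 k),
    fun f x B hf hB i hi => ?_⟩
  have hB0 : 0 ≤ B := (norm_nonneg _).trans (hB 0 (Nat.zero_le _))
  -- The factor `f` is smooth only at `x`. For each finite order this gives a neighbourhood on which
  -- it is differentiable that often, and the Leibniz rule is applied within its interior.
  obtain ⟨u, hu, hfu⟩ := (hf.of_le (m := (i : ℕ∞)) (by exact_mod_cast le_top)).contDiffOn le_rfl
    (by simp)
  have hx : x ∈ interior u := mem_interior_iff_mem_nhds.2 hu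
  have key := norm_iteratedFDerivWithin_mul_le (N := (i : ℕ∞)) (n := i)
    (hχ.of_le (by exact_mod_cast le_top)).contDiffOn
    (hfu.mono interior_subset) isOpen_interior.uniqueDiffOn hx le_rfl
  simp only [iteratedFDerivWithin_of_isOpen _ isOpen_interior hx] at key
  refine key.trans ?_
  calc ∑ k ∈ Finset.range (i + 1), (i.choose k : ℝ) * ‖iteratedFDeriv ℝ k χ x‖ *
        ‖iteratedFDeriv ℝ (i - k) f x‖
      ≤ ∑ k ∈ Finset.range (i + 1), (i.choose k : ℝ) * D k * B := by
        refine Finset.sum_le_sum fun k _ => ?_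
        have h1 := hD k x
        have h2 := hB (i - k) ((Nat.sub_le _ _).trans hi)
        have h3 := hD0 k
        gcongr
    _ = (∑ k ∈ Finset.range (i + 1), (i.choose k : ℝ) * D k) * B := by rw [Finset.sum_mul]
    _ ≤ _ := by
        refine mul_le_mul_of_nonneg_right ?_ hB0
        exact Finset.single_le_sum
          (f := fun i => ∑ k ∈ Finset.range (i + 1), (i.choose k : ℝ) * D k)
          (fun i _ => Finset.sum_nonneg fun k _ => mul_nonneg (by positivity) (hD0 k))
          (Finset.mem_range.2 (Nat.lt_succ_iff.2 hi))

/-! ### Cutoff functions -/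

theorem exists_cutoff {K : Set (Eu n)} (hK : IsCompact K) {U : Set (Eu n)} (hU : IsOpen U)
    (hUΩ : U ⊆ Ω) (hKU : K ⊆ U) :
    ∃ χ : 𝓓(Ω, ℂ), tsupport χ ⊆ U ∧ ∃ W : Opens (Eu n), K ⊆ W ∧ (W : Set (Eu n)) ⊆ U ∧
      ∀ x ∈ W, χ x = 1 := by
  obtain ⟨L, hL, hKL, hLU⟩ := exists_compact_between hK hU hKU
  obtain ⟨f, hf1, hf0, -⟩ := exists_contMDiffMap_one_nhds_of_subset_interior
    (modelWithCornersSelf ℝ (Eu n)) (n := ⊤) hK.isClosed hKL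
  have hsm : ContDiff ℝ ∞ (fun x => (f x : ℂ)) :=
    Complex.ofRealCLM.contDiff.comp f.contMDiff.contDiff
  have hts : tsupport (fun x => (f x : ℂ)) ⊆ L := by
    refine closure_minimal (fun x hx => ?_) hL.isClosed
    by_contra hxL
    exact hx (by simp [hf0 x hxL])
  obtain ⟨W, hW, hKW, hW1⟩ := eventually_nhdsSet_iff_exists.1 hf1
  refine ⟨⟨fun x => f x, hsm, hL.of_isClosed_subset (isClosed_tsupport _) hts,
    hts.trans (hLU.trans hUΩ)⟩, hts.trans hLU, ⟨⟨W ∩ U, hW.inter hU⟩, Set.subset_inter hKW hKU,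
    Set.inter_subset_right, fun x hx => ?_⟩⟩
  change (f x : ℂ) = 1
  rw [hW1 x hx.1]
  simp

/-- The product of a test function with support in `V` and a smooth function on `V`. -/
def cut (χ : 𝓓(Ω, ℂ)) (h : tsupport χ ⊆ V) : SmoothOn V →ₗ[ℂ] 𝓓(Ω, ℂ) where
  toFun f := ⟨fun x => χ x * f x,
    contDiff_iff_contDiffAt.2 fun x => by
      by_cases hx : x ∈ V
      · exact χ.contDiff.contDiffAt.mul (f.contDiffAt hx)
      · refine (contDiffAt_const (c := (0 : ℂ))).congr_of_eventuallyEq ?_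
        have : ∀ᶠ y in 𝓝 x, y ∉ tsupport χ :=
          (isClosed_tsupport _).isOpen_compl.mem_nhds fun hx' => hx (h hx')
        filter_upwards [this] with y hy
        rw [image_eq_zero_of_notMem_tsupport hy, zero_mul],
    χ.hasCompactSupport.mul_right, tsupport_mul_subset_left.trans χ.tsupport_subset⟩
  map_add' f g := by
    ext x
    exact mul_add _ _ _
  map_smul' c f := by
    ext x
    exact mul_left_comm _ _ _

theorem tsupport_cut (χ : 𝓓(Ω, ℂ)) (h : tsupport χ ⊆ V) (f : SmoothOn V) :
    tsupport (cut χ h f) ⊆ tsupport χ := tsupport_mul_subset_left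

/-- The support of a test function as a compact subset of an open set containing it. -/
def suppIn (χ : 𝓓(Ω, ℂ)) (h : tsupport χ ⊆ V) : CompactIn V :=
  ⟨tsupport χ, χ.hasCompactSupport, h⟩

theorem iteratedFDeriv_eq_zero_of_notMem_tsupport {f : Eu n → ℂ} {x : Eu n} (hx : x ∉ tsupport f)
    (i : ℕ) : iteratedFDeriv ℝ i f x = 0 :=
  image_eq_zero_of_notMem_tsupport fun h => hx (tsupport_iteratedFDeriv_subset i h)

theorem exists_bound_cut (χ : 𝓓(Ω, ℂ)) (h : tsupport χ ⊆ V) (j : ℕ) :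
    ∃ C ≥ 0, ∀ f : SmoothOn V, ∀ i ≤ j, ∀ x,
      ‖iteratedFDeriv ℝ i (cut χ h f) x‖ ≤ C * supDeriv (tsupport χ) j f := by
  obtain ⟨C, hC, hb⟩ := exists_bound_iteratedFDeriv_mul χ.contDiff χ.hasCompactSupport j
  refine ⟨C, hC, fun f i hi x => ?_⟩
  by_cases hx : x ∈ tsupport χ
  · exact hb f x _ (f.contDiffAt (h hx))
      (fun k hk => norm_iteratedFDeriv_le_supDeriv (suppIn χ h) f hk hx) i hi
  · rw [iteratedFDeriv_eq_zero_of_notMem_tsupport fun hx' => hx (tsupport_cut χ h f hx'), norm_zero]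
    exact mul_nonneg hC (supDeriv_nonneg _ _ _)

/-! ### Seminorm bounds for distributions -/

/-- On test functions supported in `K`, `w` is a continuous form on a space topologized by the `C^j`
norms. It is bounded by finitely many of these, and the highest order occurring dominates the
others. -/
theorem Distr.exists_bound (w : Distr Ω) (K : CompactIn Ω) :
    ∃ C ≥ 0, ∃ j : ℕ, ∀ f : 𝓓(Ω, ℂ), tsupport f ⊆ K.1 → ‖w f‖ ≤ C * supDeriv K.1 j f := by
  let K' : Compacts (Eu n) := ⟨K.1, K.2.1⟩
  have hK' : (K' : Set (Eu n)) ⊆ Ω := K.2.2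
  let q : Seminorm ℂ 𝓓_{K'}(Eu n, ℂ) :=
    (normSeminorm ℂ ℂ).comp ((w ∘L TestFunction.ofSupportedInCLM ℂ hK').toLinearMap)
  have hq : Continuous q :=
    continuous_norm.comp (w ∘L TestFunction.ofSupportedInCLM ℂ hK').continuous
  obtain ⟨s, C, -, hC⟩ := Seminorm.bound_of_continuous
    (ContDiffMapSupportedIn.withSeminorms ℂ (Eu n) ℂ ⊤ K') q hq
  refine ⟨C, C.2, s.sup id, fun f hf => ?_⟩
  let fK : 𝓓_{K'}(Eu n, ℂ) := .of_support_subset f.contDiff (subset_closure.trans hf)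
  have h1 := hC fK
  refine h1.trans ?_
  change (C : ℝ) * _ ≤ _
  refine mul_le_mul_of_nonneg_left ?_ C.2
  refine Seminorm.finset_sup_apply_le (supDeriv_nonneg _ _ _) fun i hi => ?_
  refine (ContDiffMapSupportedIn.seminorm_top_le_iff ℂ (supDeriv_nonneg _ _ _) i fK).2
    fun x hx => ?_
  exact norm_iteratedFDeriv_le_supDeriv K (testToSmooth f) (Finset.le_sup (f := id) hi) hx

theorem smoothOn_withSeminorms : WithSeminorms (smoothSeminorms Ω) := ⟨rfl⟩

/-- Continuity gives a bound by finitely many `p_{K,j}`. The union of the compact sets and the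
maximal order turn them into a single seminorm. -/
theorem DistrC.exists_bound (w : DistrC Ω) :
    ∃ C ≥ 0, ∃ (K : CompactIn Ω) (j : ℕ), ∀ f : SmoothOn Ω, ‖w f‖ ≤ C * supDeriv K.1 j f := by
  let q : Seminorm ℂ (SmoothOn Ω) := (normSeminorm ℂ ℂ).comp w.toLinearMap
  have hq : Continuous q := continuous_norm.comp w.continuous
  obtain ⟨s, C, -, hC⟩ := Seminorm.bound_of_continuous (smoothOn_withSeminorms (Ω := Ω)) q hq
  let K : CompactIn Ω := ⟨⋃ i ∈ s, i.1.1, s.isCompact_biUnion fun i _ => i.1.2.1,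
    Set.iUnion₂_subset fun i _ => i.1.2.2⟩
  refine ⟨C, C.2, K, s.sup Prod.snd, fun f => (hC f).trans ?_⟩
  change (C : ℝ) * _ ≤ _
  refine mul_le_mul_of_nonneg_left ?_ C.2
  refine Seminorm.finset_sup_apply_le (supDeriv_nonneg _ _ _) fun i hi => ?_
  exact supDeriv_mono (L := K) (Set.subset_biUnion_of_mem (u := fun i : CompactIn Ω × ℕ => i.1.1) hi)
    (Finset.le_sup (f := Prod.snd) hi) f

/-! ### Restriction and support in `𝓖(Ω)` -/

namespace G

theorem isRep_restrict {u : G Ω} {a : Eps → SmoothOn Ω} (hu : u.IsRep a) (h : V ≤ Ω) :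
    (G.restrict h u).IsRep fun ε => (a ε).restrict h := by
  obtain ⟨ha, rfl⟩ := hu
  exact ⟨(restrictNet h ⟨a, ha⟩).2, rfl⟩

theorem restrict_eq_zero_iff {u : G Ω} {a : Eps → SmoothOn Ω} (hu : u.IsRep a) (h : V ≤ Ω) :
    G.restrict h u = 0 ↔ ∀ (K : CompactIn V) (j : ℕ), IsNegl fun ε => supDeriv K.1 j (a ε) := by
  rw [(isRep_restrict hu h).eq_zero_iff]
  exact ⟨fun h K j => h (K, j), fun h i => h i.1 i.2⟩

theorem exists_restrict_eq_zero {u : G Ω} {x : Eu n} (hx : x ∈ Ω) (hxu : x ∉ u.supp) :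
    ∃ (V : Opens (Eu n)) (h : V ≤ Ω), x ∈ V ∧ G.restrict h u = 0 := by
  by_contra! hne
  exact hxu ⟨hx, hne⟩

/-- A generalized function is negligible on compact sets outside its support. -/
theorem isNegl_of_disjoint_supp {u : G Ω} {a : Eps → SmoothOn Ω} (hu : u.IsRep a) (K : CompactIn Ω)
    (hK : Disjoint K.1 u.supp) (j : ℕ) : IsNegl fun ε => supDeriv K.1 j (a ε) := by
  -- The claim is enlarged to a compact superset and to all orders at once, which makes it stable
  -- under subsets and finite unions. Induction over compact sets then needs it only on a compact
  -- neighbourhood of each point.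
  suffices h : ∃ L : CompactIn Ω, K.1 ⊆ L.1 ∧ ∀ j, IsNegl fun ε => supDeriv L.1 j (a ε) by
    obtain ⟨L, hKL, hL⟩ := h
    refine (hL j).of_le 1 (Eventually.of_forall fun ε => ?_)
    rw [one_mul, Real.norm_of_nonneg (supDeriv_nonneg _ _ _),
      Real.norm_of_nonneg (supDeriv_nonneg _ _ _)]
    exact supDeriv_mono hKL le_rfl _
  refine K.2.1.induction_on (p := fun s => ∃ L : CompactIn Ω, s ⊆ L.1 ∧
    ∀ j, IsNegl fun ε => supDeriv L.1 j (a ε)) ?_ ?_ ?_ ?_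
  · refine ⟨⟨∅, isCompact_empty, Set.empty_subset _⟩, le_rfl, fun j => ?_⟩
    simpa [supDeriv] using IsNegl.zero
  · rintro s t hst ⟨L, hL, h⟩
    exact ⟨L, hst.trans hL, h⟩
  · rintro s t ⟨L, hL, h⟩ ⟨M, hM, k⟩
    refine ⟨⟨L.1 ∪ M.1, L.2.1.union M.2.1, Set.union_subset L.2.2 M.2.2⟩,
      Set.union_subset_union hL hM, fun j => ?_⟩
    refine ((h j).add (k j)).of_le 1 (Eventually.of_forall fun ε => ?_)
    have h1 := supDeriv_nonneg L.1 j (a ε)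
    have h2 := supDeriv_nonneg M.1 j (a ε)
    rw [one_mul, Real.norm_of_nonneg (supDeriv_nonneg _ _ _), Real.norm_of_nonneg (add_nonneg h1 h2)]
    refine supDeriv_le (add_nonneg h1 h2) fun i hi x hx => ?_
    rcases hx with hx | hx
    · exact (norm_iteratedFDeriv_le_supDeriv L (a ε) hi hx).trans (le_add_of_nonneg_right h2)
    · exact (norm_iteratedFDeriv_le_supDeriv M (a ε) hi hx).trans (le_add_of_nonneg_left h1)
  · intro x hx
    obtain ⟨V, hV, hxV, h0⟩ := exists_restrict_eq_zero (K.2.2 hx)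
      (Set.disjoint_left.1 hK hx)
    obtain ⟨L, hL, hLV, hLc⟩ := local_compact_nhds (V.isOpen.mem_nhds hxV)
    exact ⟨L, mem_nhdsWithin_of_mem_nhds hL, ⟨L, hLc, hLV.trans hV⟩, le_rfl,
      fun j => (restrict_eq_zero_iff hu hV).1 h0 ⟨L, hLc, hLV⟩ j⟩

theorem supp_subset_of_isRep {u : G Ω} {a : Eps → SmoothOn Ω} (hu : u.IsRep a) {K : Set (Eu n)}
    (hK : IsClosed K) (h : ∀ L : CompactIn Ω, Disjoint L.1 K → ∀ j, IsNegl fun ε => supDeriv L.1 j (a ε)) :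
    u.supp ⊆ K := by
  intro x hx
  by_contra hxK
  let V : Opens (Eu n) := ⟨Ω ∩ Kᶜ, Ω.isOpen.inter hK.isOpen_compl⟩
  have hV : V ≤ Ω := fun y hy => hy.1
  refine hx.2 V hV ⟨hx.1, hxK⟩ ((restrict_eq_zero_iff hu hV).2 fun L j => ?_)
  exact h ⟨L.1, L.2.1, L.2.2.trans hV⟩ (Set.disjoint_left.2 fun y hy => (L.2.2 hy).2) j

theorem supp_subset_of_tsupport {u : G Ω} {a : Eps → SmoothOn Ω} (hu : u.IsRep a) {K : Set (Eu n)}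
    (hK : IsClosed K) (h : ∀ ε, tsupport (a ε) ⊆ K) : u.supp ⊆ K := by
  refine supp_subset_of_isRep hu hK fun L hL j => ?_
  have : ∀ ε, supDeriv L.1 j (a ε) = 0 := fun ε => le_antisymm
    (supDeriv_le le_rfl fun i _ x hx => by
      rw [iteratedFDeriv_eq_zero_of_notMem_tsupport fun h' =>
        Set.disjoint_left.1 hL hx (h ε h'), norm_zero]) (supDeriv_nonneg _ _ _)
  simpa only [this] using IsNegl.zero

/-- Two generalized functions that agree on a neighbourhood of each compact set agree. -/
theorem ext_of_restrict {u v : G Ω} (h : ∀ K : CompactIn Ω, ∃ (V : Opens (Eu n)) (hV : V ≤ Ω),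
    K.1 ⊆ V ∧ G.restrict hV u = G.restrict hV v) : u = v := by
  obtain ⟨a, ha⟩ := GE.exists_rep u
  obtain ⟨b, hb⟩ := GE.exists_rep v
  refine (ha.eq_iff hb).2 fun i => ?_
  obtain ⟨V, hV, hKV, he⟩ := h i.1
  exact ((isRep_restrict ha hV).eq_iff (isRep_restrict hb hV)).1 he
    (⟨i.1.1, i.1.2.1, hKV⟩, i.2)

/-- Multiplying by a cutoff that is `1` near the support does not change a generalized function. -/
theorem isRep_cut {u : G Ω} {a : Eps → SmoothOn Ω} (hu : u.IsRep a) (χ : 𝓓(Ω, ℂ))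
    {W : Opens (Eu n)} (hW : u.supp ⊆ W) (h1 : ∀ x ∈ W, χ x = 1) :
    u.IsRep fun ε => testToSmooth (cut χ χ.tsupport_subset (a ε)) := by
  refine hu.congr fun ⟨K, j⟩ => ?_
  -- The error `(1 - χ) a` vanishes identically on `W`. The rest of `K` is compact and misses the
  -- support, so `a` is negligible there, and so is its product with `χ`.
  let L : CompactIn Ω := ⟨K.1 \ W, K.2.1.diff W.isOpen, Set.sdiff_subset.trans K.2.2⟩
  obtain ⟨C, hC, hb⟩ := exists_bound_iteratedFDeriv_mul χ.contDiff χ.hasCompactSupport j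
  refine (isNegl_of_disjoint_supp hu L (Set.disjoint_left.2 fun x hx hx' => hx.2 (hW hx')) j).of_le
    (1 + C) (Eventually.of_forall fun ε => ?_)
  rw [Real.norm_of_nonneg (apply_nonneg _ _), Real.norm_of_nonneg (supDeriv_nonneg _ _ _)]
  refine supDeriv_le (mul_nonneg (by linarith) (supDeriv_nonneg _ _ _)) fun i hi x hx => ?_
  by_cases hxW : x ∈ W
  · rw [iteratedFDeriv_congr_of_eqOn (g := fun _ => 0) W.isOpen (fun y hy => ?_) i hxW]
    · simp only [iteratedFDeriv_fun_zero, Pi.zero_apply, norm_zero]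
      exact mul_nonneg (by linarith) (supDeriv_nonneg _ _ _)
    · change a ε y - χ y * a ε y = 0
      rw [h1 y hy, one_mul, sub_self]
  · have hxL : x ∈ L.1 := ⟨hx, hxW⟩
    have hs : iteratedFDeriv ℝ i (a ε - testToSmooth (cut χ χ.tsupport_subset (a ε)) : SmoothOn Ω) x
        = iteratedFDeriv ℝ i (a ε) x - iteratedFDeriv ℝ i (fun y => χ y * a ε y) x :=
      iteratedFDeriv_sub_apply (((a ε).contDiffAt (K.2.2 hx)).of_le (by exact_mod_cast le_top))
        ((χ.contDiff.contDiffAt.mul ((a ε).contDiffAt (K.2.2 hx))).of_le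
          (by exact_mod_cast le_top))
    rw [hs, add_mul, one_mul]
    refine (norm_sub_le _ _).trans (add_le_add (norm_iteratedFDeriv_le_supDeriv L _ hi hxL) ?_)
    exact hb _ x _ ((a ε).contDiffAt (K.2.2 hx))
      (fun k hk => norm_iteratedFDeriv_le_supDeriv L _ hk hxL) i hi

end G

theorem Gc.exists_compact (u : Gc Ω) : ∃ K : CompactIn Ω, u.val.supp ⊆ K.1 := u.2

theorem Gc.ext' {u v : Gc Ω} (h : u.val = v.val) : u = v := Subtype.ext h

/-- The support is closed only relative to `Ω`; intersecting it with a compact subset of `Ω`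
excludes limit points on the boundary. -/
theorem G.isClosed_supp_inter {u : G Ω} (K : CompactIn Ω) : IsCompact (u.supp ∩ K.1) := by
  refine K.2.1.of_isClosed_subset ?_ Set.inter_subset_right
  rw [← isOpen_compl_iff, isOpen_iff_mem_nhds]
  intro x hx
  by_cases hxK : x ∈ K.1
  · obtain ⟨V, hV, hxV, h0⟩ := G.exists_restrict_eq_zero (K.2.2 hxK) fun h => hx ⟨h, hxK⟩
    exact mem_of_superset (V.isOpen.mem_nhds hxV) fun y hy hy' => hy'.1.2 V hV hy h0
  · exact mem_of_superset (K.2.1.isClosed.isOpen_compl.mem_nhds hxK) fun y hy hy' => hy hy'.2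

theorem Gc.isCompact_supp (u : Gc Ω) : IsCompact u.val.supp := by
  obtain ⟨K, hK⟩ := u.exists_compact
  have := G.isClosed_supp_inter (u := u.val) K
  rwa [Set.inter_eq_left.2 hK] at this

/-- A cutoff that is `1` near the support of a compactly supported generalized function. -/
theorem Gc.exists_cutoff (u : Gc Ω) (hV : u.val.supp ⊆ V) (hVΩ : V ≤ Ω) :
    ∃ χ : 𝓓(Ω, ℂ), tsupport χ ⊆ V ∧ ∃ W : Opens (Eu n), u.val.supp ⊆ W ∧ W ≤ V ∧
      ∀ x ∈ W, χ x = 1 :=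
  Colombeau.exists_cutoff u.isCompact_supp V.isOpen hVΩ hV

/-! ### Functionals on `𝓖_c(Ω)` -/

/-- Preimages of balls form a base at `0`. The ultrametric inequality makes them additive, and
`absE_mul_lt_of_le_one` makes them balanced. It serves to recognize the topology induced by a
functional as a competitor in the definition of the inductive limit topology. -/
theorem GenNumber.isLocallyConvexTopology_induced {M : Type} [AddCommGroup M] [Module GenNumber M]
    (T : M →ₗ[GenNumber] GenNumber) :
    IsLocallyConvexTopology (TopologicalSpace.induced T inferInstance) := by
  let _ : TopologicalSpace M := TopologicalSpace.induced T inferInstance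
  have hT : Continuous T := continuous_induced_dom
  refine ⟨⟨continuous_induced_rng.2 ?_⟩, ⟨continuous_induced_rng.2 ?_⟩, fun U hU => ?_⟩
  · have : (T ∘ fun p : M × M => p.1 + p.2) = fun p => T p.1 + T p.2 := by
      funext p
      simp
    rw [this]
    fun_prop
  · have : (T ∘ fun p : GenNumber × M => p.1 • p.2) = fun p => p.1 * T p.2 := by
      funext p
      simp
    rw [this]
    fun_prop
  · rw [nhds_induced, map_zero] at hU
    obtain ⟨r, hr, h⟩ := ((GenNumber.hasBasis_nhds 0).comap T).mem_iff.1 hU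
    refine ⟨_, ?_, h, fun x hx y hy => ?_, fun c hc x hx => ?_⟩
    · rw [nhds_induced, map_zero]
      exact ((GenNumber.hasBasis_nhds 0).comap T).mem_of_mem hr
    · change (T (x + y) - 0).absE < r
      have := GenNumber.absE_add_lt (z := T x - 0) (y := T y - 0) hx hy
      simpa using this
    · change (T (c • x) - 0).absE < r
      have := GenNumber.absE_mul_lt_of_le_one (z := T x - 0) hc hx
      simpa using this

/-- Functionals on `𝓖(Ω)` that agree on common supports define a functional on `𝓖_c(Ω)`. -/
theorem exists_dualGc (T : CompactIn Ω → DualG Ω)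
    (hT : ∀ (K L : CompactIn Ω) (u : Gc Ω), u.val.supp ⊆ K.1 → u.val.supp ⊆ L.1 →
      T K u.val = T L u.val) :
    ∃ S : DualGc Ω, ∀ (K : CompactIn Ω) (u : Gc Ω), u.val.supp ⊆ K.1 → S u = T K u.val := by
  choose K hK using Gc.exists_compact (Ω := Ω)
  have hun : ∀ L M : CompactIn Ω, ∃ P : CompactIn Ω, L.1 ⊆ P.1 ∧ M.1 ⊆ P.1 := fun L M =>
    ⟨⟨L.1 ∪ M.1, L.2.1.union M.2.1, Set.union_subset L.2.2 M.2.2⟩, Set.subset_union_left,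
      Set.subset_union_right⟩
  have hS : ∀ (L : CompactIn Ω) (u : Gc Ω), u.val.supp ⊆ L.1 → T (K u) u.val = T L u.val :=
    fun L u hu => hT _ _ u (hK u) hu
  let S : Gc Ω →ₗ[GenNumber] GenNumber :=
    { toFun := fun u => T (K u) u.val
      map_add' := fun u v => by
        obtain ⟨P, h1, h2⟩ := hun (K u) (K v)
        have hu := (hK u).trans h1
        have hv := (hK v).trans h2
        rw [hS P u hu, hS P v hv, hS P (u + v)
          ((G.supp_add u.val v.val).trans (Set.union_subset hu hv))]
        exact map_add (T P) u.val v.val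
      map_smul' := fun c u => by
        rw [hS (K u) (c • u) ((G.supp_smul c u.val).trans (hK u))]
        exact map_smul (T (K u)) c u.val }
  refine ⟨⟨S, ?_⟩, fun L u hu => hS L u hu⟩
  -- The inductive limit topology is the infimum of the admissible topologies, so it is finer than
  -- the one induced by `S` as soon as the latter is admissible. For this, only continuity of `S` on
  -- each `𝓖_L(Ω)` remains.
  refine continuous_iff_le_induced.2 (sInf_le ⟨GenNumber.isLocallyConvexTopology_induced S,
    fun L => ?_⟩)
  let _ := GK.topology L
  refine continuous_induced_rng.2 ?_
  have : (S ∘ Subtype.val : GK L → GenNumber) = fun u => T L u.1.val := by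
    funext u
    exact hS L u.1 u.2
  change Continuous (S ∘ Subtype.val : GK L → GenNumber)
  rw [this]
  exact (T L).continuous.comp continuous_induced_dom

end

open LineDeriv

/-! ### Derivatives of Schwartz functions -/

section

variable {n : ℕ}

/-- The Schwartz function `y ↦ f (y - x)`. -/
abbrev translate (x : Eu n) : 𝓢(Eu n, ℂ) →L[ℂ] 𝓢(Eu n, ℂ) := SchwartzMap.compSubConstCLM ℂ x

theorem lineDerivOp_comm (v w : Eu n) (f : 𝓢(Eu n, ℂ)) : ∂_{v} (∂_{w} f) = ∂_{w} (∂_{v} f) := by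
  have key : ∀ (v w : Eu n) (x : Eu n),
      ∂_{v} (∂_{w} f) x = fderiv ℝ (fderiv ℝ f) x v w := by
    intro v w x
    rw [SchwartzMap.lineDerivOp_apply_eq_fderiv]
    have h : ⇑(∂_{w} f : 𝓢(Eu n, ℂ)) = fun y => fderiv ℝ f y w := by
      funext y
      exact SchwartzMap.lineDerivOp_apply_eq_fderiv _ _ _
    have hd : DifferentiableAt ℝ (fderiv ℝ f) x :=
      ((f.smooth 2).fderiv_right (m := 1) (by norm_num)).differentiable (by norm_num) x
    rw [h, fderiv_clm_apply hd (differentiableAt_const w)]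
    simp
  ext x
  rw [key, key]
  exact (f.contDiffAt 2).isSymmSndFDerivAt (by simp) v w

theorem iteratedLineDerivOp_lineDerivOp {k : ℕ} (m : Fin k → Eu n) (v : Eu n) (f : 𝓢(Eu n, ℂ)) :
    ∂^{m} (∂_{v} f) = ∂_{v} (∂^{m} f) := by
  induction k with
  | zero => rfl
  | succ k ih =>
    rw [iteratedLineDerivOp_succ_left, ih, lineDerivOp_comm, ← iteratedLineDerivOp_succ_left]

theorem iteratedFDeriv_lineDerivOp (l : ℕ) (v : Eu n) (f : 𝓢(Eu n, ℂ)) (x : Eu n) :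
    iteratedFDeriv ℝ l (∂_{v} f : 𝓢(Eu n, ℂ)) x = fderiv ℝ (iteratedFDeriv ℝ l f) x v := by
  ext m
  rw [← SchwartzMap.iteratedLineDerivOp_eq_iteratedFDeriv, iteratedLineDerivOp_lineDerivOp]
  have h := iteratedFDeriv_succ_apply_left (𝕜 := ℝ) (f := f) (x := x)
    (Fin.cons v m : Fin (l + 1) → Eu n)
  rw [Fin.cons_zero, Fin.tail_cons] at h
  rw [← h, ← SchwartzMap.iteratedLineDerivOp_eq_iteratedFDeriv, iteratedLineDerivOp_succ_left,
    Fin.cons_zero, Fin.tail_cons]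

theorem norm_iteratedFDeriv_lineDerivOp_le (l : ℕ) (v : Eu n) (f : 𝓢(Eu n, ℂ)) (x : Eu n) :
    ‖iteratedFDeriv ℝ l (∂_{v} f : 𝓢(Eu n, ℂ)) x‖ ≤ ‖iteratedFDeriv ℝ (l + 1) f x‖ * ‖v‖ := by
  rw [iteratedFDeriv_lineDerivOp, ← norm_fderiv_iteratedFDeriv]
  exact ContinuousLinearMap.le_opNorm _ _

theorem norm_iteratedFDeriv_iteratedLineDerivOp_le (l : ℕ) {k : ℕ} (m : Fin k → Eu n)
    (f : 𝓢(Eu n, ℂ)) (x : Eu n) :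
    ‖iteratedFDeriv ℝ l (∂^{m} f : 𝓢(Eu n, ℂ)) x‖ ≤ ‖iteratedFDeriv ℝ (l + k) f x‖ * ∏ i, ‖m i‖ := by
  induction k generalizing l with
  | zero => simp
  | succ k ih =>
    rw [iteratedLineDerivOp_succ_left, Fin.prod_univ_succ]
    refine (norm_iteratedFDeriv_lineDerivOp_le l _ _ x).trans ?_
    have h := ih (l + 1) (Fin.tail m)
    rw [show l + 1 + k = l + (k + 1) by ring] at h
    calc _ ≤ (‖iteratedFDeriv ℝ (l + (k + 1)) f x‖ * ∏ i, ‖Fin.tail m i‖) * ‖m 0‖ := by gcongr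
      _ = _ := by
        rw [mul_assoc, mul_comm (∏ i, _)]
        rfl

theorem lineDerivOp_translate (v x : Eu n) (f : 𝓢(Eu n, ℂ)) :
    ∂_{v} (translate x f) = translate x (∂_{v} f) := by
  ext y
  rw [SchwartzMap.lineDerivOp_apply_eq_fderiv, SchwartzMap.compSubConstCLM_apply,
    SchwartzMap.lineDerivOp_apply_eq_fderiv]
  have : (translate x f : Eu n → ℂ) = fun z => f (z - x) := by
    funext z
    exact SchwartzMap.compSubConstCLM_apply _ _ _
  rw [this, fderiv_comp_sub]

theorem iteratedLineDerivOp_translate {k : ℕ} (m : Fin k → Eu n) (x : Eu n) (f : 𝓢(Eu n, ℂ)) :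
    ∂^{m} (translate x f) = translate x (∂^{m} f) := by
  induction k with
  | zero => rfl
  | succ k ih =>
    rw [iteratedLineDerivOp_succ_left, ih, lineDerivOp_translate, ← iteratedLineDerivOp_succ_left]

theorem iteratedFDeriv_translate (l : ℕ) (x : Eu n) (f : 𝓢(Eu n, ℂ)) (y : Eu n) :
    iteratedFDeriv ℝ l (translate x f) y = iteratedFDeriv ℝ l f (y - x) := by
  rw [← iteratedFDeriv_comp_sub]
  rfl

/-! ### A Banach space of weighted jets -/

/-- Jets of order at most `L` of functions on `ℝⁿ`, with the supremum norm. -/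
def JetSpace (n L : ℕ) : Type :=
  (l : Fin (L + 1)) → BoundedContinuousFunction (Eu n) (ContinuousMultilinearMap ℝ
    (fun _ : Fin (l : ℕ) => Eu n) ℂ)

instance (L : ℕ) : NormedAddCommGroup (JetSpace n L) :=
  inferInstanceAs (NormedAddCommGroup ((l : Fin (L + 1)) → BoundedContinuousFunction (Eu n)
    (ContinuousMultilinearMap ℝ (fun _ : Fin (l : ℕ) => Eu n) ℂ)))

instance (L : ℕ) : NormedSpace ℂ (JetSpace n L) :=
  inferInstanceAs (NormedSpace ℂ ((l : Fin (L + 1)) → BoundedContinuousFunction (Eu n)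
    (ContinuousMultilinearMap ℝ (fun _ : Fin (l : ℕ) => Eu n) ℂ)))

instance (L : ℕ) : CompleteSpace (JetSpace n L) :=
  inferInstanceAs (CompleteSpace ((l : Fin (L + 1)) → BoundedContinuousFunction (Eu n)
    (ContinuousMultilinearMap ℝ (fun _ : Fin (l : ℕ) => Eu n) ℂ)))

/-- The component of order `l` of a jet at a point. -/
def JetSpace.eval {L : ℕ} (X : JetSpace n L) (l : Fin (L + 1)) (y : Eu n) :
    ContinuousMultilinearMap ℝ (fun _ : Fin (l : ℕ) => Eu n) ℂ := X l y

theorem JetSpace.norm_le {L : ℕ} {X : JetSpace n L} {B : ℝ} (hB : 0 ≤ B)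
    (h : ∀ l y, ‖X.eval l y‖ ≤ B) : ‖X‖ ≤ B :=
  (pi_norm_le_iff_of_nonneg hB).2 fun l => (BoundedContinuousFunction.norm_le hB).2 (h l)

theorem JetSpace.norm_eval_le {L : ℕ} (X : JetSpace n L) (l : Fin (L + 1)) (y : Eu n) :
    ‖X.eval l y‖ ≤ ‖X‖ :=
  ((X l).norm_coe_le_norm y).trans (norm_le_pi_norm (f := X) l)

theorem exists_weighted_bound (k l : ℕ) (f : 𝓢(Eu n, ℂ)) :
    ∃ C, ∀ y, (1 + ‖y‖) ^ k * ‖iteratedFDeriv ℝ l f y‖ ≤ C :=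
  ⟨_, fun y => SchwartzMap.one_add_le_sup_seminorm_apply (𝕜 := ℂ) (m := (k, l)) le_rfl le_rfl f y⟩

/-- The weighted jet `(1 + |y|)^k D^l f(y)`, `l ≤ L`, of a Schwartz function. -/
def jet (k L : ℕ) : 𝓢(Eu n, ℂ) →ₗ[ℂ] JetSpace n L where
  toFun f l := BoundedContinuousFunction.ofNormedAddCommGroup
    (fun y => ((1 + ‖y‖) ^ k : ℝ) • iteratedFDeriv ℝ (l : ℕ) f y)
    (by
      have := (f.smooth ⊤).continuous_iteratedFDeriv (m := (l : ℕ)) (by exact_mod_cast le_top)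
      fun_prop)
    (exists_weighted_bound k l f).choose
    (fun y => by
      rw [norm_smul, Real.norm_of_nonneg (by positivity)]
      exact (exists_weighted_bound k l f).choose_spec y)
  map_add' f g := by
    funext l
    ext1 y
    change ((1 + ‖y‖) ^ k : ℝ) • iteratedFDeriv ℝ (l : ℕ) (f + g : Eu n → ℂ) y
      = ((1 + ‖y‖) ^ k : ℝ) • iteratedFDeriv ℝ (l : ℕ) f y
        + ((1 + ‖y‖) ^ k : ℝ) • iteratedFDeriv ℝ (l : ℕ) g y
    rw [iteratedFDeriv_add_apply (f.contDiffAt _) (g.contDiffAt _), smul_add]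
  map_smul' c f := by
    funext l
    ext1 y
    change ((1 + ‖y‖) ^ k : ℝ) • iteratedFDeriv ℝ (l : ℕ) (c • f : Eu n → ℂ) y
      = c • ((1 + ‖y‖) ^ k : ℝ) • iteratedFDeriv ℝ (l : ℕ) f y
    rw [iteratedFDeriv_const_smul_apply (f.contDiffAt _), smul_comm]

theorem jet_apply (k L : ℕ) (f : 𝓢(Eu n, ℂ)) (l : Fin (L + 1)) (y : Eu n) :
    (jet k L f).eval l y = ((1 + ‖y‖) ^ k : ℝ) • iteratedFDeriv ℝ (l : ℕ) f y := rfl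

theorem norm_jet_le {k L : ℕ} {f : 𝓢(Eu n, ℂ)} {B : ℝ} (hB : 0 ≤ B)
    (h : ∀ l ≤ L, ∀ y, (1 + ‖y‖) ^ k * ‖iteratedFDeriv ℝ l f y‖ ≤ B) : ‖jet k L f‖ ≤ B := by
  refine JetSpace.norm_le hB fun l y => ?_
  rw [jet_apply, norm_smul, Real.norm_of_nonneg (by positivity)]
  exact h l (Nat.lt_succ_iff.1 l.2) y

theorem le_norm_jet {k l L : ℕ} (hl : l ≤ L) (f : 𝓢(Eu n, ℂ)) (y : Eu n) :
    (1 + ‖y‖) ^ k * ‖iteratedFDeriv ℝ l f y‖ ≤ ‖jet k L f‖ := by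
  have h := (jet k L f).norm_eval_le ⟨l, Nat.lt_succ_iff.2 hl⟩ y
  rwa [jet_apply, norm_smul, Real.norm_of_nonneg (by positivity)] at h

theorem one_add_norm_le_mul (x y : Eu n) : 1 + ‖x + y‖ ≤ (1 + ‖x‖) * (1 + ‖y‖) := by
  nlinarith [norm_add_le x y, norm_nonneg x, norm_nonneg y, mul_nonneg (norm_nonneg x) (norm_nonneg y)]

/-- By the Peetre-type inequality `1 + |y| ≤ (1 + |x|)(1 + |y - x|)`, moving the weight by `x` costs
a factor `(1 + |x|)^k`. For `k = 0` translation costs nothing, which later gives uniformity in `x`.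
-/
theorem norm_jet_translate_le (k L : ℕ) (x : Eu n) (f : 𝓢(Eu n, ℂ)) :
    ‖jet k L (translate x f)‖ ≤ (1 + ‖x‖) ^ k * ‖jet k L f‖ := by
  refine norm_jet_le (by positivity) fun l hl y => ?_
  rw [iteratedFDeriv_translate]
  have h1 : 1 + ‖y‖ ≤ (1 + ‖x‖) * (1 + ‖y - x‖) := by simpa using one_add_norm_le_mul x (y - x)
  calc (1 + ‖y‖) ^ k * ‖iteratedFDeriv ℝ l f (y - x)‖
      ≤ ((1 + ‖x‖) * (1 + ‖y - x‖)) ^ k * ‖iteratedFDeriv ℝ l f (y - x)‖ := by gcongr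
    _ = (1 + ‖x‖) ^ k * ((1 + ‖y - x‖) ^ k * ‖iteratedFDeriv ℝ l f (y - x)‖) := by
        rw [mul_pow, mul_assoc]
    _ ≤ _ := by
        gcongr
        exact le_norm_jet hl f _

theorem norm_jet_iteratedLineDerivOp_le (k L : ℕ) {j : ℕ} (m : Fin j → Eu n) (f : 𝓢(Eu n, ℂ)) :
    ‖jet k L (∂^{m} f)‖ ≤ ‖jet k (L + j) f‖ * ∏ i, ‖m i‖ := by
  refine norm_jet_le (by positivity) fun l hl y => ?_
  calc _ ≤ (1 + ‖y‖) ^ k * (‖iteratedFDeriv ℝ (l + j) f y‖ * ∏ i, ‖m i‖) := by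
        gcongr
        exact norm_iteratedFDeriv_iteratedLineDerivOp_le l m f y
    _ = ((1 + ‖y‖) ^ k * ‖iteratedFDeriv ℝ (l + j) f y‖) * ∏ i, ‖m i‖ := by ring
    _ ≤ _ := by
        gcongr
        exact le_norm_jet (by omega) f y

theorem norm_jet_mono {k k' L L' : ℕ} (hk : k ≤ k') (hL : L ≤ L') (f : 𝓢(Eu n, ℂ)) :
    ‖jet k L f‖ ≤ ‖jet k' L' f‖ := by
  refine norm_jet_le (norm_nonneg _) fun l hl y => ?_
  refine le_trans ?_ (le_norm_jet (hl.trans hL) f y)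
  gcongr
  linarith [norm_nonneg y]

/-- The component of order `0` already determines the function. Hence a form on Schwartz functions
can be regarded as a form on the range of `jet`, ready for Hahn–Banach. -/
theorem jet_injective (k L : ℕ) : Function.Injective (jet (n := n) k L) := by
  rw [injective_iff_map_eq_zero]
  intro f hf
  ext y
  have h := le_norm_jet (k := k) (Nat.zero_le L) f y
  rw [hf, norm_zero, norm_iteratedFDeriv_zero] at h
  have h1 : (1 : ℝ) ≤ (1 + ‖y‖) ^ k := one_le_pow₀ (by linarith [norm_nonneg y])
  have h2 : ‖f y‖ ≤ 0 := (le_mul_of_one_le_left (norm_nonneg _) h1).trans h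
  simpa using h2

/-- A linear form bounded by a jet norm extends to the Banach space of jets. -/
theorem exists_jet_extension (W : 𝓢(Eu n, ℂ) →ₗ[ℂ] ℂ) {C : ℝ} {k L : ℕ}
    (hW : ∀ f, ‖W f‖ ≤ C * ‖jet k L f‖) : ∃ A : JetSpace n L →L[ℂ] ℂ, ∀ f, W f = A (jet k L f) := by
  let e := LinearEquiv.ofInjective (jet (n := n) k L) (jet_injective k L)
  let g : LinearMap.range (jet (n := n) k L) →L[ℂ] ℂ :=
    (W ∘ₗ e.symm.toLinearMap).mkContinuous C fun X => by
      have := hW (e.symm X)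
      have h2 : jet k L (e.symm X) = X := congrArg Subtype.val (e.apply_symm_apply X)
      rwa [h2] at this
  obtain ⟨A, hA, -⟩ := exists_extension_norm_eq _ g
  refine ⟨A, fun f => ?_⟩
  have := hA (e f)
  rw [show ((e f : LinearMap.range (jet (n := n) k L)) : JetSpace n L) = jet k L f from rfl] at this
  rw [this]
  change W f = W (e.symm (e f))
  rw [e.symm_apply_apply]

/-! ### Smoothness of translations -/

/-- The mean value inequality is used twice on the ball of radius `|h|` about `y`, which costs two
more derivatives. Since `|h| ≤ 1`, weights at points of this ball compare with the weight at `y` up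
to the factor `2^k`. -/
theorem norm_jet_translate_sub_add_le (k L : ℕ) (f : 𝓢(Eu n, ℂ)) {h : Eu n} (hh : ‖h‖ ≤ 1) :
    ‖jet k L (translate h f - f + ∂_{h} f)‖ ≤ 2 ^ k * ‖jet k (L + 2) f‖ * ‖h‖ ^ 2 := by
  refine norm_jet_le (by positivity) fun l hl y => ?_
  have e : iteratedFDeriv ℝ l (translate h f - f + ∂_{h} f : 𝓢(Eu n, ℂ)) y
      = iteratedFDeriv ℝ l f (y - h) - iteratedFDeriv ℝ l f y
        - fderiv ℝ (iteratedFDeriv ℝ l f) y (y - h - y) := by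
    have e1 : iteratedFDeriv ℝ l (translate h f - f + ∂_{h} f : 𝓢(Eu n, ℂ)) y
        = iteratedFDeriv ℝ l (translate h f - f : 𝓢(Eu n, ℂ)) y
          + iteratedFDeriv ℝ l (∂_{h} f : 𝓢(Eu n, ℂ)) y :=
      iteratedFDeriv_add_apply ((translate h f - f).contDiffAt _) ((∂_{h} f).contDiffAt _)
    have e2 : iteratedFDeriv ℝ l (translate h f - f : 𝓢(Eu n, ℂ)) y
        = iteratedFDeriv ℝ l (translate h f) y - iteratedFDeriv ℝ l f y :=
      iteratedFDeriv_sub_apply ((translate h f).contDiffAt _) (f.contDiffAt _)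
    rw [e1, e2, iteratedFDeriv_translate, iteratedFDeriv_lineDerivOp, sub_sub_cancel_left, map_neg,
      sub_neg_eq_add]
  set M : ℝ := 2 ^ k * ‖jet k (L + 2) f‖ / (1 + ‖y‖) ^ k with hM
  have hM0 : 0 ≤ M := by positivity
  have hdiff : ∀ (i : ℕ) (z : Eu n), DifferentiableAt ℝ (iteratedFDeriv ℝ i f) z := fun i z =>
    (f.contDiffAt ⊤).differentiableAt_iteratedFDeriv (by exact_mod_cast ENat.natCast_lt_top i)
  have hb2 : ∀ z ∈ Metric.closedBall y ‖h‖, ‖fderiv ℝ (iteratedFDeriv ℝ (l + 1) f) z‖ ≤ M := by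
    intro z hz
    rw [norm_fderiv_iteratedFDeriv, hM, le_div_iff₀ (by positivity)]
    have h1 : 1 + ‖y‖ ≤ 2 * (1 + ‖z‖) := by
      have : ‖y‖ ≤ ‖z‖ + ‖z - y‖ := by simpa using norm_sub_le z (z - y)
      rw [Metric.mem_closedBall, dist_eq_norm] at hz
      linarith [norm_nonneg z]
    calc _ ≤ ‖iteratedFDeriv ℝ (l + 1 + 1) f z‖ * (2 * (1 + ‖z‖)) ^ k := by gcongr
      _ = 2 ^ k * ((1 + ‖z‖) ^ k * ‖iteratedFDeriv ℝ (l + 1 + 1) f z‖) := by rw [mul_pow]; ring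
      _ ≤ _ := by
        gcongr
        exact le_norm_jet (by omega) f z
  have hconv := convex_closedBall y ‖h‖
  have hy : y ∈ Metric.closedBall y ‖h‖ := Metric.mem_closedBall_self (norm_nonneg _)
  have hb1 : ∀ z ∈ Metric.closedBall y ‖h‖,
      ‖fderiv ℝ (iteratedFDeriv ℝ l f) z - fderiv ℝ (iteratedFDeriv ℝ l f) y‖ ≤ M * ‖h‖ := by
    intro z hz
    -- Currying is an isometry, so the derivative of `D^l f` may be measured as `D^(l+1) f`, to
    -- which the second-derivative bound applies.
    have hcurry : ∀ a b : ContinuousMultilinearMap ℝ (fun _ : Fin (l + 1) => Eu n) ℂ,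
        ‖continuousMultilinearCurryLeftEquiv ℝ (fun _ => Eu n) ℂ a
          - continuousMultilinearCurryLeftEquiv ℝ (fun _ => Eu n) ℂ b‖ = ‖a - b‖ := fun a b => by
      rw [← LinearIsometryEquiv.map_sub, LinearIsometryEquiv.norm_map]
    rw [fderiv_iteratedFDeriv]
    refine (le_of_eq (hcurry _ _)).trans ?_
    refine (hconv.norm_image_sub_le_of_norm_fderiv_le (𝕜 := ℝ) (fun w _ => hdiff _ w) hb2 hy
      hz).trans ?_
    rw [Metric.mem_closedBall, dist_eq_norm] at hz
    gcongr
  have hyh : y - h ∈ Metric.closedBall y ‖h‖ := by simp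
  have key := hconv.norm_image_sub_le_of_norm_fderiv_le' (𝕜 := ℝ) (fun w _ => hdiff l w) hb1 hy hyh
  rw [e]
  calc _ ≤ (1 + ‖y‖) ^ k * (M * ‖h‖ * ‖y - h - y‖) := by gcongr
    _ = _ := by
      rw [sub_sub_cancel_left, norm_neg, hM]
      field_simp

/-- The derivative of `x ↦ jet (translate x f)`. -/
def jetDeriv (k L : ℕ) (f : 𝓢(Eu n, ℂ)) (x : Eu n) : Eu n →L[ℝ] JetSpace n L :=
  LinearMap.toContinuousLinearMap
    { toFun := fun v => -jet k L (translate x (∂_{v} f))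
      map_add' := fun v w => by
        rw [lineDerivOp_left_add, map_add, map_add, neg_add]
      map_smul' := fun c v => by
        rw [lineDerivOp_left_smul]
        have h1 : translate x (c • ∂_{v} f) = (c : ℂ) • translate x (∂_{v} f) := by
          rw [← map_smul]
          rfl
        rw [h1, map_smul, ← smul_neg]
        rfl }

theorem jetDeriv_apply (k L : ℕ) (f : 𝓢(Eu n, ℂ)) (x v : Eu n) :
    jetDeriv k L f x v = -jet k L (translate x (∂_{v} f)) := rfl

/-- The increment at `x` is the translate by `x` of the increment at `0`. The quadratic estimate
there, times the cost of translation, is `o(|h|)`. -/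
theorem hasFDerivAt_jet_translate (k L : ℕ) (f : 𝓢(Eu n, ℂ)) (x : Eu n) :
    HasFDerivAt (fun x => jet k L (translate x f)) (jetDeriv k L f x) x := by
  rw [hasFDerivAt_iff_isLittleO_nhds_zero]
  refine IsBigO.trans_isLittleO (IsBigO.of_bound
    ((1 + ‖x‖) ^ k * (2 ^ k * ‖jet k (L + 2) f‖)) ?_)
    (isLittleO_norm_pow_id (one_lt_two : 1 < 2))
  filter_upwards [Metric.closedBall_mem_nhds (0 : Eu n) one_pos] with h hh
  rw [mem_closedBall_zero_iff] at hh
  have e : jet k L (translate (x + h) f) - jet k L (translate x f) - jetDeriv k L f x h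
      = jet k L (translate x (translate h f - f + ∂_{h} f)) := by
    have ht : translate (x + h) f = translate x (translate h f) := by
      ext y
      simp [add_comm]
    rw [jetDeriv_apply, sub_neg_eq_add, ht, map_add, map_sub, map_add, map_sub]
  rw [e, norm_pow, norm_norm]
  calc _ ≤ (1 + ‖x‖) ^ k * (2 ^ k * ‖jet k (L + 2) f‖ * ‖h‖ ^ 2) :=
        (norm_jet_translate_le k L x _).trans (by
          gcongr
          exact norm_jet_translate_sub_add_le k L f hh)
    _ = _ := by ring

theorem continuous_jet_translate (k L : ℕ) (f : 𝓢(Eu n, ℂ)) :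
    Continuous fun x => jet k L (translate x f) :=
  continuous_iff_continuousAt.2 fun x => (hasFDerivAt_jet_translate k L f x).continuousAt

variable {W : 𝓢(Eu n, ℂ) →ₗ[ℂ] ℂ} {C : ℝ} {k L : ℕ}

/-- The Hahn–Banach extension of `W` is a continuous linear map on jets, so the chain rule applies
to it and the differentiable curve of translated jets. -/
theorem hasFDerivAt_apply_translate (hW : ∀ f, ‖W f‖ ≤ C * ‖jet k L f‖) (f : 𝓢(Eu n, ℂ))
    (x : Eu n) : ∃ D : Eu n →L[ℝ] ℂ, HasFDerivAt (fun x => W (translate x f)) D x ∧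
      ∀ v, D v = -W (translate x (∂_{v} f)) := by
  obtain ⟨A, hA⟩ := exists_jet_extension W hW
  refine ⟨(A.restrictScalars ℝ).comp (jetDeriv k L f x), ?_, fun v => ?_⟩
  · simp only [hA]
    exact (A.restrictScalars ℝ).hasFDerivAt.comp x (hasFDerivAt_jet_translate k L f x)
  · rw [hA]
    change A (-_) = _
    rw [map_neg]

theorem fderiv_apply_translate (hW : ∀ f, ‖W f‖ ≤ C * ‖jet k L f‖) (f : 𝓢(Eu n, ℂ))
    (x v : Eu n) : fderiv ℝ (fun x => W (translate x f)) x v = -W (translate x (∂_{v} f)) := by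
  obtain ⟨D, hD, h⟩ := hasFDerivAt_apply_translate hW f x
  rw [hD.fderiv, h]

/-- Each directional derivative is, up to sign, a function of the same kind with `∂_v f` in place of
`f` and the same bound on `W`. Induction over the order therefore closes. -/
theorem contDiff_apply_translate (hW : ∀ f, ‖W f‖ ≤ C * ‖jet k L f‖) (f : 𝓢(Eu n, ℂ)) :
    ContDiff ℝ ∞ fun x => W (translate x f) := by
  rw [contDiff_infty]
  intro N
  induction N generalizing f with
  | zero =>
    refine contDiff_zero.2 (continuous_iff_continuousAt.2 fun x => ?_)
    obtain ⟨D, hD, -⟩ := hasFDerivAt_apply_translate hW f x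
    exact hD.continuousAt
  | succ N ih =>
    have : ((N + 1 : ℕ) : WithTop ℕ∞) = (N : WithTop ℕ∞) + 1 := by push_cast; rfl
    rw [this, contDiff_succ_iff_fderiv_apply]
    refine ⟨fun x => ?_, fun h => absurd h (by simp), fun v => ?_⟩
    · obtain ⟨D, hD, -⟩ := hasFDerivAt_apply_translate hW f x
      exact hD.differentiableAt
    · simp only [fderiv_apply_translate hW]
      exact (ih (∂_{v} f)).neg

theorem iteratedFDeriv_apply_translate (hW : ∀ f, ‖W f‖ ≤ C * ‖jet k L f‖) (f : 𝓢(Eu n, ℂ))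
    {j : ℕ} (m : Fin j → Eu n) (x : Eu n) :
    iteratedFDeriv ℝ j (fun x => W (translate x f)) x m
      = (-1) ^ j * W (translate x (∂^{m} f)) := by
  induction j generalizing x with
  | zero => simp
  | succ j ih =>
    rw [DifferentiableAt.iteratedFDeriv_succ_apply_left'
      ((contDiff_apply_translate hW f).contDiffAt.differentiableAt_iteratedFDeriv
        (by exact_mod_cast ENat.natCast_lt_top j))]
    simp only [ih]
    have h1 : DifferentiableAt ℝ (fun y => W (translate y (∂^{Fin.tail m} f))) x :=
      (contDiff_apply_translate hW _).contDiffAt.differentiableAt (by simp)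
    rw [fderiv_const_mul h1]
    change (-1 : ℂ) ^ j * fderiv ℝ (fun y => W (translate y (∂^{Fin.tail m} f))) x (m 0) = _
    rw [fderiv_apply_translate hW, ← iteratedLineDerivOp_succ_left, pow_succ]
    ring

theorem norm_iteratedFDeriv_apply_translate_le (hW : ∀ f, ‖W f‖ ≤ C * ‖jet k L f‖)
    (f : 𝓢(Eu n, ℂ)) (j : ℕ) (x : Eu n) {B : ℝ} (hB : 0 ≤ B)
    (h : ∀ m : Fin j → Eu n, ‖W (translate x (∂^{m} f))‖ ≤ B * ∏ i, ‖m i‖) :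
    ‖iteratedFDeriv ℝ j (fun x => W (translate x f)) x‖ ≤ B := by
  refine ContinuousMultilinearMap.opNorm_le_bound hB fun m => ?_
  rw [iteratedFDeriv_apply_translate hW, norm_mul, norm_pow, norm_neg, norm_one, one_pow, one_mul]
  exact h m

end

/-! ### Scaled mollifiers -/

section

variable {n : ℕ}

theorem negDilation_apply (ε : Eps) (y : Eu n) : negDilation n ε y = -((ε : ℝ)⁻¹ • y) := by
  change (-(Units.mk0 (ε : ℝ) ε.2.1.ne')⁻¹) • y = _
  rw [Units.smul_def]
  simp

theorem shiftMoll_eq_translate (φ : 𝓢(Eu n, ℂ)) (ε : Eps) (x : Eu n) :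
    shiftMoll φ ε x = translate x (shiftMoll φ ε 0) := by
  ext y
  rw [SchwartzMap.compSubConstCLM_apply, shiftMoll_apply, shiftMoll_apply, zero_sub, neg_sub]

/-- The profile at the origin is passed as a separate function so that rewriting shifted mollifiers
as translates terminates; `shiftMoll φ ε 0` is itself a shifted mollifier. -/
theorem exists_shiftMoll_eq_translate (φ : 𝓢(Eu n, ℂ)) (ε : Eps) :
    ∃ f, f = shiftMoll φ ε 0 ∧ ∀ x, shiftMoll φ ε x = translate x f :=
  ⟨_, rfl, shiftMoll_eq_translate φ ε⟩

theorem norm_iteratedFDeriv_shiftMoll_zero_le (φ : 𝓢(Eu n, ℂ)) (ε : Eps) (l : ℕ) (y : Eu n) :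
    ‖iteratedFDeriv ℝ l (shiftMoll φ ε 0) y‖
      ≤ ((ε : ℝ)⁻¹) ^ (n + l) * ‖iteratedFDeriv ℝ l φ (-((ε : ℝ)⁻¹ • y))‖ := by
  have hε : (0 : ℝ) ≤ (ε : ℝ)⁻¹ := inv_nonneg.2 ε.2.1.le
  let g : Eu n →L[ℝ] Eu n := (negDilation n ε : Eu n →L[ℝ] Eu n)
  have hg : ‖g‖ ≤ (ε : ℝ)⁻¹ := by
    refine ContinuousLinearMap.opNorm_le_bound _ hε fun y => ?_
    change ‖negDilation n ε y‖ ≤ _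
    rw [negDilation_apply, norm_neg, norm_smul, Real.norm_of_nonneg hε]
  have hcomp : ⇑(shiftMoll φ ε 0) = (((ε : ℝ) ^ n)⁻¹ : ℂ) • (φ ∘ g) := by
    funext y
    rw [shiftMoll_apply, Pi.smul_apply, smul_eq_mul, Function.comp_apply]
    change _ = _ * φ (negDilation n ε y)
    rw [negDilation_apply, zero_sub, smul_neg]
  have hs : ContDiff ℝ ∞ (φ ∘ g) := (φ.smooth ⊤).comp g.contDiff
  rw [hcomp, iteratedFDeriv_const_smul_apply (hs.contDiffAt.of_le (by exact_mod_cast le_top)),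
    norm_smul, g.iteratedFDeriv_comp_right (φ.smooth ⊤) y (by exact_mod_cast le_top)]
  have h1 : ‖(((ε : ℝ) ^ n)⁻¹ : ℂ)‖ = ((ε : ℝ)⁻¹) ^ n := by
    rw [norm_inv, norm_pow, Complex.norm_real, Real.norm_of_nonneg ε.2.1.le, inv_pow]
  have h2 : g y = -((ε : ℝ)⁻¹ • y) := negDilation_apply ε y
  rw [h1, h2, pow_add, mul_assoc]
  refine mul_le_mul_of_nonneg_left ?_ (pow_nonneg hε n)
  refine (ContinuousMultilinearMap.norm_compContinuousLinearMap_le _ _).trans ?_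
  rw [Finset.prod_const, Finset.card_univ, Fintype.card_fin, mul_comm]
  gcongr

/-- The weight is kept in the scaled variable `y / ε`. Dropping the scaling gives the growth bound
for regularizations, while at positive distance from the origin the weight itself yields powers of
`ε`. -/
theorem norm_iteratedFDeriv_shiftMoll_zero_le' (φ : 𝓢(Eu n, ℂ)) (ε : Eps) (k : ℕ) {l L : ℕ}
    (hl : l ≤ L) (y : Eu n) :
    (1 + ‖(ε : ℝ)⁻¹ • y‖) ^ k * ‖iteratedFDeriv ℝ l (shiftMoll φ ε 0) y‖
      ≤ ((ε : ℝ)⁻¹) ^ (n + L) * ‖jet k L φ‖ := by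
  have hε1 : (1 : ℝ) ≤ (ε : ℝ)⁻¹ := (one_le_inv₀ ε.2.1).2 ε.2.2
  have h := le_norm_jet (k := k) hl φ (-((ε : ℝ)⁻¹ • y))
  rw [norm_neg] at h
  calc _ ≤ (1 + ‖(ε : ℝ)⁻¹ • y‖) ^ k *
        (((ε : ℝ)⁻¹) ^ (n + l) * ‖iteratedFDeriv ℝ l φ (-((ε : ℝ)⁻¹ • y))‖) := by
        gcongr
        exact norm_iteratedFDeriv_shiftMoll_zero_le φ ε l y
    _ = ((ε : ℝ)⁻¹) ^ (n + l) * ((1 + ‖(ε : ℝ)⁻¹ • y‖) ^ k *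
        ‖iteratedFDeriv ℝ l φ (-((ε : ℝ)⁻¹ • y))‖) := by ring
    _ ≤ ((ε : ℝ)⁻¹) ^ (n + L) * ‖jet k L φ‖ := by gcongr

theorem norm_jet_shiftMoll_zero_le (φ : 𝓢(Eu n, ℂ)) (ε : Eps) (k L : ℕ) :
    ‖jet k L (shiftMoll φ ε 0)‖ ≤ ((ε : ℝ)⁻¹) ^ (n + L) * ‖jet k L φ‖ := by
  have hε1 : (1 : ℝ) ≤ (ε : ℝ)⁻¹ := (one_le_inv₀ ε.2.1).2 ε.2.2
  refine norm_jet_le (by positivity) fun l hl y => ?_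
  refine le_trans ?_ (norm_iteratedFDeriv_shiftMoll_zero_le' φ ε k hl y)
  have : ‖y‖ ≤ ‖(ε : ℝ)⁻¹ • y‖ := by
    rw [norm_smul, Real.norm_of_nonneg (by linarith)]
    exact le_mul_of_one_le_left (norm_nonneg _) hε1
  gcongr

theorem supDeriv_le_norm_jet (K : Set (Eu n)) (k L : ℕ) (f : 𝓢(Eu n, ℂ)) :
    supDeriv K L f ≤ ‖jet k L f‖ := by
  refine supDeriv_le (norm_nonneg _) fun i hi x _ => ?_
  refine le_trans ?_ (norm_jet_mono (Nat.zero_le k) le_rfl f)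
  simpa using le_norm_jet (k := 0) hi f x

/-! ### Growth and decay of regularized linear forms -/

variable {W : 𝓢(Eu n, ℂ) →ₗ[ℂ] ℂ} {C : ℝ} {k L : ℕ}

theorem contDiff_apply_shiftMoll (hW : ∀ f, ‖W f‖ ≤ C * ‖jet k L f‖) (φ : 𝓢(Eu n, ℂ)) (ε : Eps) :
    ContDiff ℝ ∞ fun x => W (shiftMoll φ ε x) := by
  obtain ⟨f₀, hf₀, hf₁⟩ := exists_shiftMoll_eq_translate φ ε
  simp only [hf₁]
  exact contDiff_apply_translate hW _

/-- The derivatives of a regularized distribution grow at most polynomially in `x` and `ε⁻¹`. -/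
theorem norm_iteratedFDeriv_apply_shiftMoll_le (hC : 0 ≤ C) (hW : ∀ f, ‖W f‖ ≤ C * ‖jet k L f‖)
    (φ : 𝓢(Eu n, ℂ)) (ε : Eps) (j : ℕ) (x : Eu n) :
    ‖iteratedFDeriv ℝ j (fun x => W (shiftMoll φ ε x)) x‖
      ≤ C * ‖jet k (L + j) φ‖ * (1 + ‖x‖) ^ k * ((ε : ℝ)⁻¹) ^ (n + (L + j)) := by
  have hε := ε.2.1
  obtain ⟨f₀, hf₀, hf₁⟩ := exists_shiftMoll_eq_translate φ ε
  simp only [hf₁]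
  refine norm_iteratedFDeriv_apply_translate_le hW _ j x (by positivity) fun m => ?_
  calc _ ≤ C * ((1 + ‖x‖) ^ k * (((ε : ℝ)⁻¹ ^ (n + (L + j)) * ‖jet k (L + j) φ‖)
        * ∏ i, ‖m i‖)) := by
        refine (hW _).trans ?_
        gcongr
        refine (norm_jet_translate_le k L x _).trans ?_
        gcongr
        refine (norm_jet_iteratedLineDerivOp_le k L m _).trans ?_
        rw [hf₀]
        gcongr
        exact norm_jet_shiftMoll_zero_le φ ε k (L + j)
    _ = _ := by ring

/-- Away from its support, a regularized distribution is small. -/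
theorem norm_iteratedFDeriv_apply_shiftMoll_le_of_dist {K : Set (Eu n)} (hC : 0 ≤ C)
    (hW : ∀ f, ‖W f‖ ≤ C * supDeriv K L f) (φ : 𝓢(Eu n, ℂ)) (j q : ℕ) {δ : ℝ} (hδ : 0 < δ)
    (ε : Eps) (x : Eu n) (hx : ∀ y ∈ K, δ ≤ ‖x - y‖) :
    ‖iteratedFDeriv ℝ j (fun x => W (shiftMoll φ ε x)) x‖
      ≤ C * ‖jet (q + (n + (L + j))) (L + j) φ‖ * (δ⁻¹) ^ (q + (n + (L + j))) * (ε : ℝ) ^ q := by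
  have hε := ε.2.1
  have hW' : ∀ f, ‖W f‖ ≤ C * ‖jet 0 L f‖ := fun f => (hW f).trans (by
    gcongr
    exact supDeriv_le_norm_jet K 0 L f)
  -- At distance `δ` the weight is at least `(δ / ε)^Q`. Scaling and differentiation lose `ε^(-(n +
  -- L + j))`, so this `Q` leaves exactly `ε^q`.
  set Q := q + (n + (L + j)) with hQ
  obtain ⟨f₀, hf₀, hf₁⟩ := exists_shiftMoll_eq_translate φ ε
  simp only [hf₁]
  refine norm_iteratedFDeriv_apply_translate_le hW' _ j x (by positivity) fun m => ?_
  refine (hW _).trans ?_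
  rw [mul_assoc, mul_assoc, mul_assoc]
  refine mul_le_mul_of_nonneg_left ?_ hC
  refine supDeriv_le (by positivity) fun i hi y hy => ?_
  rw [iteratedFDeriv_translate, hf₀]
  refine (norm_iteratedFDeriv_iteratedLineDerivOp_le i m _ (y - x)).trans ?_
  rw [← mul_assoc, ← mul_assoc]
  refine mul_le_mul_of_nonneg_right ?_ (by positivity)
  have h1 := norm_iteratedFDeriv_shiftMoll_zero_le' φ ε Q (l := i + j) (L := L + j) (by omega) (y - x)
  have h2 : (δ / ε) ^ Q ≤ (1 + ‖(ε : ℝ)⁻¹ • (y - x)‖) ^ Q := by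
    gcongr
    rw [norm_smul, Real.norm_of_nonneg (by positivity), norm_sub_rev, div_eq_inv_mul]
    have := mul_le_mul_of_nonneg_left (hx y hy) (inv_nonneg.2 hε.le)
    linarith
  have h3 := (mul_le_mul_of_nonneg_right h2 (norm_nonneg _)).trans h1
  have h4 : (0 : ℝ) < (δ / ε) ^ Q := by positivity
  rw [mul_comm, ← le_div_iff₀ h4] at h3
  refine h3.trans (le_of_eq ?_)
  rw [hQ, div_pow, inv_pow, inv_pow, pow_add (ε : ℝ) q]
  field_simp

/-! ### Integration by parts -/

/-- The Schwartz function `x ↦ f (y - x)`. -/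
def reflect (y : Eu n) (f : 𝓢(Eu n, ℂ)) : 𝓢(Eu n, ℂ) :=
  translate y (SchwartzMap.compCLMOfContinuousLinearEquiv ℂ (ContinuousLinearEquiv.neg ℝ) f)

theorem reflect_apply (y : Eu n) (f : 𝓢(Eu n, ℂ)) (x : Eu n) : reflect y f x = f (y - x) := by
  simp [reflect]

theorem lineDerivOp_reflect (v y : Eu n) (f : 𝓢(Eu n, ℂ)) :
    ∂_{v} (reflect y f) = -reflect y (∂_{v} f) := by
  rw [reflect, lineDerivOp_translate, SchwartzMap.lineDerivOp_compCLMOfContinuousLinearEquiv,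
    ContinuousLinearEquiv.neg_apply, lineDerivOp_left_neg, map_neg, map_neg, reflect]

/-- Each partial integration gives a minus sign, cancelled by the one from differentiating `f (y -
x)` in `x`; hence no `(-1)^j`. -/
theorem integral_reflect_iteratedLineDerivOp {j : ℕ} (m : Fin j → Eu n) (y : Eu n)
    (f b : 𝓢(Eu n, ℂ)) :
    ∫ x, (∂^{m} f : 𝓢(Eu n, ℂ)) (y - x) * b x = ∫ x, f (y - x) * (∂^{m} b : 𝓢(Eu n, ℂ)) x := by
  induction j generalizing b with
  | zero => rfl
  | succ j ih =>
    have h : ∀ g : 𝓢(Eu n, ℂ), ∫ x, (∂_{m 0} g : 𝓢(Eu n, ℂ)) (y - x) * b x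
        = ∫ x, g (y - x) * (∂_{m 0} b : 𝓢(Eu n, ℂ)) x := by
      intro g
      have := SchwartzMap.integral_mul_lineDerivOp_right_eq_neg_left (μ := volume) (reflect y g) b
        (m 0)
      rw [lineDerivOp_reflect] at this
      simp only [neg_apply, neg_mul, integral_neg, neg_neg, reflect_apply] at this
      exact this.symm
    rw [iteratedLineDerivOp_succ_left, h, ih, iteratedLineDerivOp_lineDerivOp,
      ← iteratedLineDerivOp_succ_left]

theorem integral_mul_iteratedLineDerivOp {j : ℕ} (m : Fin j → Eu n) (f b : 𝓢(Eu n, ℂ)) :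
    ∫ x, f x * (∂^{m} b : 𝓢(Eu n, ℂ)) x = (-1) ^ j * ∫ x, (∂^{m} f : 𝓢(Eu n, ℂ)) x * b x := by
  induction j generalizing f with
  | zero => simp
  | succ j ih =>
    rw [iteratedLineDerivOp_succ_left, SchwartzMap.integral_mul_lineDerivOp_right_eq_neg_left,
      ih, iteratedLineDerivOp_lineDerivOp, ← iteratedLineDerivOp_succ_left, pow_succ]
    ring

/-- Substitute `x = y + εz`: the Jacobian cancels `ε^(-n)`. The sign in `y + εz` is right for a
possibly non-even `φ`, because `shiftMoll φ ε 0` is the reflected scaled mollifier. -/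
theorem integral_shiftMoll_zero_mul (φ : 𝓢(Eu n, ℂ)) (ε : Eps) (y : Eu n) (g : Eu n → ℂ) :
    ∫ x, shiftMoll φ ε 0 (y - x) * g x = ∫ z, φ z * g (y + (ε : ℝ) • z) := by
  have hε := ε.2.1
  have h1 : ∫ x, shiftMoll φ ε 0 (y - x) * g x
      = ∫ x, (((ε : ℝ) ^ n)⁻¹ : ℂ) * (φ ((ε : ℝ)⁻¹ • x) * g (y + x)) := by
    rw [← integral_add_left_eq_self _ y]
    congr 1
    funext x
    rw [shiftMoll_apply, sub_add_cancel_left, zero_sub, neg_neg, mul_assoc]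
  have h2 := Measure.integral_comp_smul (μ := (volume : Measure (Eu n)))
    (fun x => φ ((ε : ℝ)⁻¹ • x) * g (y + x)) (ε : ℝ)
  rw [h1, integral_const_mul]
  simp only [smul_smul, inv_mul_cancel₀ hε.ne', one_smul, finrank_euclideanSpace,
    Fintype.card_fin] at h2
  rw [h2, abs_of_pos (by positivity), Complex.real_smul]
  push_cast
  rfl

/-! ### Taylor expansion and vanishing moments -/

theorem integrable_prod_mul (φ : 𝓢(Eu n, ℂ)) {i : ℕ} (r : Fin i → Fin n) :
    Integrable fun z : Eu n => ((∏ a, z (r a) : ℝ) : ℂ) * φ z := by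
  have hc : Continuous fun z : Eu n => ((∏ a, z (r a) : ℝ) : ℂ) * φ z := by
    have : Continuous fun z : Eu n => ∏ a, z (r a) :=
      continuous_finsetProd _ fun a _ => by fun_prop
    exact (Complex.continuous_ofReal.comp this).mul φ.continuous
  refine (φ.integrable_pow_mul volume i).mono' hc.aestronglyMeasurable
    (Eventually.of_forall fun z => ?_)
  rw [norm_mul, Complex.norm_real, norm_prod]
  gcongr
  calc ∏ a, ‖z (r a)‖ ≤ ∏ _a : Fin i, ‖z‖ :=
        Finset.prod_le_prod (fun _ _ => norm_nonneg _) fun a _ => PiLp.norm_apply_le z _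
    _ = ‖z‖ ^ i := by simp

theorem multilinear_diag_eq_sum {i : ℕ} (A : ContinuousMultilinearMap ℝ (fun _ : Fin i => Eu n) ℂ)
    (z : Eu n) : A (fun _ => z) = ∑ r : Fin i → Fin n, ((∏ a, z (r a) : ℝ) : ℂ)
      * A fun a => EuclideanSpace.basisFun (Fin n) ℝ (r a) := by
  have hz : z = ∑ j, z j • EuclideanSpace.basisFun (Fin n) ℝ j := by
    have := (EuclideanSpace.basisFun (Fin n) ℝ).sum_repr z
    simpa using this.symm
  conv_lhs => rw [hz]
  rw [A.map_sum]
  refine Finset.sum_congr rfl fun r _ => ?_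
  rw [A.map_smul_univ, Complex.real_smul]

variable {φ : 𝓢(Eu n, ℂ)}

/-- Grouping equal indices turns the product into the monomial with exponents `α_j`, the number of
`a` with `r a = j`. As `i ≠ 0`, some exponent is nonzero. -/
theorem IsMollifier.integral_prod_eq_zero (hφ : IsMollifier φ) {i : ℕ} (hi : i ≠ 0)
    (r : Fin i → Fin n) : ∫ z : Eu n, ((∏ a, z (r a) : ℝ) : ℂ) * φ z = 0 := by
  have h := hφ.2 (fun j => (Finset.univ.filter fun a => r a = j).card) (fun h => ?_)
  · rw [← h]
    congr 1
    funext z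
    congr 2
    rw [← Finset.prod_fiberwise' Finset.univ r (fun j => z j)]
    simp
  · have h0 := congrFun h (r ⟨0, Nat.pos_of_ne_zero hi⟩)
    simp only [Pi.zero_apply, Finset.card_eq_zero] at h0
    have h1 : (⟨0, Nat.pos_of_ne_zero hi⟩ : Fin i) ∈ Finset.univ.filter
        fun a => r a = r ⟨0, Nat.pos_of_ne_zero hi⟩ :=
      Finset.mem_filter.2 ⟨Finset.mem_univ _, rfl⟩
    rw [h0] at h1
    exact Finset.notMem_empty _ h1

theorem integrable_multilinear_mul (φ : 𝓢(Eu n, ℂ)) {i : ℕ}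
    (A : ContinuousMultilinearMap ℝ (fun _ : Fin i => Eu n) ℂ) :
    Integrable fun z : Eu n => A (fun _ => z) * φ z := by
  simp only [multilinear_diag_eq_sum, Finset.sum_mul]
  refine integrable_finsetSum _ fun r _ => ?_
  have := (integrable_prod_mul φ r).mul_const (A fun a => EuclideanSpace.basisFun (Fin n) ℝ (r a))
  refine this.congr (Eventually.of_forall fun z => ?_)
  ring

/-- In coordinates a multilinear form on the diagonal is a combination of monomials of degree `i`,
so all Taylor terms of positive order integrate to zero against `φ`. -/
theorem IsMollifier.integral_multilinear_eq_zero (hφ : IsMollifier φ) {i : ℕ} (hi : i ≠ 0)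
    (A : ContinuousMultilinearMap ℝ (fun _ : Fin i => Eu n) ℂ) :
    ∫ z : Eu n, A (fun _ => z) * φ z = 0 := by
  have e : ∀ z : Eu n, A (fun _ => z) * φ z = ∑ r : Fin i → Fin n,
      (((∏ a, z (r a) : ℝ) : ℂ) * φ z) * A fun a => EuclideanSpace.basisFun (Fin n) ℝ (r a) := by
    intro z
    rw [multilinear_diag_eq_sum, Finset.sum_mul]
    exact Finset.sum_congr rfl fun r _ => by ring
  simp only [e]
  rw [integral_finsetSum _ fun r _ => (integrable_prod_mul φ r).mul_const _]
  refine Finset.sum_eq_zero fun r _ => ?_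
  rw [integral_mul_const, hφ.integral_prod_eq_zero hi, zero_mul]

/-- The integral remainder contains `D^(q+1) g` at points `y + tεz`. In the exponent of `1 + |z|`,
`q + 1` comes from the increment `(εz)^(q+1)`, and `k` from moving the weight from these points back
to `y`. -/
theorem norm_taylor_remainder_le (k q : ℕ) (g : 𝓢(Eu n, ℂ)) (ε : Eps) (y z : Eu n) :
    (1 + ‖y‖) ^ k * ‖g (y + (ε : ℝ) • z) - ∑ i ∈ Finset.range (q + 1),
        ((i.factorial : ℝ)⁻¹ : ℝ) • iteratedFDeriv ℝ i g y (fun _ => (ε : ℝ) • z)‖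
      ≤ ‖jet k (q + 1) g‖ * (ε : ℝ) ^ (q + 1) * ((1 + ‖z‖) ^ (k + q + 1)) := by
  have hε := ε.2.1
  rw [map_add_eq_sum_add_integral_iteratedFDeriv (n := q) (f := g)
    (fun t _ => (g.contDiffAt ((q + 1 : ℕ) : ℕ∞)).of_le (by push_cast; rfl)), add_sub_cancel_left]
  have hb : ∀ t ∈ Set.uIoc (0 : ℝ) 1, ‖(1 - t) ^ q •
      iteratedFDeriv ℝ (q + 1) g (y + t • (ε : ℝ) • z) (fun _ => (ε : ℝ) • z)‖
      ≤ ‖jet k (q + 1) g‖ * (ε : ℝ) ^ (q + 1) * ((1 + ‖z‖) ^ (k + q + 1)) / (1 + ‖y‖) ^ k := by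
    intro t ht
    rw [Set.uIoc_of_le zero_le_one] at ht
    have ht1 : |1 - t| ≤ 1 := by rw [abs_le]; constructor <;> linarith [ht.1, ht.2]
    rw [le_div_iff₀ (by positivity), norm_smul, norm_pow, Real.norm_eq_abs]
    have h1 : 1 + ‖y‖ ≤ (1 + ‖y + t • (ε : ℝ) • z‖) * (1 + ‖z‖) := by
      have := one_add_norm_le_mul (y + t • (ε : ℝ) • z) (-(t • (ε : ℝ) • z))
      rw [add_neg_cancel_right, norm_neg] at this
      refine this.trans ?_
      gcongr
      rw [norm_smul, norm_smul, Real.norm_of_nonneg ht.1.le, Real.norm_of_nonneg hε.le]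
      calc t * (ε * ‖z‖) ≤ 1 * (1 * ‖z‖) := by
            have := ε.2.2
            have := ht.2
            gcongr
        _ = ‖z‖ := by ring
    have h2 := ContinuousMultilinearMap.le_opNorm
      (iteratedFDeriv ℝ (q + 1) g (y + t • (ε : ℝ) • z)) (fun _ => (ε : ℝ) • z)
    rw [Finset.prod_const, Finset.card_univ, Fintype.card_fin, norm_smul,
      Real.norm_of_nonneg hε.le] at h2
    have h3 := le_norm_jet (k := k) (le_refl (q + 1)) g (y + t • (ε : ℝ) • z)
    calc |1 - t| ^ q * ‖iteratedFDeriv ℝ (q + 1) g (y + t • (ε : ℝ) • z) (fun _ => (ε : ℝ) • z)‖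
          * (1 + ‖y‖) ^ k
        ≤ 1 ^ q * (‖iteratedFDeriv ℝ (q + 1) g (y + t • (ε : ℝ) • z)‖ * (ε * ‖z‖) ^ (q + 1))
          * ((1 + ‖y + t • (ε : ℝ) • z‖) * (1 + ‖z‖)) ^ k := by gcongr
      _ = ((1 + ‖y + t • (ε : ℝ) • z‖) ^ k * ‖iteratedFDeriv ℝ (q + 1) g (y + t • (ε : ℝ) • z)‖)
          * (ε : ℝ) ^ (q + 1) * ((1 + ‖z‖) ^ k * ‖z‖ ^ (q + 1)) := by
          rw [mul_pow, mul_pow]; ring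
      _ ≤ ‖jet k (q + 1) g‖ * (ε : ℝ) ^ (q + 1) * ((1 + ‖z‖) ^ k * (1 + ‖z‖) ^ (q + 1)) := by
          gcongr
          linarith
      _ = _ := by ring
  have h := intervalIntegral.norm_integral_le_of_norm_le_const hb
  rw [norm_smul, sub_zero, abs_one, mul_one] at *
  have hf : ‖((q.factorial : ℝ)⁻¹)‖ ≤ 1 := by
    rw [norm_inv, Real.norm_natCast]
    exact inv_le_one_of_one_le₀ (by exact_mod_cast Nat.one_le_iff_ne_zero.2 q.factorial_ne_zero)
  rw [mul_comm, ← le_div_iff₀ (by positivity)]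
  calc _ ≤ 1 * _ := mul_le_mul hf h (norm_nonneg _) zero_le_one
    _ = _ := one_mul _

theorem integrable_one_add_pow_mul_norm (φ : 𝓢(Eu n, ℂ)) (k : ℕ) :
    Integrable fun z => (1 + ‖z‖) ^ k * ‖φ z‖ := by
  have : ∀ z : Eu n, (1 + ‖z‖) ^ k * ‖φ z‖
      = ∑ i ∈ Finset.range (k + 1), (k.choose i : ℝ) * (‖z‖ ^ i * ‖φ z‖) := by
    intro z
    rw [add_comm, add_pow, Finset.sum_mul]
    exact Finset.sum_congr rfl fun i _ => by rw [one_pow]; ring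
  simp only [this]
  exact integrable_finsetSum _ fun i _ => (φ.integrable_pow_mul volume i).const_mul _

/-- Mollification approximates to arbitrary order. -/
theorem IsMollifier.norm_sub_integral_le (hφ : IsMollifier φ) (k q : ℕ) (g : 𝓢(Eu n, ℂ)) (ε : Eps)
    (y : Eu n) :
    (1 + ‖y‖) ^ k * ‖g y - ∫ z, φ z * g (y + (ε : ℝ) • z)‖
      ≤ (∫ z, (1 + ‖z‖) ^ (k + q + 1) * ‖φ z‖) * ‖jet k (q + 1) g‖ * (ε : ℝ) ^ (q + 1) := by
  -- This is the Taylor polynomial of `z ↦ g (y + εz)`. Against `φ` its constant term gives `g y`,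
  -- as `∫ φ = 1`, and the others vanish, so only the remainder is left to integrate.
  set P : Eu n → ℂ := fun z => ∑ i ∈ Finset.range (q + 1),
    ((i.factorial : ℝ)⁻¹ : ℝ) • iteratedFDeriv ℝ i g y (fun _ => (ε : ℝ) • z) with hP
  have hterm : ∀ (i : ℕ) (z : Eu n),
      (((i.factorial : ℝ)⁻¹ : ℝ) • iteratedFDeriv ℝ i g y (fun _ => (ε : ℝ) • z)) * φ z
      = (((i.factorial : ℝ)⁻¹ * (ε : ℝ) ^ i : ℝ) : ℂ) *
        (iteratedFDeriv ℝ i g y (fun _ => z) * φ z) := by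
    intro i z
    rw [(iteratedFDeriv ℝ i g y).map_smul_univ (fun _ => (ε : ℝ)) (fun _ => z)]
    simp only [Finset.prod_const, Finset.card_univ, Fintype.card_fin, Complex.real_smul]
    push_cast
    ring
  have hPint : Integrable fun z => P z * φ z := by
    simp only [hP, Finset.sum_mul, hterm]
    exact integrable_finsetSum _ fun i _ => (integrable_multilinear_mul φ _).const_mul _
  have hPval : ∫ z, P z * φ z = g y := by
    simp only [hP, Finset.sum_mul, hterm]
    rw [integral_finsetSum _ fun i _ => (integrable_multilinear_mul φ _).const_mul _,
      Finset.sum_eq_single 0]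
    · simp [integral_const_mul, hφ.1]
    · intro i _ hi
      rw [integral_const_mul, hφ.integral_multilinear_eq_zero hi, mul_zero]
    · intro h
      exact absurd (Finset.mem_range.2 (Nat.succ_pos q)) h
  have hgint : Integrable fun z => φ z * g (y + (ε : ℝ) • z) := by
    refine φ.integrable.mul_bdd (c := SchwartzMap.seminorm ℂ 0 0 g)
      (by fun_prop) (Eventually.of_forall fun z => ?_)
    exact SchwartzMap.norm_le_seminorm ℂ g _
  have hdiff : g y - ∫ z, φ z * g (y + (ε : ℝ) • z)
      = -∫ z, (g (y + (ε : ℝ) • z) - P z) * φ z := by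
    rw [← hPval, ← integral_sub hPint hgint, ← integral_neg]
    congr 1
    funext z
    ring
  rw [hdiff, norm_neg]
  have hpos : (0 : ℝ) < (1 + ‖y‖) ^ k := by positivity
  rw [mul_comm, ← le_div_iff₀ hpos]
  have hb : ∀ z, ‖(g (y + (ε : ℝ) • z) - P z) * φ z‖
      ≤ (‖jet k (q + 1) g‖ * (ε : ℝ) ^ (q + 1) / (1 + ‖y‖) ^ k)
        * ((1 + ‖z‖) ^ (k + q + 1) * ‖φ z‖) := by
    intro z
    have h := norm_taylor_remainder_le k q g ε y z
    rw [mul_comm, ← le_div_iff₀ hpos] at h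
    rw [norm_mul]
    calc _ ≤ _ := mul_le_mul_of_nonneg_right h (norm_nonneg _)
      _ = _ := by ring
  refine (norm_integral_le_of_norm_le
    ((integrable_one_add_pow_mul_norm φ (k + q + 1)).const_mul _)
    (Eventually.of_forall hb)).trans (le_of_eq ?_)
  rw [integral_const_mul]
  ring

/-! ### Regularization of distributions acts like the distribution -/

/-- Evaluation of a component of a jet, as a continuous linear form. -/
def JetSpace.evalCLM {L : ℕ} (l : Fin (L + 1)) (y : Eu n) (m : Fin (l : ℕ) → Eu n) :
    JetSpace n L →L[ℂ] ℂ :=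
  LinearMap.mkContinuous
    { toFun := fun X => X.eval l y m
      map_add' := fun _ _ => rfl
      map_smul' := fun _ _ => rfl } (∏ i, ‖m i‖) fun X => by
    refine ((X.eval l y).le_opNorm m).trans ?_
    rw [mul_comm]
    exact mul_le_mul_of_nonneg_left (X.norm_eval_le l y) (by positivity)

theorem JetSpace.evalCLM_apply {L : ℕ} (l : Fin (L + 1)) (y : Eu n) (m : Fin (l : ℕ) → Eu n)
    (X : JetSpace n L) : JetSpace.evalCLM l y m X = X.eval l y m := rfl

/-- Jets of translates grow at most like `(1 + |x|)^k`, which the Schwartz function `b` compensates;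
so the Bochner integral exists in the jet space. -/
theorem integrable_smul_jet (k L : ℕ) (f b : 𝓢(Eu n, ℂ)) :
    Integrable fun x => b x • jet k L (translate x f) := by
  refine ((integrable_one_add_pow_mul_norm b k).const_mul ‖jet k L f‖).mono'
    ((b.continuous.smul (continuous_jet_translate k L f)).aestronglyMeasurable)
    (Eventually.of_forall fun x => ?_)
  rw [norm_smul]
  calc _ ≤ ‖b x‖ * ((1 + ‖x‖) ^ k * ‖jet k L f‖) := by
        gcongr
        exact norm_jet_translate_le k L x f
    _ = _ := by ring

/-- Evaluating a jet component commutes with the Bochner integral. Integration by parts moves `∂^m`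
from the mollifier to `b`, and the scalar approximation estimate is applied to `∂^m b`. -/
theorem IsMollifier.norm_jet_sub_integral_le (hφ : IsMollifier φ) (k L q : ℕ) (ε : Eps)
    (b : 𝓢(Eu n, ℂ)) :
    ‖jet k L b - ∫ x, b x • jet k L (shiftMoll φ ε x)‖
      ≤ (∫ z, (1 + ‖z‖) ^ (k + q + 1) * ‖φ z‖) * ‖jet k (L + q + 1) b‖ * (ε : ℝ) ^ (q + 1) := by
  have hε := ε.2.1
  have hM : 0 ≤ ∫ z, (1 + ‖z‖) ^ (k + q + 1) * ‖φ z‖ := integral_nonneg fun z => by positivity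
  refine JetSpace.norm_le (by positivity) fun l y => ?_
  refine ContinuousMultilinearMap.opNorm_le_bound (by positivity) fun m => ?_
  rw [← JetSpace.evalCLM_apply, map_sub]
  obtain ⟨f₀, hf₀, hf₁⟩ := exists_shiftMoll_eq_translate φ ε
  simp only [hf₁]
  rw [← (JetSpace.evalCLM l y m).integral_comp_comm (integrable_smul_jet k L _ b)]
  have e1 : ∀ f : 𝓢(Eu n, ℂ), JetSpace.evalCLM l y m (jet k L f)
      = (((1 + ‖y‖) ^ k : ℝ) : ℂ) * (∂^{m} f : 𝓢(Eu n, ℂ)) y := by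
    intro f
    rw [JetSpace.evalCLM_apply, jet_apply, SchwartzMap.iteratedLineDerivOp_eq_iteratedFDeriv,
      smul_apply, Complex.real_smul]
  have e2 : ∫ x, JetSpace.evalCLM l y m (b x • jet k L (translate x f₀))
      = (((1 + ‖y‖) ^ k : ℝ) : ℂ) * ∫ z, φ z * (∂^{m} b : 𝓢(Eu n, ℂ)) (y + (ε : ℝ) • z) := by
    rw [← integral_shiftMoll_zero_mul, ← hf₀, ← integral_reflect_iteratedLineDerivOp, ← integral_const_mul]
    congr 1
    funext x
    rw [map_smul, e1, iteratedLineDerivOp_translate, SchwartzMap.compSubConstCLM_apply, smul_eq_mul]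
    ring
  rw [e1, e2, ← mul_sub, norm_mul, Complex.norm_real, Real.norm_of_nonneg (by positivity)]
  refine (hφ.norm_sub_integral_le k q _ ε y).trans ?_
  have h := norm_jet_iteratedLineDerivOp_le k (q + 1) m b
  have h' : ‖jet k (q + 1 + l) b‖ ≤ ‖jet k (L + q + 1) b‖ :=
    norm_jet_mono le_rfl (by have := l.2; omega) b
  calc _ ≤ (∫ z, (1 + ‖z‖) ^ (k + q + 1) * ‖φ z‖) * (‖jet k (L + q + 1) b‖ * ∏ i, ‖m i‖)
        * (ε : ℝ) ^ (q + 1) := by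
        gcongr
        exact h.trans (by gcongr)
    _ = _ := by ring

/-- Pairing with a regularized distribution differs from applying the distribution by a term of
arbitrarily high order. -/
theorem IsMollifier.exists_norm_apply_sub_integral_le (hφ : IsMollifier φ)
    (hW : ∀ f, ‖W f‖ ≤ C * ‖jet k L f‖) (q : ℕ) :
    ∃ A ≥ 0, ∀ (ε : Eps) (b : 𝓢(Eu n, ℂ)), ‖W b - ∫ x, W (shiftMoll φ ε x) * b x‖
      ≤ A * ‖jet k (L + q + 1) b‖ * (ε : ℝ) ^ (q + 1) := by
  obtain ⟨T, hT⟩ := exists_jet_extension W hW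
  have hM : 0 ≤ ∫ z, (1 + ‖z‖) ^ (k + q + 1) * ‖φ z‖ := integral_nonneg fun z => by positivity
  refine ⟨‖T‖ * ∫ z, (1 + ‖z‖) ^ (k + q + 1) * ‖φ z‖, by positivity, fun ε b => ?_⟩
  -- The form `W` has no continuity on the jet space by itself. Its extension `T` is a continuous
  -- linear form there and commutes with the Bochner integral.
  have e : W b - ∫ x, W (shiftMoll φ ε x) * b x
      = T (jet k L b - ∫ x, b x • jet k L (shiftMoll φ ε x)) := by
    rw [map_sub, hT b]
    congr 1
    obtain ⟨f₀, hf₀, hf₁⟩ := exists_shiftMoll_eq_translate φ ε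
    simp only [hf₁]
    rw [← T.integral_comp_comm (integrable_smul_jet k L _ b)]
    congr 1
    funext x
    rw [map_smul, hT, smul_eq_mul, mul_comm]
  rw [e]
  refine (T.le_opNorm _).trans ?_
  calc _ ≤ ‖T‖ * _ := mul_le_mul_of_nonneg_left (hφ.norm_jet_sub_integral_le k L q ε b)
        (norm_nonneg _)
    _ = _ := by ring

end

/-! ### Direct functionals -/

section

variable {n : ℕ} {Ω V : Opens (Eu n)}

/-- The union of two compact subsets of `Ω`. -/
def CompactIn.union (K L : CompactIn Ω) : CompactIn Ω :=
  ⟨K.1 ∪ L.1, K.2.1.union L.2.1, Set.union_subset K.2.2 L.2.2⟩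

theorem Distr.isNegl_sub (w : Distr Ω) (K : CompactIn Ω) {a b : Eps → 𝓓(Ω, ℂ)}
    (ha : ∀ ε, tsupport (a ε) ⊆ K.1) (hb : ∀ ε, tsupport (b ε) ⊆ K.1) {u : G Ω}
    (hua : u.IsRep fun ε => testToSmooth (a ε)) (hub : u.IsRep fun ε => testToSmooth (b ε)) :
    IsNegl fun ε => w (a ε) - w (b ε) := by
  obtain ⟨C, hC, j, hw⟩ := w.exists_bound K
  refine ((hua.eq_iff hub).1 rfl (K, j)).of_le C (Eventually.of_forall fun ε => ?_)
  rw [Real.norm_of_nonneg (apply_nonneg _ _), ← map_sub]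
  refine hw (a ε - b ε) (closure_minimal (fun x hx => ?_) K.2.1.isClosed)
  by_contra hxK
  refine hx ?_
  change a ε x - b ε x = 0
  rw [image_eq_zero_of_notMem_tsupport fun h => hxK (ha ε h),
    image_eq_zero_of_notMem_tsupport fun h => hxK (hb ε h), sub_zero]

/-- A compactly supported generalized function has representatives with common compact support near
its support. -/
theorem Gc.exists_testRep (u : Gc Ω) (hV : u.val.supp ⊆ V) (hVΩ : V ≤ Ω) :
    ∃ (K : CompactIn V) (b : Eps → 𝓓(Ω, ℂ)), (∀ ε, tsupport (b ε) ⊆ K.1) ∧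
      u.val.supp ⊆ interior K.1 ∧ u.val.IsRep fun ε => testToSmooth (b ε) := by
  obtain ⟨χ, hχ, W, hW, hWV, h1⟩ := u.exists_cutoff hV hVΩ
  obtain ⟨a, ha⟩ := GE.exists_rep u.val
  refine ⟨suppIn χ hχ, fun ε => cut χ χ.tsupport_subset (a ε), fun ε => tsupport_cut _ _ _,
    hW.trans (interior_maximal (fun x hx => ?_) W.isOpen), G.isRep_cut ha χ hW h1⟩
  exact subset_closure (by rw [Function.mem_support, h1 x hx]; exact one_ne_zero)

/-- Each compact subset of `Ω` has a cutoff. -/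
theorem exists_cutoff_compactIn (K : CompactIn Ω) :
    ∃ (χ : 𝓓(Ω, ℂ)) (W : Opens (Eu n)), K.1 ⊆ W ∧ W ≤ Ω ∧ ∀ x ∈ W, χ x = 1 := by
  obtain ⟨χ, -, W, hW, hWΩ, h1⟩ := exists_cutoff K.2.1 Ω.isOpen le_rfl K.2.2
  exact ⟨χ, W, hW, hWΩ, h1⟩

theorem subset_interior_tsupport {χ : 𝓓(Ω, ℂ)} {W : Opens (Eu n)} (h1 : ∀ x ∈ W, χ x = 1) :
    (W : Set (Eu n)) ⊆ interior (tsupport χ) :=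
  interior_maximal (fun x hx => subset_closure (by
    rw [Function.mem_support, h1 x hx]; exact one_ne_zero)) W.isOpen

/-- For each compact `K`, with a cutoff `χ_K` equal to `1` near `K`, the net `w(χ_K u_ε)` defines a
continuous functional on all of `𝓖(Ω)`. If `supp u` lies in both `K` and `L`, then `χ_K u_ε` and
`χ_L u_ε` both represent `u`, so the functionals agree and glue. -/
theorem exists_isDirect (w : Distr Ω) : ∃ T, IsDirect w T := by
  choose χ W hKW hWΩ h1 using exists_cutoff_compactIn (Ω := Ω)
  have hT : ∀ K : CompactIn Ω, ∃ T : DualG Ω, ∀ u a, u.IsRep a →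
      (T u).IsRep fun ε => w (cut (χ K) (χ K).tsupport_subset (a ε)) := by
    intro K
    obtain ⟨C, hC, j, hw⟩ := w.exists_bound (suppIn (χ K) (χ K).tsupport_subset)
    obtain ⟨D, hD, hb⟩ := exists_bound_cut (χ K) (χ K).tsupport_subset j
    refine GE.exists_functional (fun _ => w.toLinearMap ∘ₗ cut (χ K) (χ K).tsupport_subset)
      {(suppIn (χ K) (χ K).tsupport_subset, j)} (C * D) 0 (Eventually.of_forall fun ε f => ?_)
    rw [Finset.sum_singleton, Nat.cast_zero, neg_zero, powNet_zero, mul_one, mul_assoc]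
    refine (hw _ (tsupport_cut _ _ _)).trans (mul_le_mul_of_nonneg_left ?_ hC)
    exact supDeriv_le (mul_nonneg hD (apply_nonneg _ _)) fun i hi x _ => hb f i hi x
  choose T hT using hT
  obtain ⟨S, hS⟩ := exists_dualGc T fun K L u hK hL => by
    obtain ⟨a, ha⟩ := GE.exists_rep u.val
    refine ((hT K _ a ha).eq_iff (hT L _ a ha)).2 (w.isNegl_sub
      ((suppIn (χ K) (χ K).tsupport_subset).union (suppIn (χ L) (χ L).tsupport_subset))
      (fun ε => (tsupport_cut _ _ _).trans Set.subset_union_left)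
      (fun ε => (tsupport_cut _ _ _).trans Set.subset_union_right)
      (G.isRep_cut ha (χ K) (hK.trans (hKW K)) (h1 K))
      (G.isRep_cut ha (χ L) (hL.trans (hKW L)) (h1 L)))
  refine ⟨S, fun u K a haK ha => ?_⟩
  have hu : u.val.supp ⊆ K.1 := G.supp_subset_of_tsupport ha K.2.1.isClosed haK
  rw [hS K u hu]
  refine (hT K _ _ ha).congr (w.isNegl_sub ((suppIn (χ K) (χ K).tsupport_subset).union K)
      (fun ε => (tsupport_cut _ _ _).trans Set.subset_union_left)
      (fun ε => (haK ε).trans Set.subset_union_right)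
      (G.isRep_cut ha (χ K) (hu.trans (hKW K)) (h1 K)) ha)

theorem existsUnique_isDirect (w : Distr Ω) : ∃! T, IsDirect w T := by
  obtain ⟨T, hT⟩ := exists_isDirect w
  refine ⟨T, hT, fun S hS => ContinuousLinearMap.ext fun u => ?_⟩
  obtain ⟨K, b, hbK, -, hb⟩ := u.exists_testRep (fun x hx => hx.1) le_rfl
  exact (hS u K b hbK hb).unique (hT u K b hbK hb)

theorem existsUnique_isDirectC (w : DistrC Ω) : ∃! T, IsDirectC w T := by
  obtain ⟨C, hC, K, j, hw⟩ := w.exists_bound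
  obtain ⟨T, hT⟩ := GE.exists_functional (p := smoothSeminorms Ω) (fun _ => w.toLinearMap)
    {(K, j)} C 0 (Eventually.of_forall fun ε f => by
      rw [Finset.sum_singleton, Nat.cast_zero, neg_zero, powNet_zero, mul_one]
      exact hw f)
  refine ⟨T, hT, fun S hS => ContinuousLinearMap.ext fun u => ?_⟩
  obtain ⟨a, ha⟩ := GE.exists_rep u
  exact (hS u a ha).unique (hT u a ha)

theorem exists_bound_tempered (w : 𝓢'(Eu n, ℂ)) : ∃ (s : Finset (ℕ × ℕ)) (C : ℝ), 0 ≤ C ∧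
    ∀ f, ‖w f‖ ≤ C * ∑ i ∈ s, schwartzSeminormFamily ℂ (Eu n) ℂ i f := by
  let q : Seminorm ℂ 𝓢(Eu n, ℂ) := (normSeminorm ℂ ℂ).comp w.toLinearMap
  have hq : Continuous q := continuous_norm.comp w.continuous
  obtain ⟨s, C, -, hC⟩ := Seminorm.bound_of_continuous (schwartz_withSeminorms ℂ (Eu n) ℂ) q hq
  refine ⟨s, C, C.2, fun f => (hC f).trans ?_⟩
  change (C : ℝ) * _ ≤ _
  refine mul_le_mul_of_nonneg_left ?_ C.2
  exact Seminorm.finset_sup_apply_le (Finset.sum_nonneg fun i _ => apply_nonneg _ _) fun i hi =>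
    Finset.single_le_sum (f := fun i => schwartzSeminormFamily ℂ (Eu n) ℂ i f)
      (fun i _ => apply_nonneg _ _) hi

theorem existsUnique_isDirectS (w : 𝓢'(Eu n, ℂ)) : ∃! T, IsDirectS w T := by
  obtain ⟨s, C, hC, hw⟩ := exists_bound_tempered w
  obtain ⟨T, hT⟩ := GE.exists_functional (p := schwartzSeminormFamily ℂ (Eu n) ℂ)
    (fun _ => w.toLinearMap) s C 0 (Eventually.of_forall fun ε f => by
      rw [Nat.cast_zero, neg_zero, powNet_zero, mul_one]
      exact hw f)
  refine ⟨T, hT, fun S hS => ContinuousLinearMap.ext fun u => ?_⟩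
  obtain ⟨a, ha⟩ := GE.exists_rep u
  exact (hS u a ha).unique (hT u a ha)

/-! ### Integration functionals -/

theorem isNegl_setIntegral {K : Set (Eu n)} (hK : volume K < ⊤) {f : Eps → Eu n → ℂ} {g : Eps → ℝ}
    (hg : IsNegl g) (h : ∀ ε, ∀ x ∈ K, ‖f ε x‖ ≤ g ε) : IsNegl fun ε => ∫ x in K, f ε x := by
  refine hg.of_le (volume.real K) (Eventually.of_forall fun ε => ?_)
  rw [mul_comm]
  exact norm_setIntegral_le_of_norm_le_const hK fun x hx =>
    (h ε x hx).trans (Real.le_norm_self _)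

theorem SmoothOn.continuousOn (f : SmoothOn Ω) {K : Set (Eu n)} (hK : K ⊆ Ω) : ContinuousOn f K :=
  fun _ hx => (f.contDiffAt (hK hx)).continuousAt.continuousWithinAt

theorem integrableOn_mul (K : CompactIn V) (hK : K.1 ⊆ Ω) (f : SmoothOn V) (g : SmoothOn Ω) :
    IntegrableOn (fun x => f x * g x) K.1 :=
  ((f.continuousOn K.2.2).mul (g.continuousOn hK)).integrableOn_compact K.2.1

theorem isNegl_mul_of_mod {a b : Eps → ℝ} {N : ℕ} (ha : a =O[toZero] powNet (-(N : ℝ)))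
    (hb : IsNegl b) : IsNegl fun ε => a ε * b ε := by
  obtain ⟨C, hC⟩ := ha.bound
  refine hb.of_le_powNet C N (hC.mono fun ε hε => ?_)
  rw [norm_powNet] at hε
  rw [norm_mul]
  gcongr

theorem G.exists_mod {u : G Ω} {a : Eps → SmoothOn Ω} (hu : u.IsRep a) (K : CompactIn Ω) (j : ℕ) :
    ∃ N : ℕ, (fun ε => supDeriv K.1 j (a ε)) =O[toZero] powNet (-(N : ℝ)) := hu.1 (K, j)

theorem isNegl_setIntegral_mul_of_disjoint {v : G V} {u : G Ω} (hVΩ : V ≤ Ω) {a : Eps → SmoothOn V}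
    {b : Eps → SmoothOn Ω} (ha : v.IsRep a) (hb : u.IsRep b) (K : CompactIn V)
    (hK : Disjoint K.1 u.supp) {s : Set (Eu n)} (hs : s ⊆ K.1) :
    IsNegl fun ε => ∫ x in s, a ε x * b ε x := by
  obtain ⟨N, hN⟩ := G.exists_mod ha K 0
  refine isNegl_setIntegral ((measure_mono hs).trans_lt K.2.1.measure_lt_top)
    (isNegl_mul_of_mod hN (G.isNegl_of_disjoint_supp hb (K.incl hVΩ) hK 0)) fun ε x hx => ?_
  rw [norm_mul]
  exact mul_le_mul (norm_le_supDeriv K _ 0 (hs hx)) (norm_le_supDeriv (K.incl hVΩ) _ 0 (hs hx))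
    (norm_nonneg _) (supDeriv_nonneg _ _ _)

/-- The two integrals differ by integrals over `K \ L` and `L \ K`, which stay away from the support
of `u`. There `u` is negligible and `v` moderate. -/
theorem isNegl_setIntegral_sub_set {v : G V} {u : G Ω} (hVΩ : V ≤ Ω) {a : Eps → SmoothOn V}
    {b : Eps → SmoothOn Ω} (ha : v.IsRep a) (hb : u.IsRep b) (K L : CompactIn V)
    (hK : u.supp ⊆ interior K.1) (hL : u.supp ⊆ interior L.1) :
    IsNegl fun ε => (∫ x in K.1, a ε x * b ε x) - ∫ x in L.1, a ε x * b ε x := by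
  have key : ∀ K L : CompactIn V, u.supp ⊆ interior L.1 →
      IsNegl fun ε => ∫ x in K.1 \ L.1, a ε x * b ε x := by
    intro K L hL
    refine isNegl_setIntegral_mul_of_disjoint hVΩ ha hb
      -- Removing only the interior keeps the set compact while it still misses the support.
      ⟨K.1 \ interior L.1, K.2.1.diff isOpen_interior, Set.sdiff_subset.trans K.2.2⟩
      (Set.disjoint_left.2 fun x hx hx' => hx.2 (hL hx')) fun x hx => ⟨hx.1, fun h => hx.2 (interior_subset h)⟩
  have h := (key K L hL).sub (key L K hK)
  refine h.of_le 1 (Eventually.of_forall fun ε => ?_)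
  rw [one_mul]
  refine le_of_eq (congrArg _ ?_)
  rw [← integral_inter_add_sdiff L.2.1.measurableSet
      (integrableOn_mul K (K.2.2.trans hVΩ) (a ε) (b ε)),
    ← integral_inter_add_sdiff K.2.1.measurableSet
      (integrableOn_mul L (L.2.2.trans hVΩ) (a ε) (b ε)), Set.inter_comm L.1 K.1]
  ring

/-- Write `ab - a'b' = a(b - b') + b'(a - a')`: in each term one factor is moderate and the other
negligible. -/
theorem isNegl_setIntegral_sub_rep {v : G V} {u : G Ω} (hVΩ : V ≤ Ω) {a a' : Eps → SmoothOn V}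
    {b b' : Eps → SmoothOn Ω} (ha : v.IsRep a) (ha' : v.IsRep a') (hb : u.IsRep b)
    (hb' : u.IsRep b') (K : CompactIn V) :
    IsNegl fun ε => (∫ x in K.1, a ε x * b ε x) - ∫ x in K.1, a' ε x * b' ε x := by
  obtain ⟨N, hN⟩ := G.exists_mod ha K 0
  obtain ⟨M, hM⟩ := G.exists_mod hb' (K.incl hVΩ) 0
  have h1 := isNegl_mul_of_mod hN ((hb.eq_iff hb').1 rfl (K.incl hVΩ, 0))
  have h2 := isNegl_mul_of_mod hM ((ha.eq_iff ha').1 rfl (K, 0))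
  have h := isNegl_setIntegral K.2.1.measure_lt_top
    (f := fun ε x => a ε x * b ε x - a' ε x * b' ε x) (h1.add h2) fun ε x hx => ?_
  · refine h.of_le 1 (Eventually.of_forall fun ε => ?_)
    rw [one_mul]
    refine le_of_eq (congrArg _ (integral_sub ?_ ?_).symm)
    · exact integrableOn_mul K (K.2.2.trans hVΩ) (a ε) (b ε)
    · exact integrableOn_mul K (K.2.2.trans hVΩ) (a' ε) (b' ε)
  · have e : a ε x * b ε x - a' ε x * b' ε x
        = a ε x * (b ε - b' ε : SmoothOn Ω) x + b' ε x * (a ε - a' ε : SmoothOn V) x := by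
      change _ = a ε x * (b ε x - b' ε x) + b' ε x * (a ε x - a' ε x)
      ring
    rw [e]
    refine (norm_add_le _ _).trans ?_
    rw [norm_mul, norm_mul]
    exact add_le_add
      (mul_le_mul (norm_le_supDeriv K _ 0 hx) (norm_le_supDeriv (K.incl hVΩ) _ 0 hx)
        (norm_nonneg _) (supDeriv_nonneg _ _ _))
      (mul_le_mul (norm_le_supDeriv (K.incl hVΩ) _ 0 hx) (norm_le_supDeriv K _ 0 hx)
        (norm_nonneg _) (supDeriv_nonneg _ _ _))

theorem isNegl_setIntegral_sub {v : G V} {u : G Ω} (hVΩ : V ≤ Ω) {a a' : Eps → SmoothOn V}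
    {b b' : Eps → SmoothOn Ω} (ha : v.IsRep a) (ha' : v.IsRep a') (hb : u.IsRep b)
    (hb' : u.IsRep b') (K L : CompactIn V)
    (hK : u.supp ⊆ interior K.1) (hL : u.supp ⊆ interior L.1) :
    IsNegl fun ε => (∫ x in K.1, a ε x * b ε x) - ∫ x in L.1, a' ε x * b' ε x :=
  (isNegl_setIntegral_sub_set hVΩ ha hb K L hK hL).trans
    (isNegl_setIntegral_sub_rep hVΩ ha ha' hb hb' L)

/-- Integration against a smooth function over a compact set. -/
def integralForm (K : CompactIn Ω) (a : SmoothOn Ω) : SmoothOn Ω →ₗ[ℂ] ℂ where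
  toFun f := ∫ x in K.1, a x * f x
  map_add' f g := by
    rw [← integral_add (integrableOn_mul K K.2.2 a f) (integrableOn_mul K K.2.2 a g)]
    refine integral_congr_ae (Eventually.of_forall fun x => ?_)
    exact mul_add _ _ _
  map_smul' c f := by
    rw [RingHom.id_apply, smul_eq_mul, ← integral_const_mul]
    refine integral_congr_ae (Eventually.of_forall fun x => ?_)
    exact mul_left_comm _ _ _

theorem exists_integralForm_functional {u : G Ω} {a : Eps → SmoothOn Ω} (ha : u.IsRep a)
    (K : CompactIn Ω) : ∃ T : DualG Ω, ∀ v b, v.IsRep b →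
      (T v).IsRep fun ε => ∫ x in K.1, a ε x * b ε x := by
  obtain ⟨N, hN⟩ := G.exists_mod ha K 0
  obtain ⟨C, hC⟩ := hN.bound
  refine GE.exists_functional (fun ε => integralForm K (a ε)) {(K, 0)} (C * volume.real K.1) N
    (hC.mono fun ε hε f => ?_)
  rw [norm_powNet, Real.norm_of_nonneg (supDeriv_nonneg _ _ _)] at hε
  rw [Finset.sum_singleton]
  have h := norm_setIntegral_le_of_norm_le_const (μ := volume) (f := fun x => a ε x * f x)
    (C := (C * powNet (-(N : ℝ)) ε) * supDeriv K.1 0 f) K.2.1.measure_lt_top fun x hx => by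
      rw [norm_mul]
      exact mul_le_mul ((norm_le_supDeriv K _ 0 hx).trans hε) (norm_le_supDeriv K _ 0 hx)
        (norm_nonneg _) ((supDeriv_nonneg _ _ _).trans hε)
  refine h.trans (le_of_eq ?_)
  rw [smoothSeminorms_apply]
  ring

/-- For each compact set, integration over the support of a cutoff is a functional on `𝓖(Ω)`.
Independence of integration set and representatives makes these functionals compatible. -/
theorem exists_isIntegralOn (u : G Ω) : ∃ T : DualGc Ω, IsIntegralOn u T := by
  obtain ⟨a, ha⟩ := GE.exists_rep u
  choose χ W hKW hWΩ h1 using exists_cutoff_compactIn (Ω := Ω)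
  choose T hT using fun K => exists_integralForm_functional ha
    (suppIn (χ K) (χ K).tsupport_subset)
  have h_int : ∀ K : CompactIn Ω, K.1 ⊆ interior (suppIn (χ K) (χ K).tsupport_subset).1 :=
    fun K => (hKW K).trans (subset_interior_tsupport (h1 K))
  obtain ⟨S, hS⟩ := exists_dualGc T fun K L v hK hL => by
    obtain ⟨b, hb⟩ := GE.exists_rep v.val
    exact ((hT K _ b hb).eq_iff (hT L _ b hb)).2 (isNegl_setIntegral_sub le_rfl ha ha hb hb _ _
      (hK.trans (h_int K)) (hL.trans (h_int L)))
  refine ⟨S, fun v _ a' b K ha' hb hK hKΩ hv => ?_⟩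
  rw [hS ⟨K, hK, hKΩ⟩ v (hv.trans interior_subset)]
  exact (hT _ _ b hb).congr (isNegl_setIntegral_sub le_rfl ha ha' hb hb _ ⟨K, hK, hKΩ⟩
    ((hv.trans interior_subset).trans (h_int ⟨K, hK, hKΩ⟩)) hv)

theorem existsUnique_isIntegralOn (u : G Ω) : ∃! T : DualGc Ω, IsIntegralOn u T := by
  obtain ⟨T, hT⟩ := exists_isIntegralOn u
  refine ⟨T, hT, fun S hS => ContinuousLinearMap.ext fun v => ?_⟩
  obtain ⟨a, ha⟩ := GE.exists_rep u
  have hv : v.val.supp ⊆ Ω := fun x hx => hx.1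
  obtain ⟨K, b, -, hK, hb⟩ := v.exists_testRep hv le_rfl
  exact (hS v hv a _ K.1 ha hb K.2.1 K.2.2 hK).unique (hT v hv a _ K.1 ha hb K.2.1 K.2.2 hK)

theorem existsUnique_isIntegralC (u : Gc Ω) : ∃! T : DualG Ω, IsIntegralC u T := by
  have hu : u.val.supp ⊆ Ω := fun x hx => hx.1
  obtain ⟨K, a, -, hK, ha⟩ := u.exists_testRep hu le_rfl
  obtain ⟨T, hT⟩ := exists_integralForm_functional ha K
  refine ⟨T, fun v a' b L ha' hb hL hLΩ hv => ?_, fun S hS => ContinuousLinearMap.ext fun v => ?_⟩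
  · refine (hT v b hb).congr ?_
    have := isNegl_setIntegral_sub le_rfl hb hb ha ha' K ⟨L, hL, hLΩ⟩ hK hv
    simpa only [mul_comm] using this
  · obtain ⟨b, hb⟩ := GE.exists_rep v
    exact (hS v _ b K.1 ha hb K.2.1 K.2.2 hK).unique (hT v b hb)

/-! ### Restriction of integration functionals; the chosen functionals -/

theorem IsIntegralOn.restrict {u : G Ω} {T : DualGc Ω} (hT : IsIntegralOn u T) (h : V ≤ Ω) :
    IsIntegralOn (G.restrict h u) T := by
  intro v hv a b K ha hb hK hKV hvK
  obtain ⟨a', ha'⟩ := GE.exists_rep u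
  refine (hT v (hv.trans h) a' b K ha' hb hK (hKV.trans h) hvK).congr ?_
  exact isNegl_setIntegral_sub_rep h (G.isRep_restrict ha' h) ha hb hb ⟨K, hK, hKV⟩

theorem isIntegralOn_toDual (u : G Ω) : IsIntegralOn u u.toDual :=
  Classical.epsilon_spec (exists_isIntegralOn u)

theorem isIntegralC_toDual (u : Gc Ω) : IsIntegralC u u.toDual :=
  Classical.epsilon_spec (existsUnique_isIntegralC u).exists

theorem isDirect_iotaD (w : Distr Ω) : IsDirect w (iotaD w) :=
  Classical.epsilon_spec (exists_isDirect w)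

theorem isDirectC_iotaDC (w : DistrC Ω) : IsDirectC w (iotaDC w) :=
  Classical.epsilon_spec (existsUnique_isDirectC w).exists

theorem isDirectS_iotaDS (w : 𝓢'(Eu n, ℂ)) : IsDirectS w (iotaDS w) :=
  Classical.epsilon_spec (existsUnique_isDirectS w).exists

end

/-! ### Pairing with slowly oscillating nets -/

section

variable {n : ℕ}

/-- Nets of Schwartz functions for which each derivative costs at most a factor `ε^(-1/2)`. Regular
nets are of this kind. -/
def IsSlow (b : Eps → 𝓢(Eu n, ℂ)) : Prop :=
  ∀ k : ℕ, ∃ N : ℕ, ∀ l : ℕ, (fun ε => ‖jet k l (b ε)‖) =O[toZero] powNet (-((N : ℝ) + l / 2))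

theorem IsMollifier.isNegl_pairing {φ : 𝓢(Eu n, ℂ)} (hφ : IsMollifier φ)
    {W : 𝓢(Eu n, ℂ) →ₗ[ℂ] ℂ} {C : ℝ} {k L : ℕ} (hW : ∀ f, ‖W f‖ ≤ C * ‖jet k L f‖)
    {b : Eps → 𝓢(Eu n, ℂ)} (hb : IsSlow b) :
    IsNegl fun ε => W (b ε) - ∫ x, W (shiftMoll φ ε x) * b ε x := by
  intro q
  obtain ⟨N, hN⟩ := hb k
  -- With Taylor order `r = 2q + 2N + L` the error gains `ε^(r+1)` and loses `ε^(-(N + (L+r+1)/2))`,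
  -- leaving `ε^(q + 1/2)`.
  obtain ⟨A, hA, h⟩ := hφ.exists_norm_apply_sub_integral_le hW (2 * q + 2 * N + L)
  have h1 : (fun ε => W (b ε) - ∫ x, W (shiftMoll φ ε x) * b ε x) =O[toZero]
      fun ε => ‖jet k (L + (2 * q + 2 * N + L) + 1) (b ε)‖
        * powNet ((2 * q + 2 * N + L + 1 : ℕ) : ℝ) ε := by
    refine IsBigO.of_bound A (Eventually.of_forall fun ε => (h ε (b ε)).trans (le_of_eq ?_))
    rw [powNet_natCast, norm_mul, norm_norm, norm_pow, Real.norm_of_nonneg ε.2.1.le, mul_assoc]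
  refine h1.trans (((hN _).mul (isBigO_refl _ _)).trans ?_)
  rw [powNet_mul]
  refine powNet_isBigO ?_
  push_cast
  linarith

/-! ### Jet norms versus Schwartz seminorms -/

theorem seminorm_le_norm_jet {k l K L : ℕ} (hk : k ≤ K) (hl : l ≤ L) (f : 𝓢(Eu n, ℂ)) :
    schwartzSeminormFamily ℂ (Eu n) ℂ (k, l) f ≤ ‖jet K L f‖ := by
  refine SchwartzMap.seminorm_le_bound ℂ k l f (norm_nonneg _) fun x => ?_
  refine le_trans ?_ (le_norm_jet hl f x)
  gcongr
  calc ‖x‖ ^ k ≤ (1 + ‖x‖) ^ k := by gcongr; linarith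
    _ ≤ (1 + ‖x‖) ^ K := pow_le_pow_right₀ (by linarith [norm_nonneg x]) hk

theorem norm_jet_le_sum (k L : ℕ) (f : 𝓢(Eu n, ℂ)) :
    ‖jet k L f‖ ≤ 2 ^ k * ∑ i ∈ Finset.Iic (k, L), schwartzSeminormFamily ℂ (Eu n) ℂ i f := by
  have h0 : 0 ≤ ∑ i ∈ Finset.Iic (k, L), schwartzSeminormFamily ℂ (Eu n) ℂ i f :=
    Finset.sum_nonneg fun i _ => apply_nonneg _ _
  refine norm_jet_le (by positivity) fun l hl y => ?_
  refine (SchwartzMap.one_add_le_sup_seminorm_apply (𝕜 := ℂ) (m := (k, L)) le_rfl hl f y).trans ?_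
  gcongr
  exact Seminorm.finset_sup_apply_le h0 fun i hi =>
    Finset.single_le_sum (f := fun i => schwartzSeminormFamily ℂ (Eu n) ℂ i f)
      (fun i _ => apply_nonneg _ _) hi

theorem exists_jet_bound_tempered (w : 𝓢'(Eu n, ℂ)) : ∃ (C : ℝ) (k L : ℕ), 0 ≤ C ∧
    ∀ f, ‖w f‖ ≤ C * ‖jet k L f‖ := by
  obtain ⟨s, C, hC, hw⟩ := exists_bound_tempered w
  refine ⟨C * s.card, s.sup Prod.fst, s.sup Prod.snd, by positivity, fun f => (hw f).trans ?_⟩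
  rw [mul_assoc]
  refine mul_le_mul_of_nonneg_left ?_ hC
  rw [← nsmul_eq_mul]
  exact Finset.sum_le_card_nsmul _ _ _ fun i hi => seminorm_le_norm_jet
    (Finset.le_sup (f := Prod.fst) hi) (Finset.le_sup (f := Prod.snd) hi) f

theorem isBigO_jet_of_seminorm {b : Eps → 𝓢(Eu n, ℂ)} {N : ℕ} (k L : ℕ)
    (h : ∀ i ≤ (k, L), (fun ε => schwartzSeminormFamily ℂ (Eu n) ℂ i (b ε))
      =O[toZero] powNet (-(N : ℝ))) :
    (fun ε => ‖jet k L (b ε)‖) =O[toZero] powNet (-(N : ℝ)) := by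
  have h1 : (fun ε => ‖jet k L (b ε)‖) =O[toZero] fun ε =>
      ∑ i ∈ Finset.Iic (k, L), schwartzSeminormFamily ℂ (Eu n) ℂ i (b ε) := by
    refine IsBigO.of_bound (2 ^ k) (Eventually.of_forall fun ε => ?_)
    rw [norm_norm]
    refine (norm_jet_le_sum k L (b ε)).trans ?_
    gcongr
    exact Real.le_norm_self _
  exact h1.trans (IsBigO.fun_sum fun i hi => h i (Finset.mem_Iic.1 hi))

theorem isSlow_of_regular {b : Eps → 𝓢(Eu n, ℂ)} {N : ℕ}
    (h : ∀ i, (fun ε => schwartzSeminormFamily ℂ (Eu n) ℂ i (b ε)) =O[toZero] powNet (-(N : ℝ))) :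
    IsSlow b := fun k => ⟨N, fun l => (isBigO_jet_of_seminorm k l fun i _ => h i).trans
      (powNet_isBigO (by have : (0 : ℝ) ≤ l / 2 := by positivity
                         linarith))⟩

/-! ### Tempered generalized functions -/

theorem GTau.exists_rep (u : GTau n) : ∃ a, u.IsRep a := by
  obtain ⟨a, rfl⟩ := Submodule.Quotient.mk_surjective (neglTau n) u
  exact ⟨a, a.2, rfl⟩

theorem integrable_temperate_mul {a : Eu n → ℂ} (ha : a.HasTemperateGrowth) (f : 𝓢(Eu n, ℂ)) :
    Integrable fun x => a x * f x := by
  obtain ⟨k, C, h⟩ := ha.2 0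
  refine ((integrable_one_add_pow_mul_norm f k).const_mul C).mono'
    (ha.1.continuous.mul f.continuous).aestronglyMeasurable (Eventually.of_forall fun x => ?_)
  rw [norm_mul, ← mul_assoc]
  gcongr
  simpa using h x

/-- Integration against a function of temperate growth. -/
def temperateForm {a : Eu n → ℂ} (ha : a.HasTemperateGrowth) : 𝓢(Eu n, ℂ) →ₗ[ℂ] ℂ where
  toFun f := ∫ x, a x * f x
  map_add' f g := by
    rw [← integral_add (integrable_temperate_mul ha f) (integrable_temperate_mul ha g)]
    refine integral_congr_ae (Eventually.of_forall fun x => ?_)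
    exact mul_add _ _ _
  map_smul' c f := by
    rw [RingHom.id_apply, smul_eq_mul, ← integral_const_mul]
    refine integral_congr_ae (Eventually.of_forall fun x => ?_)
    exact mul_left_comm _ _ _

/-- A weight of order `N` absorbs the growth of `a`, and a further `n + 1` leaves the integrable
function `(1 + |x|)^(-(n+1))`. -/
theorem exists_integral_mul_bound (n N : ℕ) : ∃ D ≥ 0, ∀ (f : 𝓢(Eu n, ℂ)) (a : Eu n → ℂ) (B : ℝ),
    (∀ x, ‖a x‖ ≤ B * (1 + ‖x‖) ^ N) →
      ‖∫ x, a x * f x‖ ≤ B * D * ‖jet (N + (n + 1)) 0 f‖ := by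
  have h_int : Integrable fun x : Eu n => ((1 + ‖x‖) ^ (n + 1))⁻¹ := by
    have := integrable_one_add_norm (E := Eu n) (μ := volume) (r := (n + 1 : ℕ)) (by simp)
    refine this.congr (Eventually.of_forall fun x => ?_)
    change (1 + ‖x‖) ^ (-((n + 1 : ℕ) : ℝ)) = ((1 + ‖x‖) ^ (n + 1))⁻¹
    rw [Real.rpow_neg (by positivity), Real.rpow_natCast]
  refine ⟨∫ x : Eu n, ((1 + ‖x‖) ^ (n + 1))⁻¹, integral_nonneg fun x => by positivity,
    fun f a B h => ?_⟩
  have hB : 0 ≤ B := by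
    have := (norm_nonneg _).trans (h 0)
    simpa using this
  refine (norm_integral_le_of_norm_le (h_int.const_mul (B * ‖jet (N + (n + 1)) 0 f‖))
    (Eventually.of_forall fun x => ?_)).trans (le_of_eq ?_)
  · have h1 := le_norm_jet (k := N + (n + 1)) (le_refl 0) f x
    rw [norm_iteratedFDeriv_zero] at h1
    rw [norm_mul, ← div_eq_mul_inv, le_div_iff₀ (by positivity)]
    calc ‖a x‖ * ‖f x‖ * (1 + ‖x‖) ^ (n + 1)
        ≤ B * (1 + ‖x‖) ^ N * ‖f x‖ * (1 + ‖x‖) ^ (n + 1) := by gcongr; exact h x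
      _ = B * ((1 + ‖x‖) ^ (N + (n + 1)) * ‖f x‖) := by ring
      _ ≤ _ := by gcongr
  · rw [integral_const_mul]
    ring

theorem existsUnique_isIntegralTau (u : GTau n) : ∃! T, IsIntegralTau u T := by
  obtain ⟨a, ha⟩ := u.exists_rep
  obtain ⟨N, C, hN⟩ := ha.1.2 0
  obtain ⟨D, hD, hb⟩ := exists_integral_mul_bound n N
  obtain ⟨T, hT⟩ := GE.exists_functional (p := schwartzSeminormFamily ℂ (Eu n) ℂ)
    (fun ε => temperateForm (ha.1.1 ε)) (Finset.Iic (N + (n + 1), 0))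
    (C * D * 2 ^ (N + (n + 1))) N (hN.mono fun ε hε f => by
      have h1 := hb f (a ε) (C * powNet (-(N : ℝ)) ε) fun x => by
        have := hε x
        rw [norm_iteratedFDeriv_zero] at this
        exact this.trans (le_of_eq (by ring))
      have hC : 0 ≤ C * powNet (-(N : ℝ)) ε := by
        simpa using (norm_nonneg _).trans (hε 0)
      refine h1.trans ((mul_le_mul_of_nonneg_left (norm_jet_le_sum _ 0 f)
        (mul_nonneg hC hD)).trans (le_of_eq (by ring))))
  refine ⟨T, fun v a' b ha' hvb => ?_, fun S hS => ContinuousLinearMap.ext fun v => ?_⟩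
  · refine (hT v b hvb).congr ?_
    have hd : (⟨a, ha.1⟩ - ⟨a', ha'.1⟩ : modTau n) ∈ neglTau n := by
      obtain ⟨h1, h2⟩ := ha
      obtain ⟨h3, rfl⟩ := ha'
      exact (Submodule.Quotient.eq (neglTau n)).1 h2
    -- In the definition of negligible tempered nets the weight exponent is chosen before the order.
    -- So one jet norm of `b` works for all `q`, and its growth `ε^(-P)` is absorbed by using order
    -- `q + P`.
    obtain ⟨M, hM⟩ := hd 0
    obtain ⟨D', hD', hb'⟩ := exists_integral_mul_bound n M
    have hmod : ∃ P : ℕ, (fun ε => ‖jet (M + (n + 1)) 0 (b ε)‖) =O[toZero] powNet (-(P : ℝ)) := by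
      choose P hP using hvb.1
      refine ⟨∑ i ∈ Finset.Iic (M + (n + 1), 0), P i, isBigO_jet_of_seminorm _ _ fun i hi =>
        (hP i).trans (powNet_isBigO ?_)⟩
      rw [neg_le_neg_iff]
      exact_mod_cast Finset.single_le_sum (f := P) (fun _ _ => Nat.zero_le _)
        (Finset.mem_Iic.2 hi)
    obtain ⟨P, hP⟩ := hmod
    intro q
    obtain ⟨E, hE⟩ := hM (q + P)
    have h1 : (fun ε => (∫ x, a ε x * b ε x) - ∫ x, a' ε x * b ε x) =O[toZero]
        fun ε => powNet ((q + P : ℕ) : ℝ) ε * ‖jet (M + (n + 1)) 0 (b ε)‖ := by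
      refine IsBigO.of_bound (E * D') (hE.mono fun ε hε => ?_)
      rw [← integral_sub (integrable_temperate_mul (ha.1.1 ε) (b ε))
        (integrable_temperate_mul (ha'.1.1 ε) (b ε))]
      have h2 := hb' (b ε) (fun x => a ε x - a' ε x) (E * powNet ((q + P : ℕ) : ℝ) ε) fun x => by
        have := hε x
        rw [norm_iteratedFDeriv_zero] at this
        exact this.trans (le_of_eq (by ring))
      simp only [sub_mul] at h2
      refine h2.trans (le_of_eq ?_)
      rw [norm_mul, norm_powNet, norm_norm]
      ring
    refine h1.trans (((isBigO_refl _ _).mul hP).trans ?_)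
    rw [powNet_mul]
    exact powNet_isBigO (by push_cast; linarith)
  · obtain ⟨b, hvb⟩ := GE.exists_rep v
    exact (hS v a b ha hvb).unique (hT v b hvb)

theorem existsUnique_isEmbS (φ : 𝓢(Eu n, ℂ)) (w : 𝓢'(Eu n, ℂ)) : ∃! u, IsEmbS φ w u := by
  obtain ⟨C, k, L, hC, hw⟩ := exists_jet_bound_tempered w
  have hb := norm_iteratedFDeriv_apply_shiftMoll_le (W := w.toLinearMap) hC hw φ
  have hmem : (fun (ε : Eps) x => w (shiftMoll φ ε x)) ∈ modTau n := by
    refine ⟨fun ε => ⟨contDiff_apply_shiftMoll (W := w.toLinearMap) hw φ ε, fun j =>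
      ⟨k, C * ‖jet k (L + j) φ‖ * ((ε : ℝ)⁻¹) ^ (n + (L + j)), fun x =>
        (hb ε j x).trans (le_of_eq (by ring))⟩⟩, fun j => ⟨k + (n + (L + j)), ?_⟩⟩
    refine TemperedBound.mono (N := k) (b := -((n + (L + j) : ℕ) : ℝ)) ?_ (by omega)
      (by push_cast; linarith [Nat.cast_nonneg (α := ℝ) k])
    refine ⟨C * ‖jet k (L + j) φ‖, Eventually.of_forall fun ε x => ?_⟩
    rw [powNet_neg_natCast]
    exact hb ε j x
  refine ⟨Submodule.Quotient.mk (p := neglTau n) ⟨_, hmem⟩, ⟨hmem, rfl⟩, ?_⟩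
  rintro u ⟨h, rfl⟩
  rfl

theorem iotaDS_eq_iotaS' {φ : 𝓢(Eu n, ℂ)} (hφ : IsMollifier φ) (w : 𝓢'(Eu n, ℂ)) {u : GS n}
    (hu : u ∈ GSInf n) : iotaDS w u = iotaS' φ w u := by
  obtain ⟨b, hb, N, hN⟩ := hu
  obtain ⟨C, k, L, hC, hw⟩ := exists_jet_bound_tempered w
  have h1 : IsIntegralTau (iotaS φ w) (iotaS' φ w) :=
    Classical.epsilon_spec (existsUnique_isIntegralTau (iotaS φ w)).exists
  have h2 : IsEmbS φ w (iotaS φ w) := Classical.epsilon_spec (existsUnique_isEmbS φ w).exists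
  exact ((isDirectS_iotaDS w u b hb).eq_iff (h1 u _ b h2 hb)).2
    (hφ.isNegl_pairing (W := w.toLinearMap) hw (isSlow_of_regular hN))

end

/-! ### Regularizations of compactly supported distributions -/

section

variable {n : ℕ} {Ω V : Opens (Eu n)}

section

variable {W : 𝓢(Eu n, ℂ) →ₗ[ℂ] ℂ} {C : ℝ} {k L : ℕ}

theorem exists_isBigO_supDeriv_shiftMoll (hC : 0 ≤ C) (hW : ∀ f, ‖W f‖ ≤ C * ‖jet k L f‖)
    (φ : 𝓢(Eu n, ℂ)) {M : Set (Eu n)} (hM : IsCompact M) (j : ℕ) :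
    ∃ N : ℕ, (fun ε => supDeriv M j fun x => W (shiftMoll φ ε x)) =O[toZero] powNet (-(N : ℝ)) := by
  obtain ⟨R, hR⟩ := hM.isBounded.exists_norm_le
  refine ⟨n + (L + j), IsBigO.of_bound (C * ‖jet k (L + j) φ‖ * (1 + |R|) ^ k)
    (Eventually.of_forall fun ε => ?_)⟩
  have hε := ε.2.1
  have hε1 : (1 : ℝ) ≤ (ε : ℝ)⁻¹ := (one_le_inv₀ ε.2.1).2 ε.2.2
  rw [Real.norm_of_nonneg (supDeriv_nonneg _ _ _), norm_powNet, powNet_neg_natCast]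
  refine supDeriv_le (by positivity) fun i hi x hx => ?_
  refine (norm_iteratedFDeriv_apply_shiftMoll_le hC hW φ ε i x).trans ?_
  have h1 := norm_jet_mono (le_refl k) (Nat.add_le_add_left hi L) φ
  have h2 : ‖x‖ ≤ |R| := (hR x hx).trans (le_abs_self R)
  gcongr

/-- Disjoint compact sets have positive distance. The mollifier need not have compact support, so
the regularization does not vanish off `K`, but its rapid decay over this distance beats all powers
of `ε⁻¹`. -/
theorem isNegl_supDeriv_shiftMoll {K : Set (Eu n)} (hK : IsCompact K) (hC : 0 ≤ C)
    (hW : ∀ f, ‖W f‖ ≤ C * supDeriv K L f) (φ : 𝓢(Eu n, ℂ)) {M : Set (Eu n)} (hM : IsCompact M)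
    (hMK : Disjoint M K) (j : ℕ) : IsNegl fun ε => supDeriv M j fun x => W (shiftMoll φ ε x) := by
  obtain ⟨r, hr, h⟩ := Metric.exists_pos_forall_lt_edist hM hK.isClosed hMK
  intro q
  let B : ℕ → ℝ := fun i =>
    C * ‖jet (q + (n + (L + i))) (L + i) φ‖ * ((r : ℝ)⁻¹) ^ (q + (n + (L + i)))
  have hB : ∀ i, 0 ≤ B i := fun i => by positivity
  refine IsBigO.of_bound (∑ i ∈ Finset.range (j + 1), B i) (Eventually.of_forall fun ε => ?_)
  have hε := ε.2.1
  rw [Real.norm_of_nonneg (supDeriv_nonneg _ _ _), norm_powNet, powNet_natCast]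
  refine supDeriv_le (mul_nonneg (Finset.sum_nonneg fun i _ => hB i) (by positivity))
    fun i hi x hx => ?_
  refine (norm_iteratedFDeriv_apply_shiftMoll_le_of_dist hC hW φ i q (NNReal.coe_pos.2 hr) ε x
    fun y hy => ?_).trans ?_
  · have := (h x hx y hy).le
    rw [edist_dist, ENNReal.le_ofReal_iff_toReal_le ENNReal.coe_ne_top dist_nonneg] at this
    rw [← dist_eq_norm]
    exact this
  · refine mul_le_mul_of_nonneg_right ?_ (by positivity)
    exact Finset.single_le_sum (f := B) (fun i _ => hB i)
      (Finset.mem_range.2 (Nat.lt_succ_iff.2 hi))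

end

/-! ### Localized distributions and their regularizations -/

/-- A distribution multiplied by a test function, as a linear form on Schwartz functions. -/
def locForm (w : Distr Ω) (ψ : 𝓓(Ω, ℂ)) : 𝓢(Eu n, ℂ) →ₗ[ℂ] ℂ where
  toFun f := w (testMul ψ f)
  map_add' f g := by
    rw [← map_add]
    congr 1
    ext x
    exact mul_add _ _ _
  map_smul' c f := by
    rw [RingHom.id_apply, ← map_smul]
    congr 1
    ext x
    exact mul_left_comm _ _ _

theorem locForm_apply (w : Distr Ω) (ψ : 𝓓(Ω, ℂ)) (f : 𝓢(Eu n, ℂ)) :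
    locForm w ψ f = w (testMul ψ f) := rfl

theorem exists_bound_locForm (w : Distr Ω) (ψ : 𝓓(Ω, ℂ)) :
    ∃ C ≥ 0, ∃ L : ℕ, ∀ f, ‖locForm w ψ f‖ ≤ C * supDeriv (tsupport ψ) L f := by
  obtain ⟨C, hC, j, hw⟩ := w.exists_bound (suppIn ψ ψ.tsupport_subset)
  obtain ⟨D, hD, hb⟩ := exists_bound_cut ψ ψ.tsupport_subset j
  refine ⟨C * D, by positivity, j, fun f => ?_⟩
  rw [mul_assoc]
  refine (hw (testMul ψ f) tsupport_mul_subset_left).trans (mul_le_mul_of_nonneg_left ?_ hC)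
  exact supDeriv_le (mul_nonneg hD (supDeriv_nonneg _ _ _)) fun i hi x _ =>
    hb (schwartzToSmooth Ω f) i hi x

theorem exists_jet_bound_locForm (w : Distr Ω) (ψ : 𝓓(Ω, ℂ)) :
    ∃ C ≥ 0, ∃ L : ℕ, ∀ f, ‖locForm w ψ f‖ ≤ C * ‖jet 0 L f‖ := by
  obtain ⟨C, hC, L, h⟩ := exists_bound_locForm w ψ
  exact ⟨C, hC, L, fun f => (h f).trans
    (mul_le_mul_of_nonneg_left (supDeriv_le_norm_jet _ 0 L f) hC)⟩

/-- The regularization `ψ w * φ_ε`, as a smooth function on `V`. -/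
def locReg (φ : 𝓢(Eu n, ℂ)) (w : Distr Ω) (ψ : 𝓓(Ω, ℂ)) (V : Opens (Eu n)) (ε : Eps) : SmoothOn V :=
  ⟨fun x => w (testMul ψ (shiftMoll φ ε x)), by
    obtain ⟨C, hC, L, h⟩ := exists_jet_bound_locForm w ψ
    exact (contDiff_apply_shiftMoll h φ ε).contDiffOn⟩

theorem locReg_apply (φ : 𝓢(Eu n, ℂ)) (w : Distr Ω) (ψ : 𝓓(Ω, ℂ)) (V : Opens (Eu n)) (ε : Eps)
    (x : Eu n) : locReg φ w ψ V ε x = w (testMul ψ (shiftMoll φ ε x)) := rfl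

theorem locReg_mem_modE (φ : 𝓢(Eu n, ℂ)) (w : Distr Ω) (ψ : 𝓓(Ω, ℂ)) (V : Opens (Eu n)) :
    locReg φ w ψ V ∈ modE (smoothSeminorms V) := by
  obtain ⟨C, hC, L, h⟩ := exists_jet_bound_locForm w ψ
  exact fun i => exists_isBigO_supDeriv_shiftMoll hC h φ i.1.2.1 i.2

theorem isNegl_locReg (φ : 𝓢(Eu n, ℂ)) (w : Distr Ω) (ψ : 𝓓(Ω, ℂ)) (V : Opens (Eu n))
    {M : Set (Eu n)} (hM : IsCompact M) (hMψ : Disjoint M (tsupport ψ)) (j : ℕ) :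
    IsNegl fun ε => supDeriv M j (locReg φ w ψ V ε) := by
  obtain ⟨C, hC, L, h⟩ := exists_bound_locForm w ψ
  exact isNegl_supDeriv_shiftMoll ψ.hasCompactSupport hC h φ hM hMψ j

theorem locReg_sub (φ : 𝓢(Eu n, ℂ)) (w : Distr Ω) (ψ ψ' : 𝓓(Ω, ℂ)) (V : Opens (Eu n)) (ε : Eps)
    (x : Eu n) : locReg φ w (ψ - ψ') V ε x = locReg φ w ψ V ε x - locReg φ w ψ' V ε x := by
  rw [locReg_apply, locReg_apply, locReg_apply, ← map_sub]
  congr 1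
  ext y
  exact sub_mul _ _ _

theorem disjoint_tsupport_of_eqOn_zero {f : Eu n → ℂ} {U M : Set (Eu n)} (hU : IsOpen U)
    (hM : M ⊆ U) (h : ∀ x ∈ U, f x = 0) : Disjoint M (tsupport f) := by
  refine Set.disjoint_left.2 fun x hx hx' => ?_
  obtain ⟨y, hy, hy'⟩ := mem_closure_iff.1 hx' U hU (hM hx)
  exact hy' (h y hy)

theorem G.eq_of_eqOn {u v : G Ω} {a b : Eps → SmoothOn Ω} (hu : u.IsRep a) (hv : v.IsRep b)
    (h : ∀ ε, ∀ x ∈ Ω, a ε x = b ε x) : u = v := by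
  refine (hu.eq_iff hv).2 fun ⟨K, j⟩ => ?_
  have : ∀ ε, smoothSeminorms Ω (K, j) (a ε - b ε) = 0 := fun ε => by
    rw [smoothSeminorms_apply, supDeriv_congr (g := fun _ => 0) Ω.isOpen K.2.2 fun x hx => ?_]
    · simp [supDeriv]
    · exact sub_eq_zero.2 (h ε x hx)
  simpa only [this] using IsNegl.zero

/-! ### The embedding of distributions -/

theorem exists_exhaustion (Ω : Opens (Eu n)) : ∃ K : ℕ → CompactIn Ω, Monotone (fun m => (K m).1) ∧
    ∀ L : CompactIn Ω, ∃ m, L.1 ⊆ interior (K m).1 := by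
  have : LocallyCompactSpace Ω := Ω.isOpen.locallyCompactSpace
  let E : CompactExhaustion Ω := CompactExhaustion.choice Ω
  have hval : ∀ s : Set Ω, IsOpen s → IsOpen (Subtype.val '' s : Set (Eu n)) := fun s hs =>
    Ω.isOpen.isOpenMap_subtype_val s hs
  let K : ℕ → CompactIn Ω := fun m => ⟨Subtype.val '' E m,
    (E.isCompact m).image continuous_subtype_val, by rintro _ ⟨x, -, rfl⟩; exact x.2⟩
  have hmono : Monotone (fun m => (K m).1) := fun i j hij => Set.image_mono (E.subset hij)
  refine ⟨K, hmono, fun L => ?_⟩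
  refine L.2.1.elim_directed_cover (fun m => interior (K m).1)
    (fun m => isOpen_interior) (fun x hx => ?_) fun i j => ⟨max i j,
      interior_mono (hmono (le_max_left _ _)), interior_mono (hmono (le_max_right _ _))⟩
  · obtain ⟨m, hm⟩ := E.exists_mem ⟨x, L.2.2 hx⟩
    refine Set.mem_iUnion.2 ⟨m + 1, ?_⟩
    refine interior_maximal (Set.image_mono interior_subset) (hval _ isOpen_interior)
      ⟨⟨x, L.2.2 hx⟩, E.subset_interior_succ m hm, rfl⟩

theorem isNegl_supDeriv_cut {χ : 𝓓(Ω, ℂ)} {L : CompactIn V} {a : Eps → SmoothOn V} {j : ℕ}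
    (h : IsNegl fun ε => supDeriv (L.1 ∩ tsupport χ) j (a ε)) :
    IsNegl fun ε => supDeriv L.1 j fun x => χ x * a ε x := by
  obtain ⟨C, hC, hb⟩ := exists_bound_iteratedFDeriv_mul χ.contDiff χ.hasCompactSupport j
  refine h.of_le C (Eventually.of_forall fun ε => ?_)
  rw [Real.norm_of_nonneg (supDeriv_nonneg _ _ _), Real.norm_of_nonneg (supDeriv_nonneg _ _ _)]
  refine supDeriv_le (mul_nonneg hC (supDeriv_nonneg _ _ _)) fun i hi x hx => ?_
  by_cases hxχ : x ∈ tsupport χ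
  · refine hb (a ε) x _ ((a ε).contDiffAt (L.2.2 hx)) (fun i hi => ?_) i hi
    exact norm_iteratedFDeriv_le_supDeriv
      (⟨_, L.2.1.inter_right (isClosed_tsupport _), Set.inter_subset_left.trans L.2.2⟩ : CompactIn V)
      (a ε) hi ⟨hx, hxχ⟩
  · rw [iteratedFDeriv_eq_zero_of_notMem_tsupport fun hx' => hxχ (tsupport_mul_subset_left hx'),
      norm_zero]
    exact mul_nonneg hC (supDeriv_nonneg _ _ _)

/-- Take a partition of unity `χ_m` and cutoffs `ψ'_m` equal to `1` near `supp χ_m`, and glue `χ_m ·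
(ψ'_m w * φ_ε)`. Compared with `ψ w * φ_ε` on `V`, the `m`-th error is `χ_m · ((ψ - ψ'_m) w * φ_ε)`.
On `V ∩ supp χ_m` it is taken away from the support of `ψ - ψ'_m`, so it is negligible, and only
finitely many `m` matter on a compact set. -/
theorem exists_glued_net (φ : 𝓢(Eu n, ℂ)) (w : Distr Ω) : ∃ a : Eps → SmoothOn Ω,
    ∀ (V : Opens (Eu n)) (h : V ≤ Ω) (ψ : 𝓓(Ω, ℂ)), (∀ x ∈ V, ψ x = 1) →
      ∀ (L : CompactIn V) (j : ℕ),
        IsNegl fun ε => supDeriv L.1 j (locReg φ w ψ V ε - (a ε).restrict h : SmoothOn V) := by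
  obtain ⟨K, hK, hKL⟩ := exists_exhaustion Ω
  choose θ W hKW hWΩ hθ using fun m => exists_cutoff_compactIn (K m)
  -- Differences of successive cutoffs: the partial sums telescope to `θ M`, which is `1` near `K
  -- M`. The case `m = 0` is separate because `m - 1` truncates.
  let χ : ℕ → 𝓓(Ω, ℂ) := fun m => θ m - (if m = 0 then 0 else θ (m - 1))
  choose ψ' W' hχW hW'Ω hψ' using fun m => exists_cutoff_compactIn
    (suppIn (χ m) (χ m).tsupport_subset)
  have hsum : ∀ M, ∑ m ∈ Finset.range (M + 1), χ m = θ M := by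
    intro M
    induction M with
    | zero => simp [χ]
    | succ M ih => rw [Finset.sum_range_succ, ih]; simp [χ]
  -- For `m > M` both cutoffs in `χ m` equal `1` on `K M`. This local finiteness replaces the
  -- infinite sum by a finite one near each compact set.
  have hχ0 : ∀ M m, M < m → ∀ x ∈ interior (K M).1, χ m x = 0 := by
    intro M m hMm x hx
    have h1 : θ m x = 1 := hθ m x (hKW m (hK hMm.le (interior_subset hx)))
    have h2 : θ (m - 1) x = 1 :=
      hθ _ x (hKW _ (hK (Nat.le_sub_one_of_lt hMm) (interior_subset hx)))
    have : χ m = θ m - θ (m - 1) := by simp [χ, (Nat.zero_lt_of_lt hMm).ne']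
    rw [this]
    change θ m x - θ (m - 1) x = 0
    rw [h1, h2, sub_self]
  let A : Eps → Eu n → ℂ := fun ε x => ∑ᶠ m, χ m x * locReg φ w (ψ' m) Ω ε x
  have hA : ∀ M ε, ∀ x ∈ interior (K M).1,
      A ε x = ∑ m ∈ Finset.range (M + 1), χ m x * locReg φ w (ψ' m) Ω ε x := by
    intro M ε x hx
    refine finsum_eq_sum_of_support_subset _ fun m hm => ?_
    by_contra hmM
    rw [Finset.mem_coe, Finset.mem_range, not_lt, Nat.succ_le_iff] at hmM
    exact hm (by change χ m x * _ = 0; rw [hχ0 M m hmM x hx, zero_mul])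
  have hAs : ∀ ε, ContDiffOn ℝ ∞ (A ε) Ω := by
    intro ε x hx
    obtain ⟨M, hM⟩ := hKL ⟨{x}, isCompact_singleton, Set.singleton_subset_iff.2 hx⟩
    have hxM : x ∈ interior (K M).1 := hM rfl
    have : ContDiffAt ℝ ∞ (fun x => ∑ m ∈ Finset.range (M + 1),
        χ m x * locReg φ w (ψ' m) Ω ε x) x :=
      ContDiffAt.sum fun m _ =>
        (χ m).contDiff.contDiffAt.mul ((locReg φ w (ψ' m) Ω ε).contDiffAt hx)
    refine (this.congr_of_eventuallyEq ?_).contDiffWithinAt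
    filter_upwards [isOpen_interior.mem_nhds hxM] with y hy using hA M ε y hy
  refine ⟨fun ε => ⟨A ε, hAs ε⟩, fun V h ψ hψ L j => ?_⟩
  obtain ⟨M, hM⟩ := hKL ⟨L.1, L.2.1, L.2.2.trans h⟩
  have hterm : ∀ m, IsNegl fun ε => supDeriv L.1 j
      fun x => χ m x * locReg φ w (ψ - ψ' m) V ε x := by
    intro m
    refine isNegl_supDeriv_cut (isNegl_locReg φ w (ψ - ψ' m) V
      (L.2.1.inter_right (isClosed_tsupport _)) ?_ j)
    refine disjoint_tsupport_of_eqOn_zero (U := V ∩ W' m) (V.isOpen.inter (W' m).isOpen)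
      (Set.inter_subset_inter L.2.2 (hχW m)) fun x hx => ?_
    change ψ x - ψ' m x = 0
    rw [hψ x hx.1, hψ' m x hx.2, sub_self]
  refine (IsNegl.sum (Finset.range (M + 1)) fun m _ => hterm m).of_le 1
    (Eventually.of_forall fun ε => ?_)
  have h0 : 0 ≤ ∑ m ∈ Finset.range (M + 1), supDeriv L.1 j
      fun x => χ m x * locReg φ w (ψ - ψ' m) V ε x := Finset.sum_nonneg fun m _ =>
        supDeriv_nonneg _ _ _
  rw [one_mul, Real.norm_of_nonneg (supDeriv_nonneg _ _ _), Real.norm_of_nonneg h0]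
  let r : ℕ → SmoothOn V := fun m => ⟨fun x => χ m x * locReg φ w (ψ - ψ' m) V ε x,
    (χ m).contDiff.contDiffOn.mul (locReg φ w (ψ - ψ' m) V ε).2⟩
  have hcoe : ∀ (s : Finset ℕ) (x : Eu n), (∑ m ∈ s, r m : SmoothOn V) x = ∑ m ∈ s, r m x := by
    intro s x
    induction s using Finset.induction_on with
    | empty => rfl
    | insert m s hm ih => rw [Finset.sum_insert hm, Finset.sum_insert hm, ← ih]; rfl
  have hle : smoothSeminorms V (L, j) (∑ m ∈ Finset.range (M + 1), r m)
      ≤ ∑ m ∈ Finset.range (M + 1), smoothSeminorms V (L, j) (r m) :=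
    Finset.le_sum_of_subadditive _ (map_zero _).le (map_add_le_add _) _ _
  refine le_trans (le_of_eq ?_) hle
  rw [smoothSeminorms_apply]
  refine supDeriv_congr (U := V ∩ interior (K M).1) (V.isOpen.inter isOpen_interior)
    (Set.subset_inter L.2.2 hM) (fun x hx => ?_) j
  rw [hcoe]
  change locReg φ w ψ V ε x - A ε x = ∑ m ∈ Finset.range (M + 1),
    χ m x * locReg φ w (ψ - ψ' m) V ε x
  have h1 : ∑ m ∈ Finset.range (M + 1), χ m x = 1 := by
    have h2 := congrArg (fun f : 𝓓(Ω, ℂ) => f x) (hsum M)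
    have h3 : θ M x = 1 := hθ M x (hKW M (interior_subset hx.2))
    simp only [h3] at h2
    rw [← h2]
    exact (map_sum ({ toFun := fun f : 𝓓(Ω, ℂ) => f x, map_zero' := rfl, map_add' := fun _ _ => rfl } :
      𝓓(Ω, ℂ) →+ ℂ) χ _).symm
  rw [hA M ε x hx.2, ← one_mul (locReg φ w ψ V ε x), ← h1, Finset.sum_mul, ← Finset.sum_sub_distrib]
  refine Finset.sum_congr rfl fun m _ => ?_
  rw [locReg_sub, mul_sub]
  rfl

/-- Near each compact set the glued net differs negligibly from a moderate local regularization,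
hence is moderate. Uniqueness holds because each compact set has a neighbourhood on which some
cutoff is `1`, so the local requirements determine the class. -/
theorem existsUnique_isEmb (φ : 𝓢(Eu n, ℂ)) (w : Distr Ω) : ∃! u, IsEmb φ w u := by
  obtain ⟨a, ha⟩ := exists_glued_net φ w
  have hmem : a ∈ modE (smoothSeminorms Ω) := by
    rintro ⟨K, j⟩
    obtain ⟨ψ, W, hKW, hWΩ, h1⟩ := exists_cutoff_compactIn K
    obtain ⟨N, hN⟩ := locReg_mem_modE φ w ψ W (⟨K.1, K.2.1, hKW⟩, j)
    refine ⟨N, IsBigO.trans (IsBigO.of_bound 1 (Eventually.of_forall fun ε => ?_))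
      (((ha W hWΩ ψ h1 ⟨K.1, K.2.1, hKW⟩ j).isBigO _).add hN)⟩
    rw [one_mul, Real.norm_of_nonneg (apply_nonneg _ _)]
    refine le_trans ?_ (Real.le_norm_self _)
    have := map_sub_le_add (smoothSeminorms W (⟨K.1, K.2.1, hKW⟩, j)) (locReg φ w ψ W ε)
      (locReg φ w ψ W ε - (a ε).restrict hWΩ)
    rw [sub_sub_cancel, add_comm] at this
    exact this
  refine ⟨GE.mk ⟨a, hmem⟩, fun V h ψ hψ => ⟨locReg φ w ψ V, ?_, fun ε x _ => rfl⟩, fun u hu => ?_⟩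
  · refine (GE.isRep_mk (locReg_mem_modE φ w ψ V)).congr (b := fun ε => (a ε).restrict h)
      (fun i => ha V h ψ hψ i.1 i.2) |>.unique (G.isRep_restrict (GE.isRep_mk hmem) h) ▸
      GE.isRep_mk (locReg_mem_modE φ w ψ V)
  · have hm : IsEmb φ w (GE.mk ⟨a, hmem⟩) := fun V h ψ hψ => ⟨locReg φ w ψ V,
      (GE.isRep_mk (locReg_mem_modE φ w ψ V)).congr (b := fun ε => (a ε).restrict h)
      (fun i => ha V h ψ hψ i.1 i.2) |>.unique (G.isRep_restrict (GE.isRep_mk hmem) h) ▸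
      GE.isRep_mk (locReg_mem_modE φ w ψ V), fun ε x _ => rfl⟩
    refine G.ext_of_restrict fun K => ?_
    obtain ⟨ψ, W, hKW, hWΩ, h1⟩ := exists_cutoff_compactIn K
    obtain ⟨b, hb, hb'⟩ := hu W hWΩ ψ h1
    obtain ⟨c, hc, hc'⟩ := hm W hWΩ ψ h1
    exact ⟨W, hWΩ, hKW, G.eq_of_eqOn hb hc fun ε x hx => by rw [hb' ε x hx, hc' ε x hx]⟩

theorem isEmb_iota (φ : 𝓢(Eu n, ℂ)) (w : Distr Ω) : IsEmb φ w (iota φ w) :=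
  Classical.epsilon_spec (existsUnique_isEmb φ w).exists

theorem isRep_restrict_iota (φ : 𝓢(Eu n, ℂ)) (w : Distr Ω) (h : V ≤ Ω) {ψ : 𝓓(Ω, ℂ)}
    (hψ : ∀ x ∈ V, ψ x = 1) : (G.restrict h (iota φ w)).IsRep (locReg φ w ψ V) := by
  obtain ⟨b, hb, hb'⟩ := isEmb_iota φ w V h ψ hψ
  have hl := GE.isRep_mk (locReg_mem_modE φ w ψ V)
  rwa [← G.eq_of_eqOn hb hl fun ε x hx => hb' ε x hx] at hl

theorem isIntegralOn_iota' (φ : 𝓢(Eu n, ℂ)) (w : Distr Ω) : IsIntegralOn (iota φ w) (iota' φ w) :=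
  isIntegralOn_toDual _

/-! ### The embedding of compactly supported distributions -/

/-- A compactly supported distribution as a linear form on Schwartz functions. -/
def formC (w : DistrC Ω) : 𝓢(Eu n, ℂ) →ₗ[ℂ] ℂ where
  toFun f := w (schwartzToSmooth Ω f)
  map_add' f g := by
    rw [← map_add]
    rfl
  map_smul' c f := by
    rw [RingHom.id_apply, ← map_smul]
    rfl

theorem exists_bound_formC (w : DistrC Ω) : ∃ C ≥ 0, ∃ (K : CompactIn Ω) (L : ℕ),
    (∀ f, ‖w f‖ ≤ C * supDeriv K.1 L f) ∧ (∀ f, ‖formC w f‖ ≤ C * supDeriv K.1 L f) ∧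
    ∀ f, ‖formC w f‖ ≤ C * ‖jet 0 L f‖ := by
  obtain ⟨C, hC, K, j, hw⟩ := w.exists_bound
  exact ⟨C, hC, K, j, hw, fun f => hw (schwartzToSmooth Ω f), fun f =>
    (hw (schwartzToSmooth Ω f)).trans (mul_le_mul_of_nonneg_left (supDeriv_le_norm_jet _ 0 j f) hC)⟩

/-- The regularization `w * φ_ε`, as a smooth function on `Ω`. -/
def regC (φ : 𝓢(Eu n, ℂ)) (w : DistrC Ω) (ε : Eps) : SmoothOn Ω :=
  ⟨fun x => w (schwartzToSmooth Ω (shiftMoll φ ε x)), by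
    obtain ⟨C, hC, K, L, -, -, h⟩ := exists_bound_formC w
    exact (contDiff_apply_shiftMoll h φ ε).contDiffOn⟩

/-- If `w` is bounded by a seminorm over `K`, its regularization is negligible on compact sets
disjoint from `K`; the class is therefore compactly supported although the net itself need not be.
-/
theorem existsUnique_isEmbC (φ : 𝓢(Eu n, ℂ)) (w : DistrC Ω) : ∃! u, IsEmbC φ w u := by
  obtain ⟨C, hC, K, L, -, h, h'⟩ := exists_bound_formC w
  have hmem : regC φ w ∈ modE (smoothSeminorms Ω) := fun i =>
    exists_isBigO_supDeriv_shiftMoll hC h' φ i.1.2.1 i.2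
  have hsupp : G.supp (GE.mk ⟨_, hmem⟩) ⊆ K.1 :=
    G.supp_subset_of_isRep (GE.isRep_mk hmem) K.2.1.isClosed fun M hM j =>
      isNegl_supDeriv_shiftMoll K.2.1 hC h φ M.2.1 hM j
  refine ⟨⟨GE.mk ⟨_, hmem⟩, K, hsupp⟩, ⟨_, GE.isRep_mk hmem, fun ε x _ => rfl⟩, ?_⟩
  rintro u ⟨a, ha, ha'⟩
  exact Gc.ext' (G.eq_of_eqOn ha (GE.isRep_mk hmem) ha')

theorem isRep_iotaC (φ : 𝓢(Eu n, ℂ)) (w : DistrC Ω) : (iotaC φ w).val.IsRep (regC φ w) := by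
  obtain ⟨C, hC, K, L, -, h, h'⟩ := exists_bound_formC w
  have hmem : regC φ w ∈ modE (smoothSeminorms Ω) := fun i =>
    exists_isBigO_supDeriv_shiftMoll hC h' φ i.1.2.1 i.2
  obtain ⟨a, ha, ha'⟩ : IsEmbC φ w (iotaC φ w) :=
    Classical.epsilon_spec (existsUnique_isEmbC φ w).exists
  rw [G.eq_of_eqOn ha (GE.isRep_mk hmem) ha']
  exact GE.isRep_mk hmem

end

/-! ### Action on slow nets of test functions -/

section

variable {n : ℕ} {Ω V : Opens (Eu n)}

/-- A test function as a Schwartz function. -/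
def testSchwartz (f : 𝓓(Ω, ℂ)) : 𝓢(Eu n, ℂ) := f.hasCompactSupport.toSchwartzMap f.contDiff

theorem exists_norm_jet_testSchwartz_le (K : CompactIn Ω) (k : ℕ) : ∃ C ≥ 0, ∀ f : 𝓓(Ω, ℂ),
    tsupport f ⊆ K.1 → ∀ l, ‖jet k l (testSchwartz f)‖ ≤ C * supDeriv K.1 l f := by
  obtain ⟨R, hR⟩ := K.2.1.isBounded.exists_norm_le
  refine ⟨(1 + |R|) ^ k, by positivity, fun f hf l => ?_⟩
  have h0 := supDeriv_nonneg K.1 l f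
  refine norm_jet_le (by positivity) fun i hi y => ?_
  by_cases hy : y ∈ K.1
  · have h1 : ‖y‖ ≤ |R| := (hR y hy).trans (le_abs_self R)
    gcongr
    exact norm_iteratedFDeriv_le_supDeriv K (testToSmooth f) hi hy
  · have : iteratedFDeriv ℝ i (testSchwartz f) y = 0 :=
      iteratedFDeriv_eq_zero_of_notMem_tsupport (f := f) (fun h => hy (hf h)) i
    rw [this, norm_zero, mul_zero]
    positivity

/-- Nets of test functions supported in `K` for which each derivative costs at most a factor
`ε^(-1/2)`. -/
def IsSlowTest (K : CompactIn Ω) (b : Eps → 𝓓(Ω, ℂ)) : Prop :=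
  (∀ ε, tsupport (b ε) ⊆ K.1) ∧ ∃ N : ℕ, ∀ l : ℕ,
    (fun ε => supDeriv K.1 l (b ε)) =O[toZero] powNet (-((N : ℝ) + l / 2))

theorem IsSlowTest.isSlow {K : CompactIn Ω} {b : Eps → 𝓓(Ω, ℂ)} (hb : IsSlowTest K b) :
    IsSlow fun ε => testSchwartz (b ε) := by
  intro k
  obtain ⟨hK, N, hN⟩ := hb
  obtain ⟨C, hC, h⟩ := exists_norm_jet_testSchwartz_le K k
  refine ⟨N, fun l => IsBigO.trans (IsBigO.of_bound C (Eventually.of_forall fun ε => ?_)) (hN l)⟩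
  rw [norm_norm, Real.norm_of_nonneg (supDeriv_nonneg _ _ _)]
  exact h (b ε) (hK ε) l

theorem isSlowTest_of_regular {K : CompactIn Ω} {b : Eps → 𝓓(Ω, ℂ)} {N : ℕ}
    (hK : ∀ ε, tsupport (b ε) ⊆ K.1)
    (h : ∀ l, (fun ε => supDeriv K.1 l (b ε)) =O[toZero] powNet (-(N : ℝ))) : IsSlowTest K b :=
  ⟨hK, N, fun l => (h l).trans (powNet_isBigO (by
    have : (0 : ℝ) ≤ l / 2 := by positivity
    linarith))⟩

theorem IsSlowTest.exists_gc {K : CompactIn Ω} {b : Eps → 𝓓(Ω, ℂ)} (hb : IsSlowTest K b) :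
    ∃ u : Gc Ω, u.val.IsRep (fun ε => testToSmooth (b ε)) ∧ u.val.supp ⊆ K.1 := by
  obtain ⟨hK, N, hN⟩ := hb
  have hmem : (fun ε => testToSmooth (b ε)) ∈ modE (smoothSeminorms Ω) := by
    rintro ⟨L, j⟩
    refine ⟨N + j, IsBigO.trans (IsBigO.of_bound 1 (Eventually.of_forall fun ε => ?_))
      ((hN j).trans (powNet_isBigO ?_))⟩
    · rw [one_mul, Real.norm_of_nonneg (apply_nonneg _ _),
        Real.norm_of_nonneg (supDeriv_nonneg _ _ _)]
      refine supDeriv_le (supDeriv_nonneg _ _ _) fun i hi x hx => ?_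
      by_cases hxK : x ∈ K.1
      · exact norm_iteratedFDeriv_le_supDeriv K (testToSmooth (b ε)) hi hxK
      · have : iteratedFDeriv ℝ i (testToSmooth (b ε)) x = 0 :=
          iteratedFDeriv_eq_zero_of_notMem_tsupport (f := b ε) (fun h => hxK (hK ε h)) i
        rw [this, norm_zero]
        exact supDeriv_nonneg _ _ _
    · push_cast
      have : (0 : ℝ) ≤ j := by positivity
      linarith
  have hs : G.supp (GE.mk ⟨_, hmem⟩) ⊆ K.1 :=
    G.supp_subset_of_tsupport (GE.isRep_mk hmem) K.2.1.isClosed hK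
  exact ⟨⟨GE.mk ⟨_, hmem⟩, K, hs⟩, GE.isRep_mk hmem, hs⟩

/-- A regular representative stays regular after multiplication by a fixed cutoff: the Leibniz
constants depend on the order but not on `ε`, so the exponent `N` is unchanged. -/
theorem Gc.exists_slowRep {u : Gc Ω} (hu : u ∈ GcInf Ω) : ∃ (K : CompactIn Ω) (b : Eps → 𝓓(Ω, ℂ)),
    IsSlowTest K b ∧ u.val.IsRep fun ε => testToSmooth (b ε) := by
  obtain ⟨a, ha, hreg⟩ := hu
  obtain ⟨χ, hχ, W, hW, hWV, h1⟩ := u.exists_cutoff (fun x hx => hx.1) le_rfl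
  obtain ⟨N, hN⟩ := hreg (suppIn χ χ.tsupport_subset)
  refine ⟨suppIn χ χ.tsupport_subset, fun ε => cut χ χ.tsupport_subset (a ε),
    isSlowTest_of_regular (N := N) (fun ε => tsupport_cut _ _ _) fun l => ?_,
    G.isRep_cut ha χ hW h1⟩
  obtain ⟨C, hC, hb⟩ := exists_bound_cut χ χ.tsupport_subset l
  refine IsBigO.trans (IsBigO.of_bound C (Eventually.of_forall fun ε => ?_)) (hN l)
  rw [Real.norm_of_nonneg (supDeriv_nonneg _ _ _), Real.norm_of_nonneg (apply_nonneg _ _)]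
  exact supDeriv_le (mul_nonneg hC (apply_nonneg _ _)) fun i hi x _ => hb (a ε) i hi x

/-- `T` agrees with the direct functional of `w` on slow nets. -/
def ActsLike (w : Distr Ω) (T : DualGc Ω) : Prop :=
  ∀ (K : CompactIn Ω) (b : Eps → 𝓓(Ω, ℂ)) (u : Gc Ω), IsSlowTest K b →
    u.val.IsRep (fun ε => testToSmooth (b ε)) → (T u).IsRep fun ε => w (b ε)

theorem actsLike_iotaD (w : Distr Ω) : ActsLike w (iotaD w) :=
  fun K b u hb hu => isDirect_iotaD w u K b hb.1 hu

/-- With `ψ = 1` near the common support of the test functions, `ι(w)` may be replaced there by `ψ w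
* φ_ε`. The pairing estimate for `ψ w` applies, and `ψ w` and `w` agree on these test functions. -/
theorem actsLike_iota' {φ : 𝓢(Eu n, ℂ)} (hφ : IsMollifier φ) (w : Distr Ω) :
    ActsLike w (iota' φ w) := by
  intro K b u hb hu
  obtain ⟨ψ, W, hKW, hWΩ, h1⟩ := exists_cutoff_compactIn K
  obtain ⟨L, hL, hKL, hLW⟩ := exists_compact_between K.2.1 W.isOpen hKW
  have hsupp : u.val.supp ⊆ K.1 := G.supp_subset_of_tsupport hu K.2.1.isClosed hb.1
  have h := (isIntegralOn_iota' φ w).restrict hWΩ u (hsupp.trans hKW) _ _ L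
    (isRep_restrict_iota φ w hWΩ h1) hu hL hLW (hsupp.trans hKL)
  refine h.congr ?_
  obtain ⟨C, hC, M, hM⟩ := exists_jet_bound_locForm w ψ
  have key := hφ.isNegl_pairing hM hb.isSlow
  have e1 : ∀ ε, locForm w ψ (testSchwartz (b ε)) = w (b ε) := by
    intro ε
    rw [locForm_apply]
    congr 1
    ext x
    change ψ x * b ε x = b ε x
    by_cases hx : x ∈ K.1
    · rw [h1 x (hKW hx), one_mul]
    · rw [image_eq_zero_of_notMem_tsupport fun h => hx (hb.1 ε h), mul_zero]
  have e2 : ∀ ε, ∫ x in L, locReg φ w ψ W ε x * testToSmooth (b ε) x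
      = ∫ x, locForm w ψ (shiftMoll φ ε x) * testSchwartz (b ε) x := by
    intro ε
    refine setIntegral_eq_integral_of_forall_compl_eq_zero fun x hx => ?_
    have : testToSmooth (b ε) x = 0 :=
      image_eq_zero_of_notMem_tsupport fun h => hx (interior_subset (hKL (hb.1 ε h)))
    rw [this, mul_zero]
  simp only [e2]
  simp only [e1] at key
  exact key.symm

theorem ActsLike.eq_of_mem_gcInf {w : Distr Ω} {S T : DualGc Ω} (hS : ActsLike w S)
    (hT : ActsLike w T) {u : Gc Ω} (hu : u ∈ GcInf Ω) : S u = T u := by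
  obtain ⟨K, b, hb, hub⟩ := Gc.exists_slowRep hu
  exact (hS K b u hb hub).unique (hT K b u hb hub)

/-! ### Compactly supported distributions -/

/-- The argument `b` has no compact support, so it is replaced by `χ b` with `χ = 1` near the
compact set carrying the bound on `w`. This does not change the value of `w`, and it changes the
integral only where `ι(w)` is negligible. -/
theorem iotaDC_eq_iotaC' {φ : 𝓢(Eu n, ℂ)} (hφ : IsMollifier φ) (w : DistrC Ω) {u : G Ω}
    (hu : u ∈ GInf Ω) : iotaDC w u = iotaC' φ w u := by
  obtain ⟨b, hb, hreg⟩ := hu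
  obtain ⟨C, hC, K, M, hw, hwK, hwJ⟩ := exists_bound_formC w
  obtain ⟨χ, W, hKW, hWΩ, h1⟩ := exists_cutoff_compactIn K
  have hsupp : (iotaC φ w).val.supp ⊆ K.1 := G.supp_subset_of_isRep (isRep_iotaC φ w)
    K.2.1.isClosed fun L hL j => isNegl_supDeriv_shiftMoll K.2.1 hC hwK φ L.2.1 hL j
  set L : CompactIn Ω := suppIn χ χ.tsupport_subset with hL
  set c : Eps → 𝓓(Ω, ℂ) := fun ε => cut χ χ.tsupport_subset (b ε) with hc
  have hd := isDirectC_iotaDC w u b hb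
  have hi : (iotaC' φ w u).IsRep fun ε => ∫ x in L.1, regC φ w ε x * b ε x :=
    isIntegralC_toDual (iotaC φ w) u _ b L.1 (isRep_iotaC φ w) hb
      L.2.1 L.2.2 (hsupp.trans (hKW.trans (subset_interior_tsupport h1)))
  refine (hd.eq_iff hi).2 ?_
  have hslow : IsSlowTest L c := by
    obtain ⟨N, hN⟩ := hreg L
    refine isSlowTest_of_regular (N := N) (fun ε => tsupport_cut _ _ _) fun l => ?_
    obtain ⟨D, hD, hb⟩ := exists_bound_cut χ χ.tsupport_subset l
    refine IsBigO.trans (IsBigO.of_bound D (Eventually.of_forall fun ε => ?_)) (hN l)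
    rw [Real.norm_of_nonneg (supDeriv_nonneg _ _ _), Real.norm_of_nonneg (apply_nonneg _ _)]
    exact supDeriv_le (mul_nonneg hD (apply_nonneg _ _)) fun i hi x _ => hb (b ε) i hi x
  have key := hφ.isNegl_pairing hwJ hslow.isSlow
  have e1 : ∀ ε, formC w (testSchwartz (c ε)) = w (b ε) := by
    intro ε
    change w (schwartzToSmooth Ω (testSchwartz (c ε))) = w (b ε)
    -- The seminorm bounding `w` sees only derivatives at points of `K`, and `χ b - b` vanishes on a
    -- neighbourhood of `K`.
    rw [← sub_eq_zero, ← map_sub, ← norm_le_zero_iff]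
    refine (hw _).trans (le_of_eq ?_)
    rw [supDeriv_congr (g := fun _ => 0) W.isOpen hKW fun x hx => ?_]
    · simp [supDeriv]
    · change χ x * b ε x - b ε x = 0
      rw [h1 x hx, one_mul, sub_self]
  have e2 : ∀ ε, ∫ x, formC w (shiftMoll φ ε x) * testSchwartz (c ε) x
      = ∫ x in L.1, regC φ w ε x * testToSmooth (c ε) x := by
    intro ε
    refine (setIntegral_eq_integral_of_forall_compl_eq_zero fun x hx => ?_).symm
    have : testSchwartz (c ε) x = 0 :=
      image_eq_zero_of_notMem_tsupport fun h => hx (tsupport_cut χ χ.tsupport_subset (b ε) h)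
    rw [this, mul_zero]
  simp only [e1, e2] at key
  refine key.trans ?_
  -- This is the whole difference of the integrals with `χ b` and with `b`: on `W` the integrands
  -- coincide, and `L \ W` is a compact set disjoint from `supp ι(w)`.
  have hneg : IsNegl fun ε => ∫ x in L.1 \ W, regC φ w ε x * b ε x * (χ x - 1) := by
    let P : CompactIn Ω := ⟨L.1 \ W, L.2.1.diff W.isOpen, Set.sdiff_subset.trans L.2.2⟩
    obtain ⟨N, hN⟩ := G.exists_mod hb P 0
    obtain ⟨B, hB⟩ := P.2.1.exists_bound_of_continuousOn
      ((χ.contDiff.continuous.sub continuous_const).continuousOn (f := fun x => χ x - 1))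
    have h2 := isNegl_mul_of_mod hN (G.isNegl_of_disjoint_supp (isRep_iotaC φ w) P
      (Set.disjoint_left.2 fun x hx hx' => hx.2 (hKW (hsupp hx'))) 0)
    refine isNegl_setIntegral P.2.1.measure_lt_top
      (h2.of_le |B| (Eventually.of_forall fun ε => ?_) :
        IsNegl fun ε => |B| * (supDeriv P.1 0 (b ε) * supDeriv P.1 0 (regC φ w ε))) fun ε x hx => ?_
    · rw [norm_mul, Real.norm_of_nonneg (abs_nonneg B)]
    · have h3 := norm_le_supDeriv P (b ε) 0 hx
      have h4 := norm_le_supDeriv P (regC φ w ε) 0 hx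
      have h5 := (hB x hx).trans (le_abs_self B)
      have h6 := supDeriv_nonneg P.1 0 (b ε)
      have h7 := supDeriv_nonneg P.1 0 (regC φ w ε)
      rw [norm_mul, norm_mul]
      calc _ ≤ supDeriv P.1 0 (regC φ w ε) * supDeriv P.1 0 (b ε) * |B| := by gcongr
        _ = _ := by ring
  refine hneg.of_le 1 (Eventually.of_forall fun ε => ?_)
  rw [one_mul]
  refine le_of_eq (congrArg _ ?_)
  rw [← integral_sub (integrableOn_mul L L.2.2 _ _) (integrableOn_mul L L.2.2 _ _)]
  have h_int : IntegrableOn (fun x => regC φ w ε x * testToSmooth (c ε) x - regC φ w ε x * b ε x) L.1 :=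
    (integrableOn_mul L L.2.2 _ _).sub (integrableOn_mul L L.2.2 _ _)
  refine (integral_inter_add_sdiff W.isOpen.measurableSet h_int).symm.trans ?_
  rw [setIntegral_eq_zero_of_forall_eq_zero (t := L.1 ∩ W), zero_add]
  · refine integral_congr_ae (Eventually.of_forall fun x => ?_)
    change regC φ w ε x * (χ x * b ε x) - regC φ w ε x * b ε x = regC φ w ε x * b ε x * (χ x - 1)
    ring
  · intro x hx
    change regC φ w ε x * (χ x * b ε x) - regC φ w ε x * b ε x = 0
    rw [h1 x hx.2, one_mul, sub_self]

/-! ### Supports -/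

/-- Near a point outside `supp w` choose `θ` equal to `1` on `U` and supported where `w` vanishes.
Then `θ w = 0`, so `ψ w = (ψ - θ) w` is cut off away from `U`, and its regularization is negligible
on `U`. -/
theorem supp_iota_subset (φ : 𝓢(Eu n, ℂ)) (w : Distr Ω) : (iota φ w).supp ⊆ distrSupp w := by
  intro x hx
  refine ⟨hx.1, ?_⟩
  by_contra hxs
  obtain ⟨s, hs, hso, hxs⟩ := (Distribution.notMem_dsupport_iff x).1 hxs
  obtain ⟨ψ, W, hxW, hWΩ, hψ⟩ := exists_cutoff_compactIn
    (⟨{x}, isCompact_singleton, Set.singleton_subset_iff.2 hx.1⟩ : CompactIn Ω)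
  obtain ⟨θ, hθs, U, hxU, hUW, hθ⟩ := exists_cutoff (Ω := Ω) (K := {x}) isCompact_singleton
    (hso.inter W.isOpen) (Set.inter_subset_right.trans hWΩ)
    (Set.singleton_subset_iff.2 ⟨hxs, hxW rfl⟩)
  have hU1 : ∀ y ∈ U, ψ y = 1 := fun y hy => hψ y (hUW hy).2
  have hUΩ : U ≤ Ω := fun y hy => hWΩ (hUW hy).2
  refine hx.2 U hUΩ (hxU rfl) ((isRep_restrict_iota φ w hUΩ hU1).eq_zero_iff.2 fun i => ?_)
  have he : ∀ ε, locReg φ w ψ U ε = locReg φ w (ψ - θ) U ε := by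
    intro ε
    refine Subtype.ext (funext fun y => ?_)
    rw [locReg_sub, locReg_apply φ w θ, hs, sub_zero]
    exact tsupport_mul_subset_left.trans (hθs.trans Set.inter_subset_left)
  simp only [he]
  refine isNegl_locReg φ w (ψ - θ) U i.1.2.1
    (disjoint_tsupport_of_eqOn_zero U.isOpen i.1.2.2 fun y hy => ?_) i.2
  change ψ y - θ y = 0
  rw [hU1 y hy, hθ y hy, sub_self]

theorem dualSupp_subset_of_isIntegralOn {v : G Ω} {T : DualGc Ω} (hT : IsIntegralOn v T) :
    dualSupp T ⊆ v.supp := by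
  refine fun x hx => ⟨hx.1, fun V h hxV h0 => hx.2 V h hxV fun u hu => ?_⟩
  have hR := hT.restrict h
  rw [h0] at hR
  obtain ⟨K, b, -, hK, hb⟩ := u.exists_testRep hu h
  have h1 := hR u hu _ _ K.1 GE.isRep_zero hb K.2.1 K.2.2 hK
  refine h1.unique ?_
  convert GenNumber.isRep_zero with ε
  refine (integral_congr_ae (Eventually.of_forall fun x => ?_)).trans (integral_zero _ _)
  exact zero_mul _

theorem dualSupp_iotaD_subset (w : Distr Ω) : dualSupp (iotaD w) ⊆ distrSupp w := by
  refine fun x hx => ⟨hx.1, ?_⟩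
  by_contra hxs
  obtain ⟨s, hs, hso, hxs⟩ := (Distribution.notMem_dsupport_iff x).1 hxs
  let V : Opens (Eu n) := ⟨s ∩ Ω, hso.inter Ω.isOpen⟩
  have hVΩ : V ≤ Ω := fun y hy => hy.2
  refine hx.2 V hVΩ ⟨hxs, hx.1⟩ fun u hu => ?_
  obtain ⟨K, b, hbK, -, hb⟩ := u.exists_testRep hu hVΩ
  have h1 := isDirect_iotaD w u (K.incl hVΩ) b hbK hb
  refine h1.unique ?_
  convert GenNumber.isRep_zero with ε
  exact hs (b ε) ((hbK ε).trans (K.2.2.trans Set.inter_subset_left))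

/-- A constant net of test functions is slow, so `T` evaluates it to the class of the constant `w
f`. This class is zero only if `w f = 0`. -/
theorem ActsLike.distrSupp_subset {w : Distr Ω} {T : DualGc Ω} (hT : ActsLike w T) :
    distrSupp w ⊆ dualSupp T := by
  refine fun x hx => ⟨hx.1, fun V hV hxV h0 => ?_⟩
  refine (Distribution.notMem_dsupport_iff x).2 ⟨V, fun f hf => ?_, V.isOpen, hxV⟩ hx.2
  have hslow : IsSlowTest (suppIn f f.tsupport_subset) fun _ => f :=
    isSlowTest_of_regular (N := 0) (fun _ => le_rfl) fun l =>
      IsBigO.of_bound (supDeriv (tsupport f) l f) (Eventually.of_forall fun ε => by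
        rw [norm_powNet, Nat.cast_zero, neg_zero, powNet_zero, mul_one,
          Real.norm_of_nonneg (supDeriv_nonneg _ _ _)]
        rfl)
  obtain ⟨u, hu, hus⟩ := hslow.exists_gc
  have h1 := hT _ _ u hslow hu
  exact norm_eq_zero.1 (isNegl_const.1 (h1.eq_zero_iff.1 (h0 u (hus.trans hf))))

/-! ### Singular supports: the elementary inclusions -/

theorem dualSingSupp_subset_of_isIntegralOn {v : G Ω} {T : DualGc Ω} (hT : IsIntegralOn v T) :
    dualSingSupp T ⊆ v.singSupp :=
  fun _ hx => ⟨hx.1, fun V h hxV hv => hx.2 V h hxV ⟨_, hv, hT.restrict h⟩⟩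

theorem exists_isRep_const (g : SmoothOn V) : ∃ v ∈ GInf V, v.IsRep fun _ => g := by
  have hb : ∀ i, (fun _ : Eps => smoothSeminorms V i g) =O[toZero] powNet (-((0 : ℕ) : ℝ)) :=
    fun i => IsBigO.of_bound (smoothSeminorms V i g) (Eventually.of_forall fun ε => by
      rw [norm_powNet, Nat.cast_zero, neg_zero, powNet_zero, mul_one,
        Real.norm_of_nonneg (apply_nonneg _ _)])
  have hmem : (fun _ : Eps => g) ∈ modE (smoothSeminorms V) := fun i => ⟨0, hb i⟩
  exact ⟨GE.mk ⟨_, hmem⟩, ⟨_, GE.isRep_mk hmem, fun K => ⟨0, fun j => hb (K, j)⟩⟩, GE.isRep_mk hmem⟩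

/-- Where `w` is a smooth function `g`, the direct functional is integration against the constant
net `g`, which is regular. -/
theorem dualSingSupp_iotaD_subset (w : Distr Ω) : dualSingSupp (iotaD w) ⊆ distrSingSupp w := by
  refine fun x hx => ⟨hx.1, fun V h hxV ⟨g, hg⟩ => hx.2 V h hxV ?_⟩
  obtain ⟨v, hv, hvg⟩ := exists_isRep_const g
  refine ⟨v, hv, fun u hu a b K ha hb hK hKV huK => ?_⟩
  obtain ⟨L, c, hcL, hL, hc⟩ := u.exists_testRep hu h
  refine (isDirect_iotaD w u (L.incl h) c hcL hc).congr ?_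
  have key := isNegl_setIntegral_sub h hvg ha hc hb L ⟨K, hK, hKV⟩ hL huK
  have e : ∀ ε, w (c ε) = ∫ x in L.1, g x * testToSmooth (c ε) x := by
    intro ε
    rw [hg (c ε) ((hcL ε).trans L.2.2)]
    refine (setIntegral_eq_integral_of_forall_compl_eq_zero fun x hx => ?_).symm
    have : c ε x = 0 := image_eq_zero_of_notMem_tsupport fun h => hx (hcL ε h)
    rw [this, mul_zero]
  simpa only [e] using key

end

/-! ### Regularization of smooth functions -/

section

variable {n : ℕ} {Ω V : Opens (Eu n)}

theorem integral_shiftMoll_mul (φ : 𝓢(Eu n, ℂ)) (ε : Eps) (x : Eu n) (g : Eu n → ℂ) :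
    ∫ y, g y * shiftMoll φ ε x y = ∫ z, φ z * g (x - (ε : ℝ) • z) := by
  have h := integral_shiftMoll_zero_mul φ ε (-x) fun y => g (-y)
  rw [← integral_neg_eq_self]
  refine Eq.trans (integral_congr_ae (Eventually.of_forall fun y => ?_))
    (h.trans (integral_congr_ae (Eventually.of_forall fun z => ?_)))
  · change g (-y) * shiftMoll φ ε x (-y) = shiftMoll φ ε 0 (-x - y) * g (-y)
    rw [shiftMoll_apply, shiftMoll_apply, mul_comm]
    congr 4
    abel
  · change φ z * g (-(-x + (ε : ℝ) • z)) = φ z * g (x - (ε : ℝ) • z)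
    congr 2
    abel

/-- Integration against a Schwartz function. -/
def schwartzForm (h : 𝓢(Eu n, ℂ)) : 𝓢(Eu n, ℂ) →ₗ[ℂ] ℂ := temperateForm h.hasTemperateGrowth

theorem schwartzForm_apply (h f : 𝓢(Eu n, ℂ)) : schwartzForm h f = ∫ x, h x * f x := rfl

theorem norm_schwartzForm_le (h f : 𝓢(Eu n, ℂ)) :
    ‖schwartzForm h f‖ ≤ (∫ x, ‖h x‖) * ‖jet 0 0 f‖ := by
  rw [schwartzForm_apply]
  refine (norm_integral_le_of_norm_le (h.integrable.norm.mul_const ‖jet 0 0 f‖)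
    (Eventually.of_forall fun x => ?_)).trans (le_of_eq (integral_mul_const _ _))
  rw [norm_mul]
  gcongr
  simpa using le_norm_jet (k := 0) (le_refl 0) f x

theorem schwartzForm_translate_iteratedLineDerivOp {j : ℕ} (m : Fin j → Eu n) (φ h : 𝓢(Eu n, ℂ))
    (ε : Eps) (x : Eu n) :
    schwartzForm h (translate x (∂^{m} (shiftMoll φ ε 0)))
      = (-1) ^ j * ∫ z, φ z * (∂^{m} h : 𝓢(Eu n, ℂ)) (x - (ε : ℝ) • z) := by
  rw [← iteratedLineDerivOp_translate, schwartzForm_apply, integral_mul_iteratedLineDerivOp,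
    ← shiftMoll_eq_translate, integral_shiftMoll_mul]

/-- All derivatives are moved from the mollifier to `h`, and `φ_ε` has an `L¹` norm independent of
`ε`. The bound is thus uniform in `ε`, as regularity with exponent `0` requires. -/
theorem norm_iteratedFDeriv_schwartzForm_le (φ h : 𝓢(Eu n, ℂ)) (ε : Eps) (j : ℕ) (x : Eu n) :
    ‖iteratedFDeriv ℝ j (fun x => schwartzForm h (shiftMoll φ ε x)) x‖
      ≤ (∫ z, ‖φ z‖) * ‖jet 0 j h‖ := by
  obtain ⟨f₀, hf₀, hf₁⟩ := exists_shiftMoll_eq_translate φ ε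
  have h0 : 0 ≤ ∫ z, ‖φ z‖ := integral_nonneg fun z => norm_nonneg _
  simp only [hf₁]
  refine norm_iteratedFDeriv_apply_translate_le (norm_schwartzForm_le h) f₀ j x (by positivity)
    fun m => ?_
  rw [hf₀, schwartzForm_translate_iteratedLineDerivOp, norm_mul, norm_pow, norm_neg, norm_one,
    one_pow, one_mul]
  refine (norm_integral_le_of_norm_le (φ.integrable.norm.mul_const (‖jet 0 j h‖ * ∏ i, ‖m i‖))
    (Eventually.of_forall fun z => ?_)).trans (le_of_eq ?_)
  · rw [norm_mul]
    gcongr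
    have h1 := le_norm_jet (k := 0) (le_refl 0) (∂^{m} h) (x - (ε : ℝ) • z)
    rw [pow_zero, one_mul, norm_iteratedFDeriv_zero] at h1
    refine h1.trans ((norm_jet_iteratedLineDerivOp_le 0 0 m h).trans (le_of_eq ?_))
    rw [zero_add]
  · rw [integral_mul_const, mul_assoc]

/-- If `w = g` on `V`, then `θ w` is integration against the test function `θ g`, whose
regularizations have derivatives bounded uniformly in `ε`. -/
theorem singSupp_iota_subset (φ : 𝓢(Eu n, ℂ)) (w : Distr Ω) :
    (iota φ w).singSupp ⊆ distrSingSupp w := by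
  refine fun x hx => ⟨hx.1, fun V h hxV ⟨g, hg⟩ => ?_⟩
  obtain ⟨θ, hθV, U, hxU, hUV, hθ⟩ := exists_cutoff (Ω := Ω) (K := {x}) isCompact_singleton
    V.isOpen h (Set.singleton_subset_iff.2 hxV)
  have hUΩ : U ≤ Ω := fun y hy => h (hUV hy)
  refine hx.2 U hUΩ (hxU rfl) ⟨_, isRep_restrict_iota φ w hUΩ hθ, fun K => ⟨0, fun j => ?_⟩⟩
  set k : 𝓢(Eu n, ℂ) := testSchwartz (cut θ hθV g) with hk
  have he : ∀ ε, (locReg φ w θ U ε : Eu n → ℂ) = fun x => schwartzForm k (shiftMoll φ ε x) := by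
    intro ε
    funext y
    rw [locReg_apply, hg _ (tsupport_mul_subset_left.trans hθV), schwartzForm_apply]
    refine integral_congr_ae (Eventually.of_forall fun z => ?_)
    change g z * (θ z * shiftMoll φ ε y z) = θ z * g z * shiftMoll φ ε y z
    ring
  have h0 : 0 ≤ ∫ z, ‖φ z‖ := integral_nonneg fun z => norm_nonneg _
  refine IsBigO.of_bound ((∫ z, ‖φ z‖) * ‖jet 0 j k‖) (Eventually.of_forall fun ε => ?_)
  rw [norm_powNet, Nat.cast_zero, neg_zero, powNet_zero, mul_one,
    Real.norm_of_nonneg (apply_nonneg _ _), smoothSeminorms_apply, he]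
  refine supDeriv_le (by positivity) fun i hi y _ => ?_
  refine (norm_iteratedFDeriv_schwartzForm_le φ k ε i y).trans ?_
  gcongr
  exact norm_jet_mono le_rfl hi k

/-! ### Approximation by mollification, reflected -/

theorem norm_jet_reflect_le (k L : ℕ) (g : 𝓢(Eu n, ℂ)) : ‖jet k L (reflect 0 g)‖ ≤ ‖jet k L g‖ := by
  refine norm_jet_le (norm_nonneg _) fun l hl y => ?_
  have h : (reflect 0 g : Eu n → ℂ) = g ∘ LinearIsometryEquiv.neg ℝ := by
    funext x
    rw [reflect_apply, zero_sub]
    rfl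
  have h1 := le_norm_jet (k := k) hl g (-y)
  rw [norm_neg] at h1
  rw [h, LinearIsometryEquiv.norm_iteratedFDeriv_comp_right]
  exact h1

theorem IsMollifier.norm_sub_integral_reflect_le {φ : 𝓢(Eu n, ℂ)} (hφ : IsMollifier φ) (q : ℕ)
    (g : 𝓢(Eu n, ℂ)) (ε : Eps) (x : Eu n) :
    ‖g x - ∫ z, φ z * g (x - (ε : ℝ) • z)‖
      ≤ (∫ z, (1 + ‖z‖) ^ (0 + q + 1) * ‖φ z‖) * ‖jet 0 (q + 1) g‖ * (ε : ℝ) ^ (q + 1) := by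
  have hε := ε.2.1
  have h := hφ.norm_sub_integral_le 0 q (reflect 0 g) ε (-x)
  simp only [reflect_apply, zero_sub, neg_neg, neg_add, pow_zero, one_mul] at h
  have h0 : 0 ≤ ∫ z, (1 + ‖z‖) ^ (0 + q + 1) * ‖φ z‖ := integral_nonneg fun z => by positivity
  simp only [sub_eq_add_neg]
  refine h.trans ?_
  gcongr
  exact norm_jet_reflect_le 0 (q + 1) g

/-! ### Limits of rapidly convergent nets -/

/-- Pointwise negligibility along all selections is uniform. -/
theorem eventually_forall_le_of_isNegl {X : Type*} [Nonempty X] {P : Eps → X → ℝ}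
    (h : ∀ x : Eps → X, IsNegl fun ε => P ε (x ε)) (q : ℕ) :
    ∀ᶠ ε in toZero, ∀ x, P ε x ≤ (ε : ℝ) ^ q := by
  classical
  -- The selection picks a point violating the bound whenever there is one; negligibility along it
  -- forbids violations for small `ε`.
  let x : Eps → X := fun ε => if hx : ∃ x, (ε : ℝ) ^ q < P ε x then hx.choose else Classical.arbitrary X
  -- One order more than needed: the spare factor `ε` beats the constant `C` as soon as `ε < C⁻¹`.
  obtain ⟨C, hC, hb⟩ := (h x (q + 1)).exists_pos
  filter_upwards [hb.bound, eventually_toZero_lt (inv_pos.2 hC)] with ε hε hεC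
  by_contra! hx
  have hε0 := ε.2.1
  have h1 : (ε : ℝ) ^ q < P ε (x ε) := by
    have : x ε = hx.choose := dif_pos hx
    rw [this]
    exact hx.choose_spec
  rw [norm_powNet, powNet_natCast, pow_succ] at hε
  have h2 : C * ((ε : ℝ) ^ q * ε) ≤ (ε : ℝ) ^ q := by
    have h3 : C * ε ≤ 1 := by
      have := mul_le_mul_of_nonneg_left hεC.le hC.le
      rwa [mul_inv_cancel₀ hC.ne'] at this
    calc C * ((ε : ℝ) ^ q * ε) = (ε : ℝ) ^ q * (C * ε) := by ring
      _ ≤ (ε : ℝ) ^ q * 1 := by gcongr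
      _ = _ := mul_one _
  linarith [(Real.le_norm_self _).trans hε]

/-- Squaring on `(0,1]`. -/
def Eps.sq (ε : Eps) : Eps := ⟨(ε : ℝ) ^ 2, pow_pos ε.2.1 2, pow_le_one₀ ε.2.1.le ε.2.2⟩

theorem Eps.coe_sq (ε : Eps) : (Eps.sq ε : ℝ) = (ε : ℝ) ^ 2 := rfl

/-- The square root on `(0,1]`. -/
def Eps.sqrt (ε : Eps) : Eps :=
  ⟨Real.sqrt ε, Real.sqrt_pos.2 ε.2.1, Real.sqrt_le_one.2 ε.2.2⟩

theorem Eps.sqrt_sq (ε : Eps) : Eps.sqrt (Eps.sq ε) = ε := Subtype.ext (Real.sqrt_sq ε.2.1.le)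

theorem Eps.sq_sqrt (ε : Eps) : (Eps.sqrt ε : ℝ) ^ 2 = ε := Real.sq_sqrt ε.2.1.le

/-- Along `η_(i+1) = η_i²` the scales decay at least geometrically, so the telescoping series of
`F(η_(i+1)) - F(η_i)` converges with all derivatives. Weak convergence of `F(η_i)` to the sum
follows by dominated convergence. -/
theorem exists_smooth_limit {F : Eps → Eu n → ℂ} (hF : ∀ ε, ContDiff ℝ ∞ (F ε))
    (h : ∀ j : ℕ, ∀ᶠ ε in toZero, ∀ x,
      ‖iteratedFDeriv ℝ j (fun x => F (Eps.sq ε) x - F ε x) x‖ ≤ ε) :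
    ∃ g : Eu n → ℂ, ContDiff ℝ ∞ g ∧ ∃ η : ℕ → Eps, Tendsto η atTop toZero ∧
      ∀ f : Eu n → ℂ, Continuous f → HasCompactSupport f →
        Tendsto (fun i => ∫ x, F (η i) x * f x) atTop (𝓝 (∫ x, g x * f x)) := by
  obtain ⟨δ, hδ, h0⟩ := eventually_toZero_iff.1 (h 0)
  -- Below `δ` the order-zero bound holds from the first index on, as domination requires; starting
  -- at most at `1/2` gives `η_i ≤ 2^(-i)`. For higher derivatives a bound from some index on is
  -- enough.
  let η₀ : Eps := ⟨min (δ / 2) (1 / 2), by positivity, (min_le_right _ _).trans (by norm_num)⟩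
  let η : ℕ → Eps := fun i => Eps.sq^[i] η₀
  have hsucc : ∀ i, η (i + 1) = Eps.sq (η i) := fun i => Function.iterate_succ_apply' _ _ _
  have hle : ∀ i, (η i : ℝ) ≤ (1 / 2) ^ i ∧ (η i : ℝ) ≤ (η₀ : ℝ) := by
    intro i
    induction i with
    | zero => exact ⟨by rw [pow_zero]; exact η₀.2.2, le_rfl⟩
    | succ i ih =>
      have hp := (η i).2.1
      have h2 : (η₀ : ℝ) ≤ 1 / 2 := min_le_right _ _
      rw [hsucc, Eps.coe_sq, _root_.sq]
      constructor
      · calc (η i : ℝ) * η i ≤ (1 / 2) ^ i * (1 / 2) :=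
              mul_le_mul ih.1 (ih.2.trans h2) hp.le (by positivity)
          _ = _ := (pow_succ _ _).symm
      · calc (η i : ℝ) * η i ≤ η₀ * 1 := mul_le_mul ih.2 (η i).2.2 hp.le η₀.2.1.le
          _ = _ := mul_one _
  have hη : Tendsto η atTop toZero := by
    refine tendsto_comap_iff.2 (squeeze_zero (fun i => (η i).2.1.le) (fun i => (hle i).1) ?_)
    exact tendsto_pow_atTop_nhds_zero_of_lt_one (by norm_num) (by norm_num)
  let d : ℕ → Eu n → ℂ := fun i x => F (η (i + 1)) x - F (η i) x
  have hd : ∀ i, ContDiff ℝ ∞ (d i) := fun i => (hF _).sub (hF _)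
  have hsum : Summable fun i : ℕ => ((1 : ℝ) / 2) ^ i := summable_geometric_two
  have hd0 : ∀ i x, ‖d i x‖ ≤ (1 / 2) ^ i := by
    intro i x
    have h1 := h0 (η i) (lt_of_le_of_lt ((hle i).2.trans (min_le_left _ _)) (by linarith)) x
    rw [norm_iteratedFDeriv_zero] at h1
    change ‖F (η (i + 1)) x - F (η i) x‖ ≤ _
    rw [hsucc]
    exact h1.trans (hle i).1
  have hg : ContDiff ℝ ∞ fun x => ∑' i, d i x := by
    refine contDiff_tsum_of_eventually (v := fun _ i => ((1 : ℝ) / 2) ^ i)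
      (fun i => hd i) (fun _ _ => hsum) fun j _ => ?_
    rw [Nat.cofinite_eq_atTop]
    filter_upwards [hη.eventually (h j)] with i hi x
    have := hi x
    rw [← hsucc] at this
    exact this.trans (hle i).1
  refine ⟨fun x => F η₀ x + ∑' i, d i x, (hF _).add hg, η, hη, fun f hf hfc => ?_⟩
  have htel : ∀ N x, F (η N) x = F η₀ x + ∑ i ∈ Finset.range N, d i x := by
    intro N x
    rw [Finset.sum_range_sub (fun i => F (η i) x)]
    change _ = F η₀ x + (F (η N) x - F η₀ x)
    ring
  refine tendsto_integral_of_dominated_convergence (fun x => (‖F η₀ x‖ + 2) * ‖f x‖)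
    (fun N => ((hF _).continuous.mul hf).aestronglyMeasurable) ?_ (fun N => ?_) ?_
  · refine Continuous.integrable_of_hasCompactSupport
      (((hF _).continuous.norm.add continuous_const).mul hf.norm) hfc.norm.mul_left
  · refine Eventually.of_forall fun x => ?_
    rw [norm_mul, htel]
    gcongr
    refine (norm_add_le _ _).trans ?_
    gcongr
    refine (norm_sum_le_of_le _ fun i _ => hd0 i x).trans ?_
    exact (hsum.sum_le_tsum _ fun i _ => by positivity).trans tsum_geometric_two.le
  · refine Eventually.of_forall fun x => ?_
    refine Tendsto.mul_const _ ?_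
    simp only [htel]
    refine tendsto_const_nhds.add (HasSum.tendsto_sum_nat ?_)
    exact (Summable.of_norm_bounded hsum fun i => hd0 i x).hasSum

end

/-! ### Regularity of a distribution that acts like a regular generalized function -/

section

variable {n : ℕ} {Ω V : Opens (Eu n)} {w : Distr Ω} {T : DualGc Ω} {v : G V} {a : Eps → SmoothOn V}
  {θ : 𝓓(Ω, ℂ)}

/-- The net `θ f_ε` is slow and supported in a compact subset of `V`. So `T` can be computed on it
both by applying `w` and by integrating against `a_ε`. -/
theorem ActsLike.isNegl_sub (hT : ActsLike w T) (hTv : IsIntegralOn v T)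
    (ha : v.IsRep a) (hθ : tsupport θ ⊆ V) {f : Eps → 𝓢(Eu n, ℂ)} {N : ℕ}
    (hf : ∀ l : ℕ, (fun ε => ‖jet 0 l (f ε)‖) =O[toZero] powNet (-((N : ℝ) + l / 2))) :
    IsNegl fun ε => locForm w θ (f ε) - schwartzForm (testSchwartz (cut θ hθ (a ε))) (f ε) := by
  set K : CompactIn Ω := suppIn θ θ.tsupport_subset with hK
  have hslow : IsSlowTest K fun ε => testMul θ (f ε) := by
    refine ⟨fun ε => tsupport_mul_subset_left, N, fun l => ?_⟩
    obtain ⟨C, hC, hb⟩ := exists_bound_cut θ θ.tsupport_subset l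
    refine IsBigO.trans (IsBigO.of_bound C (Eventually.of_forall fun ε => ?_)) (hf l)
    rw [Real.norm_of_nonneg (supDeriv_nonneg _ _ _), norm_norm]
    refine supDeriv_le (by positivity) fun i hi x _ => ?_
    refine (hb (schwartzToSmooth Ω (f ε)) i hi x).trans ?_
    gcongr
    exact supDeriv_le_norm_jet _ 0 l (f ε)
  obtain ⟨u, hu, hus⟩ := hslow.exists_gc
  obtain ⟨L, hL, hKL, hLV⟩ := exists_compact_between K.2.1 V.isOpen hθ
  have h1 := hT K _ u hslow hu
  have h2 := hTv u (hus.trans hθ) a _ L ha hu hL hLV (hus.trans hKL)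
  have h3 := (h1.eq_iff h2).1 rfl
  have e : ∀ ε, ∫ x in L, a ε x * testToSmooth (testMul θ (f ε)) x
      = schwartzForm (testSchwartz (cut θ hθ (a ε))) (f ε) := by
    intro ε
    rw [setIntegral_eq_integral_of_forall_compl_eq_zero, schwartzForm_apply]
    · refine integral_congr_ae (Eventually.of_forall fun x => ?_)
      change a ε x * (θ x * f ε x) = θ x * a ε x * f ε x
      ring
    · intro x hx
      change a ε x * (θ x * f ε x) = 0
      rw [image_eq_zero_of_notMem_tsupport fun h => hx (interior_subset (hKL h)), zero_mul, mul_zero]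
  simp only [e] at h3
  exact h3

theorem isBigO_jet_cut (hθ : tsupport θ ⊆ V) {N : ℕ}
    (hreg : ∀ j, (fun ε => supDeriv (tsupport θ) j (a ε)) =O[toZero] powNet (-(N : ℝ))) (l : ℕ) :
    (fun ε => ‖jet 0 l (testSchwartz (cut θ hθ (a ε)))‖) =O[toZero] powNet (-(N : ℝ)) := by
  obtain ⟨C, hC, hb⟩ := exists_norm_jet_testSchwartz_le (suppIn θ θ.tsupport_subset) 0
  obtain ⟨D, hD, hd⟩ := exists_bound_cut θ hθ l
  refine IsBigO.trans (IsBigO.of_bound (C * D) (Eventually.of_forall fun ε => ?_)) (hreg l)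
  rw [norm_norm, Real.norm_of_nonneg (supDeriv_nonneg _ _ _), mul_assoc]
  refine (hb _ (tsupport_cut _ _ _) l).trans (mul_le_mul_of_nonneg_left ?_ hC)
  exact supDeriv_le (mul_nonneg hD (supDeriv_nonneg _ _ _)) fun i hi x _ => hd (a ε) i hi x

/-- An inequality rather than an equality, because the product may be zero and then its inverse is
`0`. -/
theorem inv_mul_prod_norm_le_one {j : ℕ} (m : Fin j → Eu n) : (∏ i, ‖m i‖)⁻¹ * ∏ i, ‖m i‖ ≤ 1 :=
  inv_mul_le_one

/-- Each derivative of `φ_η` costs `η⁻¹ ≤ ε^(-1/2)`, so these nets satisfy the slow growth condition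
for the weight `k = 0`. With this weight the translations `x ε` cost nothing and may be arbitrary;
normalizing by the norms of `m` makes the directions arbitrary too. -/
theorem isBigO_jet_translate_shiftMoll (φ : 𝓢(Eu n, ℂ)) {η : Eps → Eps}
    (h1 : ∀ ε, (Eps.sqrt ε : ℝ) ≤ η ε) {j : ℕ} (x : Eps → Eu n) (m : Eps → Fin j → Eu n) (l : ℕ) :
    (fun ε => ‖jet 0 l ((((∏ i, ‖m ε i‖)⁻¹ : ℝ) : ℂ) •
      translate (x ε) (∂^{m ε} (shiftMoll φ (η ε) 0)))‖)
      =O[toZero] powNet (-(((n + j : ℕ) : ℝ) + l / 2)) := by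
  refine IsBigO.of_bound ‖jet 0 (l + j) φ‖ (Eventually.of_forall fun ε => ?_)
  have hs := (Eps.sqrt ε).2.1
  have hp : 0 ≤ ∏ i, ‖m ε i‖ := Finset.prod_nonneg fun i _ => norm_nonneg _
  rw [norm_norm, norm_powNet, map_smul, norm_smul, Complex.norm_real,
    Real.norm_of_nonneg (inv_nonneg.2 hp)]
  have h2 : ‖jet 0 l (translate (x ε) (∂^{m ε} (shiftMoll φ (η ε) 0)))‖
      ≤ ‖jet 0 (l + j) (shiftMoll φ (η ε) 0)‖ * ∏ i, ‖m ε i‖ := by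
    refine (norm_jet_translate_le 0 l _ _).trans ?_
    rw [pow_zero, one_mul]
    exact norm_jet_iteratedLineDerivOp_le 0 l _ _
  have h3 := norm_jet_shiftMoll_zero_le φ (η ε) 0 (l + j)
  have h4 : ((η ε : ℝ)⁻¹) ^ (n + (l + j)) ≤ powNet (-(((n + j : ℕ) : ℝ) + l / 2)) ε := by
    have h5 : ((η ε : ℝ)⁻¹) ^ (n + (l + j)) ≤ ((Eps.sqrt ε : ℝ)⁻¹) ^ (n + (l + j)) := by
      have := h1 ε
      have := (η ε).2.1
      gcongr
    refine h5.trans ?_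
    have h6 : ((Eps.sqrt ε : ℝ)⁻¹) ^ (n + (l + j)) = powNet (-(((n + (l + j) : ℕ) : ℝ) / 2)) ε := by
      have h7 : (Eps.sqrt ε : ℝ) = (ε : ℝ) ^ (1 / 2 : ℝ) := Real.sqrt_eq_rpow _
      rw [h7, powNet, inv_pow, ← Real.rpow_natCast, ← Real.rpow_mul ε.2.1.le,
        Real.rpow_neg ε.2.1.le]
      congr 2
      ring
    rw [h6]
    refine powNet_le ?_ ε
    push_cast
    linarith [Nat.cast_nonneg (α := ℝ) n, Nat.cast_nonneg (α := ℝ) j]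
  calc (∏ i, ‖m ε i‖)⁻¹ * ‖jet 0 l (translate (x ε) (∂^{m ε} (shiftMoll φ (η ε) 0)))‖
      ≤ (∏ i, ‖m ε i‖)⁻¹ * (‖jet 0 (l + j) (shiftMoll φ (η ε) 0)‖ * ∏ i, ‖m ε i‖) := by gcongr
    _ = ((∏ i, ‖m ε i‖)⁻¹ * ∏ i, ‖m ε i‖) * ‖jet 0 (l + j) (shiftMoll φ (η ε) 0)‖ := by ring
    _ ≤ 1 * (((η ε : ℝ)⁻¹) ^ (n + (l + j)) * ‖jet 0 (l + j) φ‖) := by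
        gcongr
        exact inv_mul_prod_norm_le_one _
    _ ≤ 1 * (powNet (-(((n + j : ℕ) : ℝ) + l / 2)) ε * ‖jet 0 (l + j) φ‖) := by gcongr
    _ = _ := by ring

theorem isNegl_mollify_error {φ : 𝓢(Eu n, ℂ)} (hφ : IsMollifier φ) {S : Eps → 𝓢(Eu n, ℂ)} {N : ℕ}
    (hS : ∀ l, (fun ε => ‖jet 0 l (S ε)‖) =O[toZero] powNet (-(N : ℝ))) {η : Eps → Eps}
    (h2 : ∀ ε, (η ε : ℝ) ^ 4 ≤ ε) {j : ℕ} (x : Eps → Eu n) (m : Eps → Fin j → Eu n) :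
    IsNegl fun ε => (∏ i, ‖m ε i‖)⁻¹ * ‖(∂^{m ε} (S ε) : 𝓢(Eu n, ℂ)) (x ε)
      - ∫ z, φ z * (∂^{m ε} (S ε) : 𝓢(Eu n, ℂ)) (x ε - (η ε : ℝ) • z)‖ := by
  intro q
  -- As `η⁴ ≤ ε`, Taylor order `r` yields `η^r ≤ ε^(q+N)`, which pays for the growth `ε^(-N)` shared
  -- by all derivatives of `S ε`.
  set r := 4 * (q + N) with hr
  set M := ∫ z, (1 + ‖z‖) ^ (0 + r + 1) * ‖φ z‖ with hM
  have hM0 : 0 ≤ M := integral_nonneg fun z => by positivity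
  have h : (fun ε => (∏ i, ‖m ε i‖)⁻¹ * ‖(∂^{m ε} (S ε) : 𝓢(Eu n, ℂ)) (x ε)
      - ∫ z, φ z * (∂^{m ε} (S ε) : 𝓢(Eu n, ℂ)) (x ε - (η ε : ℝ) • z)‖)
      =O[toZero] fun ε => ‖jet 0 (r + 1 + j) (S ε)‖ * powNet ((q + N : ℕ) : ℝ) ε := by
    refine IsBigO.of_bound M (Eventually.of_forall fun ε => ?_)
    have hp : 0 ≤ ∏ i, ‖m ε i‖ := Finset.prod_nonneg fun i _ => norm_nonneg _
    have hη := (η ε).2.1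
    have hε := ε.2.1
    rw [norm_mul, norm_mul, norm_norm, norm_norm, norm_powNet, powNet_natCast,
      Real.norm_of_nonneg (inv_nonneg.2 hp)]
    have h3 := hφ.norm_sub_integral_reflect_le r (∂^{m ε} (S ε)) (η ε) (x ε)
    have h4 := norm_jet_iteratedLineDerivOp_le 0 (r + 1) (m ε) (S ε)
    have h5 : (η ε : ℝ) ^ (r + 1) ≤ (ε : ℝ) ^ (q + N) := by
      calc (η ε : ℝ) ^ (r + 1) ≤ (η ε : ℝ) ^ r :=
            pow_le_pow_of_le_one hη.le (η ε).2.2 (Nat.le_succ r)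
        _ = ((η ε : ℝ) ^ 4) ^ (q + N) := by rw [hr, pow_mul]
        _ ≤ _ := pow_le_pow_left₀ (by positivity) (h2 ε) _
    calc _ ≤ (∏ i, ‖m ε i‖)⁻¹ * (M * (‖jet 0 (r + 1 + j) (S ε)‖ * ∏ i, ‖m ε i‖)
          * (ε : ℝ) ^ (q + N)) := by
          refine mul_le_mul_of_nonneg_left (h3.trans ?_) (inv_nonneg.2 hp)
          gcongr
      _ = ((∏ i, ‖m ε i‖)⁻¹ * ∏ i, ‖m ε i‖) * (M * (‖jet 0 (r + 1 + j) (S ε)‖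
          * (ε : ℝ) ^ (q + N))) := by ring
      _ ≤ 1 * (M * (‖jet 0 (r + 1 + j) (S ε)‖ * (ε : ℝ) ^ (q + N))) := by
          gcongr
          exact inv_mul_prod_norm_le_one _
      _ = _ := one_mul _
  refine h.trans (((hS _).mul (isBigO_refl _ _)).trans ?_)
  rw [powNet_mul]
  exact powNet_isBigO (by push_cast; linarith)

/-- Insert the mollification of `θ a_ε` at scale `η`. It is close to `θ a_ε` by the vanishing
moments, using `η⁴ ≤ ε`, and close to `θ w * φ_η` because the mollifiers at scale `η` form slow
nets, using `√ε ≤ η`. As this holds along arbitrary nets of points and directions, it is uniform. -/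
theorem ActsLike.eventually_norm_sub_le {φ : 𝓢(Eu n, ℂ)} (hφ : IsMollifier φ) (hT : ActsLike w T)
    (hTv : IsIntegralOn v T) (ha : v.IsRep a) (hθ : tsupport θ ⊆ V) {N : ℕ}
    (hreg : ∀ j, (fun ε => supDeriv (tsupport θ) j (a ε)) =O[toZero] powNet (-(N : ℝ)))
    {η : Eps → Eps} (h1 : ∀ ε, (Eps.sqrt ε : ℝ) ≤ η ε) (h2 : ∀ ε, (η ε : ℝ) ^ 4 ≤ ε) (j q : ℕ) :
    ∀ᶠ ε in toZero, ∀ x, ‖iteratedFDeriv ℝ j (testSchwartz (cut θ hθ (a ε))) x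
      - iteratedFDeriv ℝ j (fun x => locForm w θ (shiftMoll φ (η ε) x)) x‖ ≤ (ε : ℝ) ^ q := by
  set S : Eps → 𝓢(Eu n, ℂ) := fun ε => testSchwartz (cut θ hθ (a ε)) with hS
  obtain ⟨C, hC, M, hM⟩ := exists_jet_bound_locForm w θ
  let D : Eps → Eu n → ContinuousMultilinearMap ℝ (fun _ : Fin j => Eu n) ℂ := fun ε x =>
    iteratedFDeriv ℝ j (S ε) x - iteratedFDeriv ℝ j (fun x => locForm w θ (shiftMoll φ (η ε) x)) x
  have key : ∀ y : Eps → Eu n × (Fin j → Eu n),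
      IsNegl fun ε => (∏ i, ‖(y ε).2 i‖)⁻¹ * ‖D ε (y ε).1 (y ε).2‖ := by
    intro y
    set x : Eps → Eu n := fun ε => (y ε).1
    set m : Eps → Fin j → Eu n := fun ε => (y ε).2
    have n1 := hT.isNegl_sub hTv ha hθ (isBigO_jet_translate_shiftMoll φ h1 x m)
    have n2 := isNegl_mollify_error hφ (isBigO_jet_cut hθ hreg) h2 x m
    refine (n2.add (isNegl_norm.2 n1)).of_le 1 (Eventually.of_forall fun ε => ?_)
    have hp : 0 ≤ ∏ i, ‖m ε i‖ := Finset.prod_nonneg fun i _ => norm_nonneg _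
    rw [one_mul, norm_mul, norm_norm, Real.norm_of_nonneg (inv_nonneg.2 hp)]
    refine le_trans ?_ (Real.le_norm_self _)
    set c : ℂ := (((∏ i, ‖m ε i‖)⁻¹ : ℝ) : ℂ) with hc
    have hcn : ‖c‖ = (∏ i, ‖m ε i‖)⁻¹ := by
      rw [hc, Complex.norm_real, Real.norm_of_nonneg (inv_nonneg.2 hp)]
    have e1 : iteratedFDeriv ℝ j (fun x => locForm w θ (shiftMoll φ (η ε) x)) (x ε) (m ε)
        = (-1) ^ j * locForm w θ (translate (x ε) (∂^{m ε} (shiftMoll φ (η ε) 0))) := by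
      obtain ⟨f₀, hf₀, hf₁⟩ := exists_shiftMoll_eq_translate φ (η ε)
      rw [← hf₀]
      simp only [hf₁]
      exact iteratedFDeriv_apply_translate hM f₀ (m ε) (x ε)
    have e2 : iteratedFDeriv ℝ j (S ε) (x ε) (m ε) = (∂^{m ε} (S ε) : 𝓢(Eu n, ℂ)) (x ε) :=
      (SchwartzMap.iteratedLineDerivOp_eq_iteratedFDeriv ..).symm
    have e3 : D ε (x ε) (m ε) = iteratedFDeriv ℝ j (S ε) (x ε) (m ε)
        - iteratedFDeriv ℝ j (fun x => locForm w θ (shiftMoll φ (η ε) x)) (x ε) (m ε) := rfl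
    have e4 := schwartzForm_translate_iteratedLineDerivOp (m ε) φ (S ε) (η ε) (x ε)
    change _ * ‖D ε (x ε) (m ε)‖ ≤ _
    rw [e3, e1, e2, ← hcn, ← norm_mul, map_smul, map_smul, e4, ← smul_sub, smul_eq_mul]
    set I := ∫ z, φ z * (∂^{m ε} (S ε) : 𝓢(Eu n, ℂ)) (x ε - (η ε : ℝ) • z)
    set B := (∂^{m ε} (S ε) : 𝓢(Eu n, ℂ)) (x ε)
    set A := locForm w θ (translate (x ε) (∂^{m ε} (shiftMoll φ (η ε) 0)))
    -- The split into mollification error `B - I` and the difference of the two forms on the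
    -- differentiated mollifier. The sign `(-1)^j` comes from differentiating in the translation
    -- parameter and squares to `1`.
    have e5 : c * (B - (-1) ^ j * A) = c * (B - I) + (-1) ^ j * (c * ((-1) ^ j * I - A)) := by
      have : ((-1 : ℂ) ^ j) * (-1) ^ j = 1 := by rw [← mul_pow]; simp
      linear_combination (-c * I) * this
    rw [e5]
    refine (norm_add_le _ _).trans (le_of_eq ?_)
    rw [norm_mul ((-1) ^ j : ℂ), norm_pow, norm_neg, norm_one, one_pow, one_mul, norm_mul, norm_mul,
      norm_mul, norm_sub_rev A]
  filter_upwards [eventually_forall_le_of_isNegl 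
    (P := fun ε (y : Eu n × (Fin j → Eu n)) => (∏ i, ‖y.2 i‖)⁻¹ * ‖D ε y.1 y.2‖) key q] with ε hε x
  refine ContinuousMultilinearMap.opNorm_le_bound (pow_nonneg ε.2.1.le q) fun m => ?_
  have h3 := hε (x, m)
  -- If some direction is zero, the normalized estimate is void because `0⁻¹ = 0`; but then the
  -- multilinear map vanishes as well.
  by_cases hm : ∏ i, ‖m i‖ = 0
  · obtain ⟨i, -, hi⟩ := Finset.prod_eq_zero_iff.1 hm
    rw [hm, mul_zero, (D ε x).map_coord_zero i (norm_eq_zero.1 hi), norm_zero]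
  · have hp : 0 < ∏ i, ‖m i‖ :=
      lt_of_le_of_ne (Finset.prod_nonneg fun i _ => norm_nonneg _) (Ne.symm hm)
    rwa [inv_mul_le_iff₀ hp, mul_comm] at h3

/-- The same `θ a_ε` approximates `θ w * φ_η` at the two scales `η = ε^(1/2)` and `η = ε^(1/4)`.
Eliminating it compares regularizations of `θ w` at a scale and its square, and the resulting smooth
limit equals `w` near the point. -/
theorem ActsLike.distrSingSupp_subset {φ : 𝓢(Eu n, ℂ)} (hφ : IsMollifier φ) (hT : ActsLike w T) :
    distrSingSupp w ⊆ dualSingSupp T := by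
  refine fun x hx => ⟨hx.1, fun V hV hxV ⟨v, ⟨a, ha, hreg⟩, hTv⟩ => ?_⟩
  obtain ⟨θ, hθV, U, hxU, hUV, hθ⟩ := exists_cutoff (Ω := Ω) (K := {x}) isCompact_singleton
    V.isOpen hV (Set.singleton_subset_iff.2 hxV)
  have hUΩ : U ≤ Ω := fun y hy => hV (hUV hy)
  obtain ⟨N, hN⟩ := hreg (suppIn θ hθV)
  obtain ⟨C, hC, M, hM⟩ := exists_jet_bound_locForm w θ
  let F : Eps → Eu n → ℂ := fun ε x => locForm w θ (shiftMoll φ ε x)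
  have hF : ∀ ε, ContDiff ℝ ∞ (F ε) := fun ε => contDiff_apply_shiftMoll hM φ ε
  have hsqrt : ∀ ε : Eps, (Eps.sqrt ε : ℝ) ≤ Eps.sqrt (Eps.sqrt ε) := fun ε => by
    have h1 := Eps.sq_sqrt (Eps.sqrt ε)
    have h2 := (Eps.sqrt (Eps.sqrt ε)).2
    nlinarith [h2.1, h2.2]
  have hclose : ∀ j : ℕ, ∀ᶠ ε in toZero, ∀ x,
      ‖iteratedFDeriv ℝ j (fun x => F (Eps.sq ε) x - F ε x) x‖ ≤ ε := by
    intro j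
    have c1 := hT.eventually_norm_sub_le hφ hTv ha hθV hN (η := Eps.sqrt) (fun _ => le_rfl)
      (fun ε => by
        have h1 := Eps.sq_sqrt ε
        have h2 := ε.2
        calc (Eps.sqrt ε : ℝ) ^ 4 = ((Eps.sqrt ε : ℝ) ^ 2) ^ 2 := by ring
          _ = (ε : ℝ) ^ 2 := by rw [h1]
          _ ≤ ε := by nlinarith [h2.1, h2.2]) j 1
    have c2 := hT.eventually_norm_sub_le hφ hTv ha hθV hN (η := fun ε => Eps.sqrt (Eps.sqrt ε))
      hsqrt (fun ε => by
        calc (Eps.sqrt (Eps.sqrt ε) : ℝ) ^ 4 = ((Eps.sqrt (Eps.sqrt ε) : ℝ) ^ 2) ^ 2 := by ring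
          _ = (ε : ℝ) := by rw [Eps.sq_sqrt, Eps.sq_sqrt]
          _ ≤ (ε : ℝ) := le_rfl) j 1
    obtain ⟨δ, hδ, hc⟩ := eventually_toZero_iff.1 (c1.and c2)
    refine eventually_toZero_iff.2 ⟨min δ (1 / 2), by positivity, fun ε hε x => ?_⟩
    have hε0 := ε.2.1
    have hεδ : (ε : ℝ) < δ := hε.trans_le (min_le_left _ _)
    have hε2 : (ε : ℝ) < 1 / 2 := hε.trans_le (min_le_right _ _)
    have h4 : ((Eps.sq (Eps.sq ε) : Eps) : ℝ) = (ε : ℝ) ^ 4 := by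
      rw [Eps.coe_sq, Eps.coe_sq]
      ring
    have h5 : (ε : ℝ) ^ 4 ≤ ε / 2 := by
      have : (ε : ℝ) ^ 2 ≤ 1 / 2 * ε := by nlinarith
      nlinarith [sq_nonneg (ε : ℝ)]
    -- At parameter `ε⁴` the two scales are `ε²` and `ε`. Both errors are at most `ε⁴ ≤ ε / 2`, so
    -- they add up to at most `ε`.
    obtain ⟨d1, d2⟩ := hc (Eps.sq (Eps.sq ε)) (by rw [h4]; linarith)
    have d1 := d1 x
    have d2 := d2 x
    simp only [Eps.sqrt_sq, pow_one, h4] at d1 d2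
    have e : iteratedFDeriv ℝ j (fun x => F (Eps.sq ε) x - F ε x) x
        = iteratedFDeriv ℝ j (F (Eps.sq ε)) x - iteratedFDeriv ℝ j (F ε) x :=
      iteratedFDeriv_sub_apply ((hF _).contDiffAt.of_le (by exact_mod_cast le_top))
        ((hF _).contDiffAt.of_le (by exact_mod_cast le_top))
    rw [e, ← sub_sub_sub_cancel_left _ _ (iteratedFDeriv ℝ j
      (testSchwartz (cut θ hθV (a (Eps.sq (Eps.sq ε))))) x)]
    refine (norm_sub_le _ _).trans ((add_le_add d2 d1).trans ?_)
    linarith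
  obtain ⟨g, hg, η, hη, hlim⟩ := exists_smooth_limit hF hclose
  refine hx.2 U hUΩ (hxU rfl) ⟨⟨g, hg.contDiffOn⟩, fun f hf => ?_⟩
  have hwf : locForm w θ (testSchwartz f) = w f := by
    rw [locForm_apply]
    congr 1
    ext y
    change θ y * f y = f y
    by_cases hy : y ∈ tsupport f
    · rw [hθ y (hf hy), one_mul]
    · rw [image_eq_zero_of_notMem_tsupport hy, mul_zero]
  have hl := hlim f f.contDiff.continuous f.hasCompactSupport
  -- For one fixed test function order `1` suffices: the pairing with `F (η i)` tends to `w f`.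
  -- Comparing with the other limit identifies `w` with `g` on `U`.
  obtain ⟨A, hA, hAb⟩ := hφ.exists_norm_apply_sub_integral_le hM 0
  have hl' : Tendsto (fun i => ∫ x, F (η i) x * f x) atTop (𝓝 (w f)) := by
    rw [tendsto_iff_norm_sub_tendsto_zero]
    have hη' : Tendsto (fun i => A * ‖jet 0 (M + 0 + 1) (testSchwartz f)‖ * (η i : ℝ)) atTop
        (𝓝 0) := by
      have := (tendsto_comap.comp hη).const_mul (A * ‖jet 0 (M + 0 + 1) (testSchwartz f)‖)
      rwa [mul_zero] at this
    refine squeeze_zero (fun i => norm_nonneg _) (fun i => ?_) hη'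
    have := hAb (η i) (testSchwartz f)
    rw [hwf, norm_sub_rev, zero_add, pow_one] at this
    exact this
  exact tendsto_nhds_unique hl' hl

end

end

end Colombeau

theorem mainTheorem9 {n : ℕ} (Ω : Opens (Eu n)) (φ : 𝓢(Eu n, ℂ)) (hφ : IsMollifier φ) :
    -- (i)
    (∀ w : Distr Ω,
      (∃! T, IsDirect w T) ∧ (∃! u, IsEmb φ w u) ∧
      (∃! T : DualGc Ω, IsIntegralOn (iota φ w) T) ∧
      ∀ u ∈ GcInf Ω, iotaD w u = iota' φ w u) ∧
    -- (ii)
    (∀ w : DistrC Ω,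
      (∃! T, IsDirectC w T) ∧ (∃! u, IsEmbC φ w u) ∧
      (∃! T, IsIntegralC (iotaC φ w) T) ∧
      ∀ u ∈ GInf Ω, iotaDC w u = iotaC' φ w u) ∧
    -- (iii)
    (∀ w : 𝓢'(Eu n, ℂ),
      (∃! T, IsDirectS w T) ∧ (∃! u, IsEmbS φ w u) ∧
      (∃! T, IsIntegralTau (iotaS φ w) T) ∧
      ∀ u ∈ GSInf n, iotaDS w u = iotaS' φ w u) ∧
    -- (iv)
    (∀ w : Distr Ω,
      (distrSupp w = (iota φ w).supp ∧ (iota φ w).supp = dualSupp (iota' φ w) ∧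
        dualSupp (iota' φ w) = dualSupp (iotaD w)) ∧
      (distrSingSupp w = (iota φ w).singSupp ∧
        (iota φ w).singSupp = dualSingSupp (iota' φ w) ∧
        dualSingSupp (iota' φ w) = dualSingSupp (iotaD w))) := by
  refine ⟨fun w => ⟨existsUnique_isDirect w, existsUnique_isEmb φ w, existsUnique_isIntegralOn _,
    fun u hu => (actsLike_iotaD w).eq_of_mem_gcInf (actsLike_iota' hφ w) hu⟩,
    fun w => ⟨existsUnique_isDirectC w, existsUnique_isEmbC φ w, existsUnique_isIntegralC _,
      fun u hu => iotaDC_eq_iotaC' hφ w hu⟩,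
    fun w => ⟨existsUnique_isDirectS w, existsUnique_isEmbS φ w, existsUnique_isIntegralTau _,
      fun u hu => iotaDS_eq_iotaS' hφ w hu⟩, fun w => ?_⟩
  have h_int := isIntegralOn_iota' φ w
  -- For `ι(w)` and `ι'(w)` the inclusions close a cycle: `w` is contained in `ι'(w)`, this in
  -- `ι(w)`, and this in `w`. The direct functional is compared with `w` separately. Singular
  -- supports follow the same pattern.
  have s1 : distrSupp w = (iota φ w).supp := ((actsLike_iota' hφ w).distrSupp_subset.trans
    (dualSupp_subset_of_isIntegralOn h_int)).antisymm (supp_iota_subset φ w)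
  have s2 : distrSupp w = dualSupp (iota' φ w) := (actsLike_iota' hφ w).distrSupp_subset.antisymm
    ((dualSupp_subset_of_isIntegralOn h_int).trans (supp_iota_subset φ w))
  have s3 : distrSupp w = dualSupp (iotaD w) :=
    (actsLike_iotaD w).distrSupp_subset.antisymm (dualSupp_iotaD_subset w)
  have t1 : distrSingSupp w = (iota φ w).singSupp :=
    (((actsLike_iota' hφ w).distrSingSupp_subset hφ).trans
      (dualSingSupp_subset_of_isIntegralOn h_int)).antisymm (singSupp_iota_subset φ w)
  have t2 : distrSingSupp w = dualSingSupp (iota' φ w) :=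
    ((actsLike_iota' hφ w).distrSingSupp_subset hφ).antisymm
      ((dualSingSupp_subset_of_isIntegralOn h_int).trans (singSupp_iota_subset φ w))
  have t3 : distrSingSupp w = dualSingSupp (iotaD w) :=
    ((actsLike_iotaD w).distrSingSupp_subset hφ).antisymm (dualSingSupp_iotaD_subset w)
  exact ⟨⟨s1, s1.symm.trans s2, s2.symm.trans s3⟩, t1, t1.symm.trans t2, t2.symm.trans t3⟩
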